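/- Fix a smooth radial function $\chi:\mathbb R^2\to[0,1]$ supported in $\{1/2\le|\xi|\le 2\}$ with $\sum_{k\in\mathbb Z}\chi(2^{-k}\xi)=1$ for all $\xi\ne 0$, and put $\chi_j(\xi)=\chi(2^{-j}\xi)$ for $j\ge 1$. For $a\in C^{20}(\mathbb R^2;\mathbb C)$ let $$\|a\|_{S^0}=\max_{|\alpha|\le 20}\ \sup_{\xi\in\mathbb R^2}(1+|\xi|)^{|\alpha|}|\partial^\alpha a(\xi)|.$$ For $F:\mathbb R^2\times\mathbb R^2\to\mathbb C$, with $\widehat F(\xi,\zeta)=\int e^{-i(\langle y,\xi\rangle+\langle z,\zeta\rangle)}F(y,z)\,d(y,z)$, and a fixed choice of the sign $\pm$, let $$\mathcal T_jF(x,t)=\int_{\mathbb R^4}e^{i\langle x,\xi+\zeta\rangle\pm it(|\xi|+|\zeta|)}\chi_j(\xi)a(t\xi)\chi_j(\zeta)a(t\zeta)\widehat F(\xi,\zeta)\,d(\xi,\zeta).$$ Let $N(S,\delta)$ be the minimal number of intervals of length $\delta$ needed to cover $S\subset\mathbb R$, and for $E\subset[1,2]$ let $$\chi^E_{\mathrm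 A,\gamma}(\delta)=\sup_{|I|\ge\delta}\Big(\frac{\delta}{|I|}\Big)^{\gamma}N(E\cap I,\delta),$$ where $I$ runs over subintervals of $[1,2]$. Let $w_\gamma(y,z)=|y-z|^{-(2\gamma-1)}$ for $y\neq z$ in $\mathbb R^2$, and let $L^2(w_\gamma)$ be the space with norm $\|F\|_{L^2(w_\gamma)}=(\int_{\mathbb R^4}|F|^2w_\gamma)^{1/2}$. Equip $\mathbb R^2\times E$, $E$ finite, with the product of Lebesgue measure and counting measure. **Proposition.** There is a constant $c>0$ (depending only on the fixed function $\chi$) such that the following holds. Let $\frac12\le\gamma\le1$; let $a\in C^{20}(\mathbb R^2;\mathbb C)$ satisfy $\|a\|_{S^0}\le 1$ and $a(\xi)=0$ unless $0<\xi_1<2^{-10}\xi_2$; let $j\ge1$ be an integer; and let $E\subset[1,2]$ be a finite set that is uniformly $2^{-j}$-separated, i.e. $E-E\subset 2^{-j}\mathbb Z$. Then, for either choice of the sign, $\mathcal T_j$ (defined by the above formula on the dense subspace $L^1(\mathbb R^4)\cap L^2(w_\gamma)$ of $L^2(w_\gamma)$) extends to a bounded linear operator from $L^2(w_\gamma)$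 to $L^2(\mathbb R^2\times E)$, and $$\|\mathcal T_jF\|_{L^2(\mathbb R^2\times E)}\le c\,\min\Big(\frac{j^{1/2}}{2\gamma-1},\,j\Big)\,2^j\,\big[\chi^E_{\mathrm A,\gamma}(2^{-j})\big]^{1/2}\,\|F\|_{L^2(w_\gamma)}\qquad(F\in L^2(w_\gamma)),$$ where the minimum is read as $j$ when $\gamma=\frac12$. -/

import Mathlib

open MeasureTheory
open scoped ENNReal

noncomputable section

namespace BilinearWave

/-- The Euclidean plane. -/
abbrev Plane : Type := EuclideanSpace ℝ (Fin 2)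

/-- A smooth radial function `χ` on the plane, supported in `1/2 ≤ |ξ| ≤ 2`, with `0 ≤ χ ≤ 1`
and `∑_{j ∈ ℤ} χ (2^{-j} ξ) = 1` for every `ξ ≠ 0`. -/
structure IsDyadicCutoff (χ : Plane → ℝ) : Prop where
  smooth : ContDiff ℝ (⊤ : ℕ∞) χ
  radial : ∀ ξ η : Plane, ‖ξ‖ = ‖η‖ → χ ξ = χ η
  supp : tsupport χ ⊆ {ξ : Plane | 1 / 2 ≤ ‖ξ‖ ∧ ‖ξ‖ ≤ 2}
  nonneg : ∀ ξ, 0 ≤ χ ξ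
  le_one : ∀ ξ, χ ξ ≤ 1
  sum_eq_one : ∀ ξ : Plane, ξ ≠ 0 → HasSum (fun k : ℤ => χ ((2 : ℝ) ^ (-k) • ξ)) 1

/-- The frequency localization `χ_j (ξ) = χ (2^{-j} ξ)`, for `j ≥ 1`. -/
def dyadicPiece (χ : Plane → ℝ) (j : ℕ) (ξ : Plane) : ℝ :=
  χ ((2 : ℝ) ^ (-(j : ℤ)) • ξ)

/-- The partial derivative in the `i`-th coordinate direction. -/
def partialDeriv (i : Fin 2) (a : Plane → ℂ) (ξ : Plane) : ℂ :=
  fderiv ℝ a ξ (EuclideanSpace.single i 1)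

/-- The derivative `∂^α`, for a multi-index `α`. -/
def multiDeriv (α : Fin 2 → ℕ) (a : Plane → ℂ) : Plane → ℂ :=
  (partialDeriv 0)^[α 0] ((partialDeriv 1)^[α 1] a)

/-- The symbol norm of order `m`: the maximum over `|α| ≤ 20` (that is, `10 d` with `d = 2`) of
`sup_ξ (1 + |ξ|)^{-(m - |α|)} |∂^α a (ξ)|`. -/
def symbolNorm (m : ℝ) (a : Plane → ℂ) : ℝ≥0∞ :=
  ⨆ (α : Fin 2 → ℕ) (_ : α 0 + α 1 ≤ 20) (ξ : Plane),
    ENNReal.ofReal ((1 + ‖ξ‖) ^ (-(m - ((α 0 + α 1 : ℕ) : ℝ)))) * ‖multiDeriv α a ξ‖ₑ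

/-- The symbol class of order `m`. -/
def IsSymbol (m : ℝ) (a : Plane → ℂ) : Prop :=
  ContDiff ℝ 20 a ∧ symbolNorm m a < ∞

/-- The Fourier transform `F̂ (ξ, ζ) = ∫ e^{-i (⟨y, ξ⟩ + ⟨z, ζ⟩)} F (y, z) d(y, z)`. -/
def fourierPair (F : Plane × Plane → ℂ) (p : Plane × Plane) : ℂ :=
  ∫ q : Plane × Plane,
    Complex.exp (-Complex.I * ((inner ℝ q.1 p.1 + inner ℝ q.2 p.2 : ℝ) : ℂ)) * F q

/-- The bilinear operator `T_j F (x, t)`, with `σ = ± 1` the sign in the phase: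
`∫ e^{i ⟨x, ξ + ζ⟩ + i σ t (|ξ| + |ζ|)} χ_j (ξ) a (t ξ) χ_j (ζ) a (t ζ) F̂ (ξ, ζ) d(ξ, ζ)`. -/
def bilinearOp (χ : Plane → ℝ) (a : Plane → ℂ) (σ : ℝ) (j : ℕ) (F : Plane × Plane → ℂ)
    (x : Plane) (t : ℝ) : ℂ :=
  ∫ p : Plane × Plane,
    Complex.exp (Complex.I *
        ((inner ℝ x (p.1 + p.2) + σ * t * (‖p.1‖ + ‖p.2‖) : ℝ) : ℂ)) *
      (dyadicPiece χ j p.1 : ℂ) * a (t • p.1) * (dyadicPiece χ j p.2 : ℂ) * a (t • p.2) *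
      fourierPair F p

/-- A finite set `E` is uniformly `δ`-separated if `E - E ⊆ δ ℤ`. -/
def UniformlySeparated (δ : ℝ) (E : Finset ℝ) : Prop :=
  ∀ s ∈ E, ∀ t ∈ E, ∃ n : ℤ, s - t = δ * n

/-- The minimal number `N (S, δ)` of intervals of length `δ` needed to cover `S`. -/
def intervalCoveringNumber (S : Set ℝ) (δ : ℝ) : ℕ∞ :=
  ⨅ (P : Finset ℝ) (_ : S ⊆ ⋃ u ∈ P, Set.Icc u (u + δ)), (P.card : ℕ∞)

/-- The `γ`-Assouad characteristic of `E` at scale `δ`: the supremum of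
`(δ / |I|)^γ N (E ∩ I, δ)` over the intervals `I = [u, v]` in `[1, 2]` of length at least `δ`. -/
def assouadChar (γ : ℝ) (E : Set ℝ) (δ : ℝ) : ℝ≥0∞ :=
  ⨆ (u : ℝ) (v : ℝ) (_ : 1 ≤ u ∧ v ≤ 2 ∧ δ ≤ v - u),
    ENNReal.ofReal ((δ / (v - u)) ^ γ) *
      (intervalCoveringNumber (E ∩ Set.Icc u v) δ : ℝ≥0∞)

/-- The measure `w_γ (y, z) d(y, z)`, with `w_γ (y, z) = |y - z|^{-(2γ - 1)}` off the diagonal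
(which is a null set). -/
def weightedMeasure (γ : ℝ) : Measure (Plane × Plane) :=
  volume.withDensity fun p => ENNReal.ofReal (‖p.1 - p.2‖ ^ (-(2 * γ - 1)))

/-- The product of Lebesgue measure on the plane and counting measure on `E`. -/
def planeCountMeasure (E : Finset ℝ) : Measure (Plane × E) :=
  (volume : Measure Plane).prod Measure.count

/-- The factor `min (j^{1/2} / (2γ - 1), j)`, equal to `j` at `γ = 1/2`. -/
def lossFactor (γ : ℝ) (j : ℕ) : ℝ :=
  if γ = 1 / 2 then (j : ℝ) else min (Real.sqrt j / (2 * γ - 1)) j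

end BilinearWave

end

/-! ### Plancherel in the normalizations of the two Fourier integrals -/

namespace BilinearWave

/-! Write N = 2^j and decompose the frequency pairs (ξ, ζ) dyadically according to their angle θ =
2^{-l}, with 0 ≤ l ≤ j/2 and the last piece containing all smaller angles. The normalized
determinant of (ξ, ζ) measures the angle.

For one angle, Plancherel in x reduces the space-time norm to the fibres ξ + ζ = η. On a fibre the
operator takes coefficients of a function of ξ against e^{±it(|ξ|+|η-ξ|)}, t ∈ E, so by duality a
Bessel inequality for these exponentials suffices. Along horizontal lines the phase has derivative
comparable to θ, is injective on either side of its critical point, and ranges over an interval of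
length O(θ²N). Changing variables to the phase and inserting a Gaussian gives the Bessel constant
Q·θN per line, hence Q·θN² per fibre, where Q bounds the number of points of E in any interval of
length ℓ = 1/(θ²N). At the last angle no lower bound for the derivative is available, but there ℓ ≥
1/2, so E has at most 2Q points and Cauchy–Schwarz is enough. The dependence of the amplitude on t
is removed by summation by parts (`IsBesselFamily.mul_lipschitz`). The outcome is
`sum_lintegral_freqOp_sq_le`.

The weight comes from the other side. Multiplying F by y_i - z_i amounts to applying ∂_{ξ_i} -
∂_{ζ_i} to the symbol. On the phase this produces ξ_i/|ξ| - ζ_i/|ζ| = O(θ), and on the cutoffs it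
costs at most O(1/(θN)) = O(θ), because θ²N ≥ 1. Splitting F at |y - z| = θ and writing the far part
as a combination of (y_i - z_i)G_i therefore improves the norm of F to one with weight min(1,
θ²/|y-z|²) (`sum_lintegral_piece_le`).

Finally ℓ = θ^{-2}2^{-j}, so Q is at most a constant times χ^E_{A,γ} θ^{-2γ}, and the squared bound
for one angle carries 4^j χ^E_{A,γ} θ^{-s} min(1, θ²/r²) with s = 2γ - 1 and r = |y-z|. Each such
term is at most r^{-s}, and for s > 0 their sum over θ is O(r^{-s}/s). Cauchy–Schwarz over the at
most j angles costs another factor j, and this gives the loss (`succ_mul_sum_angleWeight_le`). The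
bound on integrable functions passes to the whole weighted space by density. -/

open FourierTransform SchwartzMap in
/-- The `L²` Fourier transform agrees with the Fourier integral on integrable functions. -/
theorem fourier_toLp_ae_eq {V : Type*} [NormedAddCommGroup V] [InnerProductSpace ℝ V]
    [FiniteDimensional ℝ V] [MeasurableSpace V] [BorelSpace V] {f : V → ℂ}
    (h1 : Integrable f) (h2 : MemLp f 2) :
    (𝓕 (h2.toLp f) : Lp ℂ 2 (volume : Measure V)) =ᵐ[volume] 𝓕 f := by
  have hcont : Continuous (𝓕 f) :=
    VectorFourier.fourierIntegral_continuous Real.continuous_fourierChar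
      (by exact continuous_inner) h1
  -- Both sides are locally integrable, so it suffices to test against smooth compactly supported g.
  -- The transform can be moved onto g on either side: on the left through tempered distributions,
  -- on the right by Fubini.
  refine ae_eq_of_integral_contDiff_smul_eq
    ((Lp.memLp _).locallyIntegrable (by norm_num)) hcont.locallyIntegrable ?_
  intro g hg hgc
  have hgc' : HasCompactSupport (fun x => (g x : ℂ)) :=
    hgc.comp_left (g := fun r : ℝ => (r : ℂ)) Complex.ofReal_zero
  have hg' : ContDiff ℝ (⊤ : ℕ∞) (fun x => (g x : ℂ)) := Complex.ofRealCLM.contDiff.comp hg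
  have key := DFunLike.congr_fun (Lp.fourier_toTemperedDistribution_eq (h2.toLp f))
    (hgc'.toSchwartzMap hg')
  rw [TemperedDistribution.fourier_apply, Lp.toTemperedDistribution_apply,
    Lp.toTemperedDistribution_apply] at key
  have e1 : ∫ x, g x • ((𝓕 (h2.toLp f) : Lp ℂ 2 (volume : Measure V)) : V → ℂ) x
      = ∫ x, (hgc'.toSchwartzMap hg') x • ((𝓕 (h2.toLp f) : Lp ℂ 2 (volume : Measure V)) : V → ℂ) x := by
    refine integral_congr_ae (Filter.Eventually.of_forall fun x => ?_)
    simp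
  rw [e1, ← key]
  have e2 : ∫ x, (𝓕 (hgc'.toSchwartzMap hg')) x • (h2.toLp f : V → ℂ) x
      = ∫ x, (𝓕 (hgc'.toSchwartzMap hg')) x • f x := by
    refine integral_congr_ae ?_
    filter_upwards [h2.coeFn_toLp] with x hx
    rw [hx]
  rw [e2]
  have h3 := VectorFourier.integral_fourierIntegral_smul_eq_flip (e := Real.fourierChar)
    (μ := (volume : Measure V)) (ν := (volume : Measure V)) (L := innerₗ V)
    (f := fun x => (g x : ℂ)) (g := f)
    Real.continuous_fourierChar continuous_inner
    (hg'.continuous.integrable_of_hasCompactSupport hgc') h1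
  have h4 : ∀ x, (𝓕 (hgc'.toSchwartzMap hg')) x =
      VectorFourier.fourierIntegral Real.fourierChar volume (innerₗ V) (fun x => (g x : ℂ)) x := by
    intro x
    rw [SchwartzMap.fourier_coe]
    rfl
  simp_rw [h4]
  rw [h3]
  refine integral_congr_ae (Filter.Eventually.of_forall fun x => ?_)
  simp only [flip_innerₗ]
  rfl

theorem eLpNorm_two_sq {X : Type*} [MeasurableSpace X] {μ : Measure X} (f : X → ℂ) :
    eLpNorm f 2 μ ^ 2 = ∫⁻ x, ‖f x‖ₑ ^ 2 ∂μ := by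
  have := eLpNorm_nnreal_pow_eq_lintegral (f := f) (μ := μ) (p := 2) (by norm_num)
  simpa using this

open FourierTransform in
/-- Plancherel's theorem for integrable square-integrable functions. -/
theorem lintegral_fourier_sq {V : Type*} [NormedAddCommGroup V] [InnerProductSpace ℝ V]
    [FiniteDimensional ℝ V] [MeasurableSpace V] [BorelSpace V] {f : V → ℂ}
    (h1 : Integrable f) (h2 : MemLp f 2) :
    ∫⁻ x, ‖𝓕 f x‖ₑ ^ 2 = ∫⁻ x, ‖f x‖ₑ ^ 2 := by
  have hN := Lp.norm_fourier_eq (h2.toLp f)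
  have hE : eLpNorm (𝓕 f) 2 volume = eLpNorm f 2 volume := by
    rw [← eLpNorm_congr_ae (fourier_toLp_ae_eq h1 h2), ← eLpNorm_congr_ae h2.coeFn_toLp]
    rw [← Lp.enorm_def, ← Lp.enorm_def]
    rw [← ofReal_norm, ← ofReal_norm, hN]
  rw [← eLpNorm_two_sq, ← eLpNorm_two_sq, hE]

/-- The Fourier integral `x ↦ ∫ e^{i⟨x, η⟩} h(η) dη`. -/
noncomputable def expIntegral (h : Plane → ℂ) (x : Plane) : ℂ :=
  ∫ η, Complex.exp (Complex.I * (inner ℝ x η : ℝ)) * h η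

theorem lintegral_comp_smul' {V : Type*} [NormedAddCommGroup V] [NormedSpace ℝ V]
    [FiniteDimensional ℝ V] [MeasurableSpace V] [BorelSpace V] (μ : Measure V)
    [μ.IsAddHaarMeasure] (f : V → ℝ≥0∞) {R : ℝ} (hR : R ≠ 0) :
    ∫⁻ x, f (R • x) ∂μ = ENNReal.ofReal |(R ^ Module.finrank ℝ V)⁻¹| * ∫⁻ x, f x ∂μ := by
  have h := Measure.map_addHaar_smul μ hR
  have := (Homeomorph.smulOfNeZero R hR).toMeasurableEquiv.measurableEmbedding.lintegral_map
    (μ := μ) f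
  simp only [Homeomorph.toMeasurableEquiv_coe, Homeomorph.smulOfNeZero_apply] at this
  rw [← this]
  change ∫⁻ a, f a ∂(Measure.map (fun x => R • x) μ) = _
  rw [h, lintegral_smul_measure, smul_eq_mul]

/-- Plancherel after the dilation by -1/(2π), whose Jacobian produces (2π)². -/
theorem lintegral_expIntegral_sq {h : Plane → ℂ} (h1 : Integrable h) (h2 : MemLp h 2) :
    ∫⁻ x, ‖expIntegral h x‖ₑ ^ 2 =
      ENNReal.ofReal ((2 * Real.pi) ^ 2) * ∫⁻ η, ‖h η‖ₑ ^ 2 := by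
  have e : ∀ x, expIntegral h x = FourierTransform.fourier h ((-(2 * Real.pi)⁻¹ : ℝ) • x) := by
    intro x
    rw [Real.fourier_eq', expIntegral]
    refine integral_congr_ae (Filter.Eventually.of_forall fun η => ?_)
    simp only [smul_eq_mul]
    congr 2
    rw [inner_smul_right, real_inner_comm, mul_comm]
    congr 2
    field_simp
  simp_rw [e]
  rw [lintegral_comp_smul' volume (fun x => ‖FourierTransform.fourier h x‖ₑ ^ 2)
    (by have := Real.pi_pos; simp [this.ne']), lintegral_fourier_sq h1 h2]
  congr 2
  rw [finrank_euclideanSpace, Fintype.card_fin, abs_of_nonneg (by positivity)]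
  have := Real.pi_pos
  field_simp

/-- Reinterpretation of a function on the product as a function on the `L²` product. -/
theorem lintegral_fourierPair_sq {F : Plane × Plane → ℂ} (h1 : Integrable F) (h2 : MemLp F 2) :
    ∫⁻ p, ‖fourierPair F p‖ₑ ^ 2 =
      ENNReal.ofReal ((2 * Real.pi) ^ 4) * ∫⁻ q, ‖F q‖ₑ ^ 2 := by
  -- The product carries the sup norm, which is not an inner product norm; the `L²` product has the
  -- same measure and admits Plancherel.
  have mp := WithLp.volume_preserving_ofLp Plane Plane
  have emb : MeasurableEmbedding (WithLp.ofLp : WithLp 2 (Plane × Plane) → Plane × Plane) :=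
    (MeasurableEquiv.toLp 2 (Plane × Plane)).symm.measurableEmbedding
  set G : WithLp 2 (Plane × Plane) → ℂ := fun z => F z.ofLp with hG
  have g1 : Integrable G := (mp.integrable_comp_emb emb).2 h1
  have g2 : MemLp G 2 := h2.comp_measurePreserving mp
  have e : ∀ z : WithLp 2 (Plane × Plane), fourierPair F z.ofLp =
      FourierTransform.fourier G (((2 * Real.pi)⁻¹ : ℝ) • z) := by
    intro z
    rw [Real.fourier_eq', fourierPair, ← mp.integral_comp emb]
    refine integral_congr_ae (Filter.Eventually.of_forall fun w => ?_)
    simp only [smul_eq_mul, hG]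
    congr 2
    rw [inner_smul_right, WithLp.prod_inner_apply]
    push_cast
    field_simp
  rw [← mp.lintegral_comp_emb emb, ← mp.lintegral_comp_emb emb]
  simp_rw [e]
  rw [lintegral_comp_smul' volume (fun x => ‖FourierTransform.fourier G x‖ₑ ^ 2)
    (by have := Real.pi_pos; simp [this.ne']), lintegral_fourier_sq g1 g2]
  congr 2
  have : Module.finrank ℝ (WithLp 2 (Plane × Plane)) = 4 := by
    rw [(WithLp.linearEquiv 2 ℝ (Plane × Plane)).finrank_eq]
    simp [finrank_euclideanSpace]
  rw [this, abs_of_pos (by have := Real.pi_pos; positivity)]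
  have := Real.pi_pos
  field_simp

end BilinearWave

namespace BilinearWave

/-! ### Sums over separated times -/

/-- If every interval of length `ℓ` contains at most `Q` points of `E`, Gaussian sums over `E`
at scale `ℓ` are `O(Q)`. -/
theorem sum_gaussian_le {E : Finset ℝ} {ℓ Q : ℝ} (hℓ : 0 < ℓ)
    (hQ : ∀ s : ℝ, ((E.filter fun t => t ∈ Set.Icc s (s + ℓ)).card : ℝ) ≤ Q) (s : ℝ) :
    ∑ t ∈ E, Real.exp (-(s - t) ^ 2 / (4 * ℓ ^ 2)) ≤ 10 * Q := by
  -- Sort the points by the shell mℓ ≤ |s - t| < (m+1)ℓ. A shell is covered by two intervals of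
  -- length ℓ, hence has at most 2Q points, and on it the Gaussian is at most e^{-m²/4} ≤ (4/5)^m.
  -- The geometric series sums to 5.
  set k : ℝ → ℕ := fun t => ⌊|s - t| / ℓ⌋₊ with hk
  have hQ0 : 0 ≤ Q := (Nat.cast_nonneg _).trans (hQ 0)
  have h1 : ∀ t ∈ E, Real.exp (-(s - t) ^ 2 / (4 * ℓ ^ 2)) ≤ (4 / 5 : ℝ) ^ k t := by
    intro t _
    have e5 : Real.exp (-(1 / 4)) ≤ 4 / 5 := by
      rw [Real.exp_neg, inv_le_comm₀ (Real.exp_pos _) (by norm_num)]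
      have := Real.add_one_le_exp (1 / 4 : ℝ)
      linarith
    have hfl : (k t : ℝ) ≤ |s - t| / ℓ := Nat.floor_le (by positivity)
    have hsq : (k t : ℝ) ≤ (k t : ℝ) ^ 2 := by
      exact_mod_cast Nat.le_self_pow (by norm_num) (k t)
    calc Real.exp (-(s - t) ^ 2 / (4 * ℓ ^ 2)) ≤ Real.exp ((k t : ℝ) * (-(1 / 4))) := by
          apply Real.exp_le_exp.2
          have : (k t : ℝ) ^ 2 ≤ (|s - t| / ℓ) ^ 2 := by gcongr
          have e : -(s - t) ^ 2 / (4 * ℓ ^ 2) = -(|s - t| / ℓ) ^ 2 / 4 := by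
            rw [div_pow, sq_abs]; field_simp
          rw [e]; linarith
      _ = Real.exp (-(1 / 4)) ^ k t := Real.exp_nat_mul _ _
      _ ≤ (4 / 5) ^ k t := by gcongr
  have h2 : ∀ m : ℕ, ((E.filter fun t => k t = m).card : ℝ) ≤ 2 * Q := by
    intro m
    have hsub : (E.filter fun t => k t = m) ⊆
        (E.filter fun t => t ∈ Set.Icc (s + m * ℓ) (s + m * ℓ + ℓ)) ∪
        (E.filter fun t => t ∈ Set.Icc (s - m * ℓ - ℓ) (s - m * ℓ - ℓ + ℓ)) := by
      intro t ht
      rw [Finset.mem_filter] at ht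
      obtain ⟨htE, hm⟩ := ht
      have a1 : (m : ℝ) ≤ |s - t| / ℓ := by rw [← hm]; exact Nat.floor_le (by positivity)
      have a2 : |s - t| / ℓ < m + 1 := by rw [← hm]; exact Nat.lt_floor_add_one _
      rw [le_div_iff₀ hℓ] at a1
      rw [div_lt_iff₀ hℓ] at a2
      rw [Finset.mem_union, Finset.mem_filter, Finset.mem_filter]
      rcases le_total 0 (s - t) with h | h
      · rw [abs_of_nonneg h] at a1 a2
        right; refine ⟨htE, ?_, ?_⟩ <;> linarith
      · rw [abs_of_nonpos h] at a1 a2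
        left; refine ⟨htE, ?_, ?_⟩ <;> linarith
    have h3 := (Finset.card_le_card hsub).trans (Finset.card_union_le _ _)
    have h4 : ((E.filter fun t => k t = m).card : ℝ) ≤
        ((E.filter fun t => t ∈ Set.Icc (s + m * ℓ) (s + m * ℓ + ℓ)).card : ℝ) +
        ((E.filter fun t => t ∈ Set.Icc (s - m * ℓ - ℓ) (s - m * ℓ - ℓ + ℓ)).card : ℝ) := by
      exact_mod_cast h3
    linarith [hQ (s + m * ℓ), hQ (s - m * ℓ - ℓ)]
  calc ∑ t ∈ E, Real.exp (-(s - t) ^ 2 / (4 * ℓ ^ 2)) ≤ ∑ t ∈ E, (4 / 5 : ℝ) ^ k t :=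
        Finset.sum_le_sum h1
    _ = ∑ m ∈ E.image k, (E.filter fun t => k t = m).card • (4 / 5 : ℝ) ^ m :=
        Finset.sum_comp (fun m : ℕ => (4 / 5 : ℝ) ^ m) k
    _ ≤ ∑ m ∈ E.image k, (2 * Q) * (4 / 5 : ℝ) ^ m := by
        refine Finset.sum_le_sum fun m _ => ?_
        rw [nsmul_eq_mul]
        exact mul_le_mul_of_nonneg_right (h2 m) (by positivity)
    _ = (2 * Q) * ∑ m ∈ E.image k, (4 / 5 : ℝ) ^ m := by rw [Finset.mul_sum]
    _ ≤ (2 * Q) * 5 := by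
        gcongr
        have := (summable_geometric_of_lt_one (r := (4 / 5 : ℝ)) (by norm_num)
          (by norm_num)).sum_le_tsum (E.image k) (fun i _ => by positivity)
        rw [tsum_geometric_of_lt_one (by norm_num) (by norm_num)] at this
        linarith
    _ = 10 * Q := by ring

theorem integral_gaussian_exp {ℓ : ℝ} (hℓ : 0 < ℓ) (s : ℝ) :
    ∫ v : ℝ, Complex.exp (Complex.I * ((s * v : ℝ) : ℂ)) * (Real.exp (-(ℓ * v) ^ 2) : ℂ) =
      ((Real.sqrt Real.pi / ℓ * Real.exp (-s ^ 2 / (4 * ℓ ^ 2)) : ℝ) : ℂ) := by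
  have h := fourierIntegral_gaussian (b := ((ℓ ^ 2 : ℝ) : ℂ))
    (by rw [Complex.ofReal_re]; positivity) (s : ℂ)
  have e : (((Real.pi : ℂ) / ((ℓ ^ 2 : ℝ) : ℂ)) ^ (1 / 2 : ℂ)) =
      ((Real.sqrt Real.pi / ℓ : ℝ) : ℂ) := by
    rw [← Complex.ofReal_div, show (1 / 2 : ℂ) = ((1 / 2 : ℝ) : ℂ) by push_cast; rfl,
      ← Complex.ofReal_cpow (by positivity), ← Real.sqrt_eq_rpow, Real.sqrt_div Real.pi_pos.le,
      Real.sqrt_sq hℓ.le]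
  rw [e] at h
  rw [Complex.ofReal_mul, Complex.ofReal_exp]
  convert h using 1
  · refine integral_congr_ae (Filter.Eventually.of_forall fun v => ?_)
    simp only
    congr 1
    · push_cast; ring_nf
    · push_cast; ring_nf
  · push_cast; rfl

theorem integrable_gaussian_exp {ℓ : ℝ} (hℓ : 0 < ℓ) (s : ℝ) :
    Integrable fun v : ℝ =>
      Complex.exp (Complex.I * ((s * v : ℝ) : ℂ)) * (Real.exp (-(ℓ * v) ^ 2) : ℂ) := by
  have h : Integrable fun v : ℝ => (Real.exp (-(ℓ ^ 2) * v ^ 2) : ℂ) :=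
    (integrable_exp_neg_mul_sq (b := ℓ ^ 2) (by positivity)).ofReal
  refine h.mono (by fun_prop) (Filter.Eventually.of_forall fun v => ?_)
  rw [norm_mul, mul_comm Complex.I, Complex.norm_exp_ofReal_mul_I, one_mul]
  apply le_of_eq
  congr 3
  ring

/-- Almost orthogonality of the exponentials `e^{itv}`, `t ∈ E`, against a Gaussian weight. -/
theorem lintegral_gaussian_expSum_le {E : Finset ℝ} {ℓ Q : ℝ} (hℓ : 0 < ℓ)
    (hQ : ∀ s : ℝ, ((E.filter fun t => t ∈ Set.Icc s (s + ℓ)).card : ℝ) ≤ Q) (c : ℝ → ℂ) :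
    ∫⁻ v : ℝ, ENNReal.ofReal (Real.exp (-(ℓ * v) ^ 2)) *
        ‖∑ t ∈ E, c t * Complex.exp (Complex.I * ((t * v : ℝ) : ℂ))‖ₑ ^ 2 ≤
      ENNReal.ofReal (20 * Q / ℓ * ∑ t ∈ E, ‖c t‖ ^ 2) := by
  set P : ℝ → ℂ := fun v => ∑ t ∈ E, c t * Complex.exp (Complex.I * ((t * v : ℝ) : ℂ)) with hP
  set g : ℝ → ℝ → ℝ := fun s t => Real.exp (-(s - t) ^ 2 / (4 * ℓ ^ 2)) with hg
  have hexp : ∀ v, ((Real.exp (-(ℓ * v) ^ 2) * ‖P v‖ ^ 2 : ℝ) : ℂ) =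
      ∑ s ∈ E, ∑ t ∈ E, (c s * starRingEnd ℂ (c t)) *
        (Complex.exp (Complex.I * (((s - t) * v : ℝ) : ℂ)) * (Real.exp (-(ℓ * v) ^ 2) : ℂ)) := by
    intro v
    have : ((‖P v‖ ^ 2 : ℝ) : ℂ) = P v * starRingEnd ℂ (P v) := by
      rw [Complex.mul_conj, Complex.normSq_eq_norm_sq]
    rw [Complex.ofReal_mul, this, hP]
    simp only [map_sum, map_mul, ← Complex.exp_conj, Complex.conj_I, Complex.conj_ofReal]
    rw [Finset.sum_mul_sum, Finset.mul_sum]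
    refine Finset.sum_congr rfl fun s _ => ?_
    rw [Finset.mul_sum]
    refine Finset.sum_congr rfl fun t _ => ?_
    have : Complex.exp (Complex.I * (((s - t) * v : ℝ) : ℂ)) =
        Complex.exp (Complex.I * ((s * v : ℝ) : ℂ)) *
          Complex.exp (-Complex.I * ((t * v : ℝ) : ℂ)) := by
      rw [← Complex.exp_add]; congr 1; push_cast; ring
    rw [this]; ring
  have hint : Integrable fun v => ((Real.exp (-(ℓ * v) ^ 2) * ‖P v‖ ^ 2 : ℝ) : ℂ) := by
    simp_rw [hexp]
    exact integrable_finsetSum _ fun s _ => integrable_finsetSum _ fun t _ =>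
      (integrable_gaussian_exp hℓ (s - t)).const_mul _
  have hintR : Integrable fun v => Real.exp (-(ℓ * v) ^ 2) * ‖P v‖ ^ 2 := by
    exact hint.re.congr (Filter.Eventually.of_forall fun v => Complex.ofReal_re _)
  have hval : ((∫ v, Real.exp (-(ℓ * v) ^ 2) * ‖P v‖ ^ 2 : ℝ) : ℂ) =
      ∑ s ∈ E, ∑ t ∈ E, (c s * starRingEnd ℂ (c t)) *
        ((Real.sqrt Real.pi / ℓ * g s t : ℝ) : ℂ) := by
    rw [← integral_complex_ofReal]
    simp_rw [hexp]
    rw [integral_finsetSum _ fun s _ => integrable_finsetSum _ fun t _ =>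
      (integrable_gaussian_exp hℓ (s - t)).const_mul _]
    refine Finset.sum_congr rfl fun s _ => ?_
    rw [integral_finsetSum _ fun t _ => (integrable_gaussian_exp hℓ (s - t)).const_mul _]
    refine Finset.sum_congr rfl fun t _ => ?_
    rw [integral_const_mul, integral_gaussian_exp hℓ]
  have hQ0 : 0 ≤ Q := (Nat.cast_nonneg _).trans (hQ 0)
  have hpi : Real.sqrt Real.pi ≤ 2 := by
    rw [Real.sqrt_le_left (by norm_num)]; linarith [Real.pi_le_four]
  have hbound : ∫ v, Real.exp (-(ℓ * v) ^ 2) * ‖P v‖ ^ 2 ≤ 20 * Q / ℓ * ∑ t ∈ E, ‖c t‖ ^ 2 := by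
    have h0 : ∫ v, Real.exp (-(ℓ * v) ^ 2) * ‖P v‖ ^ 2 ≤
        ∑ s ∈ E, ∑ t ∈ E, (‖c s‖ * ‖c t‖) * (Real.sqrt Real.pi / ℓ * g s t) := by
      calc _ ≤ ‖((∫ v, Real.exp (-(ℓ * v) ^ 2) * ‖P v‖ ^ 2 : ℝ) : ℂ)‖ := by
            rw [Complex.norm_real]; exact le_abs_self _
        _ ≤ _ := by
            rw [hval]
            refine (norm_sum_le _ _).trans (Finset.sum_le_sum fun s _ => ?_)
            refine (norm_sum_le _ _).trans (Finset.sum_le_sum fun t _ => le_of_eq ?_)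
            rw [norm_mul, norm_mul, RCLike.norm_conj, Complex.norm_real, Real.norm_of_nonneg]
            positivity
    -- Schur test: by the arithmetic-geometric mean inequality and the symmetry of the Gaussian
    -- kernel, only its row sums matter, and these are at most 10Q.
    have h1 : ∀ s ∈ E, ∀ t ∈ E, (‖c s‖ * ‖c t‖) * (Real.sqrt Real.pi / ℓ * g s t) ≤
        (Real.sqrt Real.pi / ℓ) * ((‖c s‖ ^ 2 * g s t) / 2 + (‖c t‖ ^ 2 * g t s) / 2) := by
      intro s _ t _
      have hsym : g t s = g s t := by simp only [hg]; congr 2; ring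
      have hg0 : 0 ≤ g s t := (Real.exp_pos _).le
      rw [hsym]
      have : ‖c s‖ * ‖c t‖ ≤ (‖c s‖ ^ 2 + ‖c t‖ ^ 2) / 2 := by
        nlinarith [sq_nonneg (‖c s‖ - ‖c t‖)]
      calc _ = (Real.sqrt Real.pi / ℓ * g s t) * (‖c s‖ * ‖c t‖) := by ring
        _ ≤ (Real.sqrt Real.pi / ℓ * g s t) * ((‖c s‖ ^ 2 + ‖c t‖ ^ 2) / 2) := by gcongr
        _ = _ := by ring
    have h2 : ∑ s ∈ E, ∑ t ∈ E, (‖c s‖ ^ 2 * g s t) ≤ 10 * Q * ∑ t ∈ E, ‖c t‖ ^ 2 := by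
      rw [Finset.mul_sum]
      refine Finset.sum_le_sum fun s _ => ?_
      rw [← Finset.mul_sum, mul_comm]
      exact mul_le_mul_of_nonneg_right (sum_gaussian_le hℓ hQ s) (by positivity)
    have h3 : ∑ s ∈ E, ∑ t ∈ E, (‖c t‖ ^ 2 * g t s) ≤ 10 * Q * ∑ t ∈ E, ‖c t‖ ^ 2 := by
      rw [Finset.sum_comm]; exact h2
    calc _ ≤ _ := h0
      _ ≤ ∑ s ∈ E, ∑ t ∈ E, (Real.sqrt Real.pi / ℓ) *
          ((‖c s‖ ^ 2 * g s t) / 2 + (‖c t‖ ^ 2 * g t s) / 2) :=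
          Finset.sum_le_sum fun s hs => Finset.sum_le_sum fun t ht => h1 s hs t ht
      _ = (Real.sqrt Real.pi / ℓ) * ((∑ s ∈ E, ∑ t ∈ E, (‖c s‖ ^ 2 * g s t)) / 2 +
          (∑ s ∈ E, ∑ t ∈ E, (‖c t‖ ^ 2 * g t s)) / 2) := by
          simp only [← Finset.mul_sum, Finset.sum_add_distrib, ← Finset.sum_div]
      _ ≤ (2 / ℓ) * ((10 * Q * ∑ t ∈ E, ‖c t‖ ^ 2) / 2 + (10 * Q * ∑ t ∈ E, ‖c t‖ ^ 2) / 2) := by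
          gcongr
      _ = _ := by ring
  calc _ = ∫⁻ v, ENNReal.ofReal (Real.exp (-(ℓ * v) ^ 2) * ‖P v‖ ^ 2) := by
        refine lintegral_congr fun v => ?_
        rw [ENNReal.ofReal_mul (Real.exp_pos _).le, ENNReal.ofReal_pow (norm_nonneg _),
          ofReal_norm]
    _ = ENNReal.ofReal (∫ v, Real.exp (-(ℓ * v) ^ 2) * ‖P v‖ ^ 2) :=
        (ofReal_integral_eq_lintegral_ofReal hintR
          (Filter.Eventually.of_forall fun v => by positivity)).symm
    _ ≤ _ := ENNReal.ofReal_le_ofReal hbound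

/-- Almost orthogonality of the oscillating functions `e^{itu}`, `t ∈ E`, for an injective phase
with derivative at least `κ` and range of length `O(1 / ℓ)`. -/
theorem setLIntegral_expSum_le {E : Finset ℝ} {ℓ Q κ A v₀ : ℝ} (hℓ : 0 < ℓ) (hκ : 0 < κ)
    (hQ : ∀ s : ℝ, ((E.filter fun t => t ∈ Set.Icc s (s + ℓ)).card : ℝ) ≤ Q)
    {S : Set ℝ} (hS : MeasurableSet S) {u u' : ℝ → ℝ}
    (hu : ∀ x ∈ S, HasDerivAt u (u' x) x) (hinj : Set.InjOn u S)
    (hlow : ∀ x ∈ S, κ ≤ |u' x|) (hrange : ∀ x ∈ S, ℓ * |u x - v₀| ≤ A) (c : ℝ → ℂ) :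
    ∫⁻ x in S, ‖∑ t ∈ E, c t * Complex.exp (Complex.I * ((t * u x : ℝ) : ℂ))‖ₑ ^ 2 ≤
      ENNReal.ofReal (Real.exp (A ^ 2) * (20 * Q / (ℓ * κ)) * ∑ t ∈ E, ‖c t‖ ^ 2) := by
  -- Recentring the phase at v₀ changes the coefficients only by unimodular factors, so the Gaussian
  -- may be placed at v₀.
  set c' : ℝ → ℂ := fun t => c t * Complex.exp (Complex.I * ((t * v₀ : ℝ) : ℂ)) with hc'
  set P : ℝ → ℂ := fun v => ∑ t ∈ E, c t * Complex.exp (Complex.I * ((t * v : ℝ) : ℂ)) with hP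
  have hQ0 : 0 ≤ Q := (Nat.cast_nonneg _).trans (hQ 0)
  have hc'n : ∀ t, ‖c' t‖ = ‖c t‖ := by
    intro t
    rw [hc', norm_mul, mul_comm Complex.I, Complex.norm_exp_ofReal_mul_I, mul_one]
  have hshift : ∀ v, P (v + v₀) =
      ∑ t ∈ E, c' t * Complex.exp (Complex.I * ((t * v : ℝ) : ℂ)) := by
    intro v
    refine Finset.sum_congr rfl fun t _ => ?_
    rw [hc', mul_assoc, ← Complex.exp_add]
    congr 2; push_cast; ring
  have hG := lintegral_gaussian_expSum_le hℓ hQ c'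
  simp_rw [← hshift, hc'n] at hG
  have hG' : ∫⁻ v, ENNReal.ofReal (Real.exp (-(ℓ * (v - v₀)) ^ 2)) * ‖P v‖ₑ ^ 2 ≤
      ENNReal.ofReal (20 * Q / ℓ * ∑ t ∈ E, ‖c t‖ ^ 2) := by
    rw [← lintegral_add_right_eq_self _ v₀]
    simpa using hG
  set ρ : ℝ → ℝ≥0∞ := fun v => ENNReal.ofReal (Real.exp (-(ℓ * (v - v₀)) ^ 2)) * ‖P v‖ₑ ^ 2
    with hρ
  -- Both the Jacobian and the Gaussian are inserted for free: |u'|/κ ≥ 1, and the Gaussian is at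
  -- least e^{-A²} on the range of u.
  have hpt : ∀ x ∈ S, ‖P (u x)‖ₑ ^ 2 ≤
      ENNReal.ofReal (Real.exp (A ^ 2) / κ) * (ENNReal.ofReal |u' x| * ρ (u x)) := by
    intro x hx
    have h1 : 1 ≤ Real.exp (A ^ 2) / κ * |u' x| * Real.exp (-(ℓ * (u x - v₀)) ^ 2) := by
      have a1 : 1 ≤ |u' x| / κ := by rw [le_div_iff₀ hκ, one_mul]; exact hlow x hx
      have a2 : 1 ≤ Real.exp (A ^ 2) * Real.exp (-(ℓ * (u x - v₀)) ^ 2) := by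
        rw [← Real.exp_add, Real.one_le_exp_iff]
        have : (ℓ * |u x - v₀|) ^ 2 ≤ A ^ 2 := by
          have := hrange x hx
          gcongr
        rw [mul_pow, sq_abs, ← mul_pow] at this
        linarith
      calc (1 : ℝ) = 1 * 1 := by ring
        _ ≤ (|u' x| / κ) * (Real.exp (A ^ 2) * Real.exp (-(ℓ * (u x - v₀)) ^ 2)) := by gcongr
        _ = _ := by ring
    have h2 : ENNReal.ofReal (Real.exp (A ^ 2) / κ) * (ENNReal.ofReal |u' x| * ρ (u x)) =
        ENNReal.ofReal (Real.exp (A ^ 2) / κ * |u' x| * Real.exp (-(ℓ * (u x - v₀)) ^ 2)) *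
          ‖P (u x)‖ₑ ^ 2 := by
      rw [ENNReal.ofReal_mul (by positivity), ENNReal.ofReal_mul (by positivity), hρ]
      ring
    rw [h2]
    exact le_mul_of_one_le_left (by positivity) (by simpa using ENNReal.ofReal_le_ofReal h1)
  calc ∫⁻ x in S, ‖P (u x)‖ₑ ^ 2
      ≤ ∫⁻ x in S, ENNReal.ofReal (Real.exp (A ^ 2) / κ) * (ENNReal.ofReal |u' x| * ρ (u x)) :=
        setLIntegral_mono' hS hpt
    _ = ENNReal.ofReal (Real.exp (A ^ 2) / κ) *
          ∫⁻ x in S, ENNReal.ofReal |u' x| * ρ (u x) := by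
        rw [lintegral_const_mul' _ _ ENNReal.ofReal_ne_top]
    _ = ENNReal.ofReal (Real.exp (A ^ 2) / κ) * ∫⁻ v in u '' S, ρ v := by
        rw [lintegral_image_eq_lintegral_abs_deriv_mul hS
          (fun x hx => (hu x hx).hasDerivWithinAt) hinj]
    _ ≤ ENNReal.ofReal (Real.exp (A ^ 2) / κ) *
          ENNReal.ofReal (20 * Q / ℓ * ∑ t ∈ E, ‖c t‖ ^ 2) := by
        gcongr
        exact (setLIntegral_le_lintegral _ _).trans hG'
    _ = _ := by
        rw [← ENNReal.ofReal_mul (by positivity)]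
        congr 1
        field_simp

/-- A family of functions with square function bounds for all linear combinations. -/
def IsBesselFamily {X : Type*} [MeasurableSpace X] (μ : Measure X) (E : Finset ℝ)
    (f : ℝ → X → ℂ) (K : ℝ) : Prop :=
  ∀ c : ℝ → ℂ, ∫⁻ x, ‖∑ t ∈ E, c t * f t x‖ₑ ^ 2 ∂μ ≤ ENNReal.ofReal (K * ∑ t ∈ E, ‖c t‖ ^ 2)

/-- The Bessel property is dual to a bound for the coefficients. -/
theorem IsBesselFamily.sum_enorm_integral_sq_le {X : Type*} [MeasurableSpace X] {μ : Measure X}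
    {E : Finset ℝ} {f : ℝ → X → ℂ} {K : ℝ} (hf : IsBesselFamily μ E f K) (hK : 0 ≤ K)
    (hfm : ∀ t ∈ E, Measurable (f t)) {h : X → ℂ} (hh : AEStronglyMeasurable h μ)
    (hint : ∀ t ∈ E, Integrable (fun x => f t x * h x) μ) :
    ∑ t ∈ E, ‖∫ x, f t x * h x ∂μ‖ₑ ^ 2 ≤ ENNReal.ofReal K * ∫⁻ x, ‖h x‖ₑ ^ 2 ∂μ := by
  set I : ℝ → ℂ := fun t => ∫ x, f t x * h x ∂μ with hI
  -- The extremal choice in the duality: with conjugated coefficients the left side becomes one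
  -- integral of a linear combination against h. Cauchy–Schwarz then gives s² ≤ K s N, and s is
  -- cancelled.
  set c : ℝ → ℂ := fun t => starRingEnd ℂ (I t) with hc
  set N : ℝ≥0∞ := ∫⁻ x, ‖h x‖ₑ ^ 2 ∂μ with hN
  set s : ℝ := ∑ t ∈ E, ‖I t‖ ^ 2 with hs
  have hs0 : 0 ≤ s := by positivity
  have hsum : ∑ t ∈ E, ‖I t‖ₑ ^ 2 = ENNReal.ofReal s := by
    rw [hs, ENNReal.ofReal_sum_of_nonneg (fun _ _ => by positivity)]
    refine Finset.sum_congr rfl fun t _ => ?_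
    rw [ENNReal.ofReal_pow (norm_nonneg _), ofReal_norm]
  have h1 : ((s : ℝ) : ℂ) = ∫ x, (∑ t ∈ E, c t * f t x) * h x ∂μ := by
    simp_rw [Finset.sum_mul, mul_assoc]
    rw [integral_finsetSum _ fun t ht => (hint t ht).const_mul _, hs, Complex.ofReal_sum]
    refine Finset.sum_congr rfl fun t _ => ?_
    rw [integral_const_mul, ← Complex.normSq_eq_norm_sq, Complex.normSq_eq_conj_mul_self]
  have h2 : ENNReal.ofReal s ≤ ∫⁻ x, ‖∑ t ∈ E, c t * f t x‖ₑ * ‖h x‖ₑ ∂μ := by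
    have : ENNReal.ofReal s = ‖((s : ℝ) : ℂ)‖ₑ := by
      rw [← ofReal_norm, Complex.norm_real, Real.norm_of_nonneg hs0]
    rw [this, h1]
    refine (enorm_integral_le_lintegral_enorm _).trans (le_of_eq ?_)
    simp_rw [enorm_mul]
  have h3 := ENNReal.lintegral_mul_le_Lp_mul_Lq μ (Real.HolderConjugate.two_two)
    (f := fun x => ‖∑ t ∈ E, c t * f t x‖ₑ) (g := fun x => ‖h x‖ₑ)
    ((Finset.measurable_sum E fun t ht =>
      measurable_const.mul (hfm t ht)).enorm.aemeasurable) hh.enorm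
  have h4 : ENNReal.ofReal s ^ 2 ≤ ENNReal.ofReal (K * s) * N := by
    calc ENNReal.ofReal s ^ 2 ≤ ((∫⁻ x, ‖∑ t ∈ E, c t * f t x‖ₑ ^ (2 : ℝ) ∂μ) ^ (1 / (2 : ℝ)) *
          (∫⁻ x, ‖h x‖ₑ ^ (2 : ℝ) ∂μ) ^ (1 / (2 : ℝ))) ^ 2 := by
          gcongr; exact h2.trans h3
      _ = (∫⁻ x, ‖∑ t ∈ E, c t * f t x‖ₑ ^ 2 ∂μ) * N := by
          rw [mul_pow, ← ENNReal.rpow_natCast, ← ENNReal.rpow_natCast, ← ENNReal.rpow_mul,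
            ← ENNReal.rpow_mul]
          norm_num [hN]
      _ ≤ _ := by
          gcongr
          refine (hf c).trans (le_of_eq ?_)
          simp only [hc, RCLike.norm_conj, hs]
  rw [hsum]
  rcases hs0.eq_or_lt with h0 | h0
  · rw [← h0]; simp
  · have h5 : ENNReal.ofReal s * ENNReal.ofReal s ≤
        ENNReal.ofReal s * (ENNReal.ofReal K * N) := by
      rw [← sq]; refine h4.trans (le_of_eq ?_)
      rw [ENNReal.ofReal_mul hK]; ring
    exact (ENNReal.mul_le_mul_iff_right (by simpa using h0) ENNReal.ofReal_ne_top).1 h5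

/-- Summation by parts over a finite set of times: a sum with slowly varying coefficients is
controlled by partial sums. -/
theorem exists_partialSum_bound (E : Finset ℝ) (hE : (E : Set ℝ) ⊆ Set.Icc 1 2) :
    ∃ (m : ℕ) (τ w : ℕ → ℝ), (∀ i, 0 ≤ w i) ∧ ∑ i ∈ Finset.range m, w i ≤ 1 ∧
      ∀ (B : ℝ) (n g : ℝ → ℂ), (∀ t ∈ E, ‖n t‖ ≤ B) →
        (∀ t ∈ E, ∀ s ∈ E, ‖n t - n s‖ ≤ B * |t - s|) →
        ‖∑ t ∈ E, n t * g t‖ ^ 2 ≤ 2 * B ^ 2 * (‖∑ t ∈ E, g t‖ ^ 2 +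
          ∑ i ∈ Finset.range m, w i * ‖∑ t ∈ E, (if t ≤ τ i then g t else 0)‖ ^ 2) := by
  classical
  rcases E.eq_empty_or_nonempty with h0 | hne
  · refine ⟨0, fun _ => 0, fun _ => 0, by simp, by simp, ?_⟩
    intro B n g _ _
    simp [h0]
  set M := E.card with hM
  have hMpos : 0 < M := Finset.card_pos.2 hne
  set φ : Fin M → ℝ := fun i => E.orderEmbOfFin hM.symm i with hφ
  -- The points of E in increasing order. Beyond the last index the value is frozen at the largest
  -- point, so that τ i ∈ E for every i.
  set τ : ℕ → ℝ := fun i => if h : i < M then φ ⟨i, h⟩ else φ ⟨M - 1, by omega⟩ with hτ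
  have hτE : ∀ i, τ i ∈ E := by
    intro i
    simp only [hτ]
    split_ifs <;> exact Finset.orderEmbOfFin_mem _ _ _
  have hlt : ∀ i k, i < M → k < M → (τ k ≤ τ i ↔ k ≤ i) := by
    intro i k hi hk
    simp only [hτ, hi, hk, dif_pos, hφ, OrderEmbedding.le_iff_le, Fin.mk_le_mk]
  have hmono : ∀ i, i < M - 1 → τ i ≤ τ (i + 1) := fun i hi =>
    (hlt _ _ (by omega) (by omega)).2 (by omega)
  have hsum : ∀ f : ℝ → ℂ, ∑ t ∈ E, f t = ∑ i ∈ Finset.range M, f (τ i) := by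
    intro f
    have hE' : E = Finset.univ.map (E.orderEmbOfFin hM.symm).toEmbedding := by
      rw [Finset.map_orderEmbOfFin_univ]
    conv_lhs => rw [hE']
    rw [Finset.sum_map, Finset.sum_range]
    refine Finset.sum_congr rfl fun i _ => ?_
    simp [hτ, hφ]
  set w : ℕ → ℝ := fun i => if i < M - 1 then τ (i + 1) - τ i else 0 with hw
  have hw0 : ∀ i, 0 ≤ w i := by
    intro i
    simp only [hw]
    split_ifs with h
    · linarith [hmono i h]
    · rfl
  have hwsum : ∑ i ∈ Finset.range (M - 1), w i = τ (M - 1) - τ 0 := by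
    rw [← Finset.sum_range_sub]
    refine Finset.sum_congr rfl fun i hi => ?_
    simp only [hw, if_pos (Finset.mem_range.1 hi)]
  have hw1 : ∑ i ∈ Finset.range (M - 1), w i ≤ 1 := by
    rw [hwsum]
    have a := hE (hτE (M - 1)); have b := hE (hτE 0)
    simp only [Set.mem_Icc] at a b
    linarith [a.2, b.1]
  refine ⟨M - 1, τ, w, hw0, hw1, ?_⟩
  intro B n g hB hL
  have hB0 : 0 ≤ B := (norm_nonneg _).trans (hB _ (hτE 0))
  have habel := Finset.sum_range_by_parts (fun i => n (τ i)) (fun i => g (τ i)) M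
  simp only [smul_eq_mul] at habel
  set G : ℕ → ℂ := fun i => ∑ t ∈ E, (if t ≤ τ i then g t else 0) with hG
  have hGi : ∀ i, i < M → ∑ k ∈ Finset.range (i + 1), g (τ k) = G i := by
    intro i hi
    rw [hG]
    simp only
    rw [hsum, ← Finset.sum_filter]
    refine Finset.sum_congr ?_ fun _ _ => rfl
    ext k
    simp only [Finset.mem_range, Finset.mem_filter]
    constructor
    · intro hk; exact ⟨by omega, (hlt _ _ hi (by omega)).2 (by omega)⟩
    · rintro ⟨hk, hk'⟩
      have := (hlt _ _ hi hk).1 hk'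
      omega
  have h1 : ‖∑ t ∈ E, n t * g t‖ ≤
      B * ‖∑ t ∈ E, g t‖ + B * ∑ i ∈ Finset.range (M - 1), w i * ‖G i‖ := by
    rw [hsum, habel, hsum g]
    refine (norm_sub_le _ _).trans (add_le_add ?_ ?_)
    · rw [norm_mul]
      exact mul_le_mul_of_nonneg_right (hB _ (hτE _)) (norm_nonneg _)
    · rw [Finset.mul_sum]
      refine (norm_sum_le _ _).trans (Finset.sum_le_sum fun i hi => ?_)
      have hi' := Finset.mem_range.1 hi
      rw [norm_mul, hGi i (by omega), ← mul_assoc]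
      refine mul_le_mul_of_nonneg_right ?_ (norm_nonneg _)
      refine (hL _ (hτE _) _ (hτE _)).trans (le_of_eq ?_)
      simp only [hw, if_pos hi']
      rw [abs_of_nonneg (by linarith [hmono i hi'])]
  -- Cauchy–Schwarz with the gaps of E as weights; their total is at most the length 1 of [1, 2].
  have h2 : (∑ i ∈ Finset.range (M - 1), w i * ‖G i‖) ^ 2 ≤
      ∑ i ∈ Finset.range (M - 1), w i * ‖G i‖ ^ 2 := by
    have hcs := Finset.sum_sq_le_sum_mul_sum_of_sq_le_mul (Finset.range (M - 1))
      (r := fun i => w i * ‖G i‖) (f := w) (g := fun i => w i * ‖G i‖ ^ 2)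
      (fun i _ => hw0 i) (fun i _ => mul_nonneg (hw0 i) (by positivity)) (fun i _ => le_of_eq (by ring))
    refine hcs.trans ?_
    refine mul_le_of_le_one_left ?_ hw1
    exact Finset.sum_nonneg fun i _ => mul_nonneg (hw0 i) (by positivity)
  set a := ‖∑ t ∈ E, g t‖
  set b := ∑ i ∈ Finset.range (M - 1), w i * ‖G i‖
  calc ‖∑ t ∈ E, n t * g t‖ ^ 2 ≤ (B * a + B * b) ^ 2 := by gcongr
    _ ≤ 2 * B ^ 2 * (a ^ 2 + b ^ 2) := by
        nlinarith [mul_nonneg (sq_nonneg B) (sq_nonneg (a - b))]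
    _ ≤ _ := by gcongr

/-- The Bessel property is stable under slowly varying bounded amplitudes. -/
theorem IsBesselFamily.mul_lipschitz {X : Type*} [MeasurableSpace X] {μ : Measure X}
    {E : Finset ℝ} (hE : (E : Set ℝ) ⊆ Set.Icc 1 2) {f : ℝ → X → ℂ} {K B : ℝ}
    (hf : IsBesselFamily μ E f K) (hK : 0 ≤ K) (hfm : ∀ t ∈ E, Measurable (f t))
    {n : ℝ → X → ℂ} (hB : ∀ t ∈ E, ∀ x, ‖n t x‖ ≤ B)
    (hL : ∀ t ∈ E, ∀ s ∈ E, ∀ x, ‖n t x - n s x‖ ≤ B * |t - s|) :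
    IsBesselFamily μ E (fun t x => f t x * n t x) (4 * B ^ 2 * K) := by
  obtain ⟨m, τ, w, hw0, hw1, hmain⟩ := exists_partialSum_bound E hE
  intro c
  set s : ℝ := ∑ t ∈ E, ‖c t‖ ^ 2 with hs
  set P : X → ℂ := fun x => ∑ t ∈ E, c t * f t x with hP
  -- Truncating the coefficients at τ i preserves the Bessel bound. This is why the Bessel property
  -- is required for all coefficient vectors.
  set R : ℕ → X → ℂ := fun i x => ∑ t ∈ E, (if t ≤ τ i then c t else 0) * f t x with hR
  have hRm : ∀ i, Measurable (R i) := fun i =>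
    Finset.measurable_sum E fun t ht => measurable_const.mul (hfm t ht)
  have hPm : Measurable P := Finset.measurable_sum E fun t ht => measurable_const.mul (hfm t ht)
  have hRb : ∀ i, ∫⁻ x, ‖R i x‖ₑ ^ 2 ∂μ ≤ ENNReal.ofReal (K * s) := by
    intro i
    refine (hf fun t => if t ≤ τ i then c t else 0).trans (ENNReal.ofReal_le_ofReal ?_)
    refine mul_le_mul_of_nonneg_left (Finset.sum_le_sum fun t _ => ?_) hK
    split_ifs
    · rfl
    · simp
  have hpt : ∀ x, ‖∑ t ∈ E, c t * (f t x * n t x)‖ₑ ^ 2 ≤ ENNReal.ofReal (2 * B ^ 2) *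
      (‖P x‖ₑ ^ 2 + ∑ i ∈ Finset.range m, ENNReal.ofReal (w i) * ‖R i x‖ₑ ^ 2) := by
    intro x
    have h := hmain B (fun t => n t x) (fun t => c t * f t x) (fun t ht => hB t ht x)
      (fun t ht s hs => hL t ht s hs x)
    have e1 : ∑ t ∈ E, c t * (f t x * n t x) = ∑ t ∈ E, n t x * (c t * f t x) :=
      Finset.sum_congr rfl fun t _ => by ring
    have e2 : ∀ i, ∑ t ∈ E, (if t ≤ τ i then c t * f t x else 0) = R i x := fun i =>
      Finset.sum_congr rfl fun t _ => by split_ifs <;> simp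
    simp_rw [e2] at h
    rw [e1]
    calc _ = ENNReal.ofReal (‖∑ t ∈ E, n t x * (c t * f t x)‖ ^ 2) := by
          rw [ENNReal.ofReal_pow (norm_nonneg _), ofReal_norm]
      _ ≤ _ := ENNReal.ofReal_le_ofReal h
      _ = _ := by
          rw [ENNReal.ofReal_mul (by positivity), ENNReal.ofReal_add (by positivity)
            (Finset.sum_nonneg fun i _ => mul_nonneg (hw0 i) (by positivity)),
            ENNReal.ofReal_pow (norm_nonneg _), ofReal_norm,
            ENNReal.ofReal_sum_of_nonneg fun i _ => mul_nonneg (hw0 i) (by positivity)]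
          congr 2
          refine Finset.sum_congr rfl fun i _ => ?_
          rw [ENNReal.ofReal_mul (hw0 i), ENNReal.ofReal_pow (norm_nonneg _), ofReal_norm]
  calc _ ≤ ∫⁻ x, ENNReal.ofReal (2 * B ^ 2) *
      (‖P x‖ₑ ^ 2 + ∑ i ∈ Finset.range m, ENNReal.ofReal (w i) * ‖R i x‖ₑ ^ 2) ∂μ :=
        lintegral_mono hpt
    _ = ENNReal.ofReal (2 * B ^ 2) * (∫⁻ x, ‖P x‖ₑ ^ 2 ∂μ +
          ∑ i ∈ Finset.range m, ENNReal.ofReal (w i) * ∫⁻ x, ‖R i x‖ₑ ^ 2 ∂μ) := by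
        rw [lintegral_const_mul' _ _ ENNReal.ofReal_ne_top,
          lintegral_add_left (hPm.enorm.pow_const 2),
          lintegral_finsetSum _ fun i _ => ((hRm i).enorm.pow_const 2).const_mul _]
        congr 2
        refine Finset.sum_congr rfl fun i _ => ?_
        rw [lintegral_const_mul' _ _ ENNReal.ofReal_ne_top]
    _ ≤ ENNReal.ofReal (2 * B ^ 2) * (ENNReal.ofReal (K * s) +
          ∑ i ∈ Finset.range m, ENNReal.ofReal (w i) * ENNReal.ofReal (K * s)) := by
        gcongr with i
        · exact hf c
        · exact hRb i
    _ ≤ ENNReal.ofReal (2 * B ^ 2) * (ENNReal.ofReal (K * s) + 1 * ENNReal.ofReal (K * s)) := by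
        rw [← Finset.sum_mul, ← ENNReal.ofReal_sum_of_nonneg fun i _ => hw0 i]
        gcongr
        simpa using ENNReal.ofReal_le_ofReal hw1
    _ = _ := by
        rw [one_mul, ← ENNReal.ofReal_add (by positivity) (by positivity),
          ← ENNReal.ofReal_mul (by positivity)]
        congr 1
        ring

end BilinearWave

namespace BilinearWave

/-! ### Geometry of the phase -/

theorem hasDerivAt_div_sqrt_one_add_sq (r : ℝ) :
    HasDerivAt (fun r : ℝ => r / Real.sqrt (1 + r ^ 2)) (1 / (Real.sqrt (1 + r ^ 2) * (1 + r ^ 2)))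
      r := by
  have hpos : 0 < 1 + r ^ 2 := by positivity
  have hs : 0 < Real.sqrt (1 + r ^ 2) := Real.sqrt_pos.2 hpos
  have h1 : HasDerivAt (fun r : ℝ => 1 + r ^ 2) (2 * r) r := by
    simpa using ((hasDerivAt_pow 2 r).const_add 1)
  have h := (hasDerivAt_id r).div (h1.sqrt hpos.ne') hs.ne'
  refine HasDerivAt.congr_deriv (f := fun r : ℝ => r / Real.sqrt (1 + r ^ 2)) h ?_
  have e : Real.sqrt (1 + r ^ 2) ^ 2 = 1 + r ^ 2 := Real.sq_sqrt hpos.le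
  simp only [id]
  field_simp
  rw [e]
  ring

theorem div_sqrt_slope {r r' : ℝ} (h : r' < r) :
    ∃ z ∈ Set.Ioo r' r, r / Real.sqrt (1 + r ^ 2) - r' / Real.sqrt (1 + r' ^ 2) =
      (1 / (Real.sqrt (1 + z ^ 2) * (1 + z ^ 2))) * (r - r') := by
  obtain ⟨z, hz, hz'⟩ := exists_hasDerivAt_eq_slope (fun r : ℝ => r / Real.sqrt (1 + r ^ 2))
    (fun r => 1 / (Real.sqrt (1 + r ^ 2) * (1 + r ^ 2))) h
    (fun x _ => (hasDerivAt_div_sqrt_one_add_sq x).continuousAt.continuousWithinAt)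
    (fun x _ => hasDerivAt_div_sqrt_one_add_sq x)
  refine ⟨z, hz, ?_⟩
  rw [hz', div_mul_cancel₀ _ (by linarith : r - r' ≠ 0)]

theorem div_sqrt_sq_add_sq {x s : ℝ} (hs : 0 < s) :
    x / Real.sqrt (x ^ 2 + s ^ 2) = (x / s) / Real.sqrt (1 + (x / s) ^ 2) := by
  have : x ^ 2 + s ^ 2 = s ^ 2 * (1 + (x / s) ^ 2) := by field_simp; ring
  rw [this, Real.sqrt_mul (by positivity), Real.sqrt_sq hs.le, div_div]

/-- The difference of the first coordinates of two unit vectors, in terms of the determinant. -/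
theorem exists_dirDiff {x s y w : ℝ} (hs : 0 < s) (hw : 0 < w) :
    ∃ m : ℝ, 0 < m ∧ m ≤ 1 ∧ (|x| ≤ s → |y| ≤ w → 1 / 4 ≤ m) ∧
      x / Real.sqrt (x ^ 2 + s ^ 2) - y / Real.sqrt (y ^ 2 + w ^ 2) =
        m * ((x * w - s * y) / (s * w)) := by
  have key : ∀ z : ℝ, 0 < 1 / (Real.sqrt (1 + z ^ 2) * (1 + z ^ 2)) ∧
      1 / (Real.sqrt (1 + z ^ 2) * (1 + z ^ 2)) ≤ 1 ∧
      (|z| ≤ 1 → 1 / 4 ≤ 1 / (Real.sqrt (1 + z ^ 2) * (1 + z ^ 2))) := by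
    intro z
    have h0 : 1 ≤ Real.sqrt (1 + z ^ 2) := by
      rw [Real.one_le_sqrt]; nlinarith [sq_nonneg z]
    have h1 : 1 ≤ 1 + z ^ 2 := by nlinarith [sq_nonneg z]
    refine ⟨by positivity, ?_, fun hz => ?_⟩
    · rw [div_le_one (by positivity)]; nlinarith
    · have h2 : z ^ 2 ≤ 1 := by rwa [sq_le_one_iff_abs_le_one]
      have h3 : Real.sqrt (1 + z ^ 2) ≤ 2 := by
        rw [Real.sqrt_le_left (by norm_num)]; linarith
      apply one_div_le_one_div_of_le (by positivity)
      nlinarith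
  have e : (x * w - s * y) / (s * w) = x / s - y / w := by field_simp
  rw [div_sqrt_sq_add_sq hs, div_sqrt_sq_add_sq hw, e]
  have hxy : |x| ≤ s → |y| ≤ w → |x / s| ≤ 1 ∧ |y / w| ≤ 1 := by
    intro h1 h2
    rw [abs_div, abs_div, abs_of_pos hs, abs_of_pos hw, div_le_one hs, div_le_one hw]
    exact ⟨h1, h2⟩
  -- The factor m is the derivative of r/√(1+r²) at a mean value point between the two slopes. If
  -- the slopes agree both sides vanish, and m = 1 serves.
  rcases lt_trichotomy (y / w) (x / s) with h | h | h
  · obtain ⟨z, hz, hz'⟩ := div_sqrt_slope h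
    refine ⟨_, (key z).1, (key z).2.1, fun h1 h2 => (key z).2.2 ?_, hz'⟩
    obtain ⟨h3, h4⟩ := hxy h1 h2
    rw [abs_le] at *
    exact ⟨by linarith [hz.1], by linarith [hz.2]⟩
  · exact ⟨1, one_pos, le_rfl, fun _ _ => by norm_num, by rw [h]; ring⟩
  · obtain ⟨z, hz, hz'⟩ := div_sqrt_slope h
    refine ⟨_, (key z).1, (key z).2.1, fun h1 h2 => (key z).2.2 ?_, by linarith⟩
    obtain ⟨h3, h4⟩ := hxy h1 h2
    rw [abs_le] at *
    exact ⟨by linarith [hz.1], by linarith [hz.2]⟩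

/-- The phase `|ξ| + |η - ξ|` on a line in direction of the first axis. -/
noncomputable def linePhase (s w a x : ℝ) : ℝ :=
  Real.sqrt (x ^ 2 + s ^ 2) + Real.sqrt ((a - x) ^ 2 + w ^ 2)

theorem hasDerivAt_linePhase {s w : ℝ} (hs : 0 < s) (hw : 0 < w) (a x : ℝ) :
    HasDerivAt (linePhase s w a) (x / Real.sqrt (x ^ 2 + s ^ 2) -
      (a - x) / Real.sqrt ((a - x) ^ 2 + w ^ 2)) x := by
  have h1 : HasDerivAt (fun x : ℝ => x ^ 2 + s ^ 2) (2 * x) x := by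
    simpa using ((hasDerivAt_pow 2 x).add_const (s ^ 2))
  have h2 : HasDerivAt (fun x : ℝ => (a - x) ^ 2 + w ^ 2) (2 * (a - x) * (-1)) x := by
    have h := (((hasDerivAt_id x).const_sub a).pow 2).add_const (w ^ 2)
    simpa using h
  have h := (h1.sqrt (by positivity)).add (h2.sqrt (by positivity))
  refine HasDerivAt.congr_deriv (f := linePhase s w a) h ?_
  have e1 : 0 < Real.sqrt (x ^ 2 + s ^ 2) := Real.sqrt_pos.2 (by positivity)
  have e2 : 0 < Real.sqrt ((a - x) ^ 2 + w ^ 2) := Real.sqrt_pos.2 (by positivity)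
  field_simp
  ring

/-- The determinant along the line. -/
theorem lineDet_eq (s w a x : ℝ) (h : s + w ≠ 0) :
    x * w - s * (a - x) = (s + w) * (x - s * a / (s + w)) := by
  field_simp
  ring

/-- The phase is critical at x₀ = sa/(s+w), where the determinant vanishes. Between x₀ and x its
derivative is at most 16D/N², while |x - x₀| ≤ 2D/N because the determinant is affine with slope s +
w ≥ N/2. For D of order θN² the variation of the phase is thus of order θ²N, a factor θ better than
the length of the line segment. -/
theorem abs_linePhase_sub_le {s w N D : ℝ} (hN : 0 < N) (hs : N / 4 ≤ s) (hw : N / 4 ≤ w)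
    (a x : ℝ) (hx : |x * w - s * (a - x)| ≤ D) :
    |linePhase s w a x - linePhase s w a (s * a / (s + w))| ≤ 32 * D ^ 2 / N ^ 3 := by
  have hs0 : 0 < s := by linarith
  have hw0 : 0 < w := by linarith
  have hsw : 0 < s + w := by linarith
  have hD0 : 0 ≤ D := (abs_nonneg _).trans hx
  set x₀ := s * a / (s + w) with hx₀
  have hx' : (s + w) * |x - x₀| ≤ D := by
    rwa [lineDet_eq s w a x hsw.ne', abs_mul, abs_of_pos hsw] at hx
  have hb : ∀ y ∈ Set.uIcc x₀ x, ‖y / Real.sqrt (y ^ 2 + s ^ 2) -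
      (a - y) / Real.sqrt ((a - y) ^ 2 + w ^ 2)‖ ≤ 16 * D / N ^ 2 := by
    intro y hy
    obtain ⟨m, hm0, hm1, -, hm⟩ := exists_dirDiff (x := y) (y := a - y) hs0 hw0
    rw [Real.norm_eq_abs, hm, lineDet_eq s w a y hsw.ne', abs_mul, abs_of_pos hm0, abs_div,
      abs_mul, abs_of_pos hsw, abs_of_pos (mul_pos hs0 hw0)]
    have hyx : |y - x₀| ≤ |x - x₀| := Set.abs_sub_left_of_mem_uIcc hy
    have h1 : (s + w) * |y - x₀| ≤ D := by
      refine le_trans ?_ hx'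
      gcongr
    have h2 : N ^ 2 / 16 ≤ s * w := by nlinarith
    calc m * ((s + w) * |y - x₀| / (s * w)) ≤ 1 * (D / (N ^ 2 / 16)) := by gcongr
      _ = _ := by field_simp
  have h := (convex_uIcc x₀ x).norm_image_sub_le_of_norm_hasDerivWithin_le
    (fun y _ => (hasDerivAt_linePhase hs0 hw0 a y).hasDerivWithinAt) hb
    Set.left_mem_uIcc Set.right_mem_uIcc
  rw [Real.norm_eq_abs, Real.norm_eq_abs] at h
  refine h.trans ?_
  have h3 : |x - x₀| ≤ D / (N / 2) := by
    rw [le_div_iff₀ (by positivity)]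
    nlinarith [abs_nonneg (x - x₀)]
  calc 16 * D / N ^ 2 * |x - x₀| ≤ 16 * D / N ^ 2 * (D / (N / 2)) := by gcongr
    _ = _ := by field_simp; ring

/-- By Rolle, two equal values would enclose a critical point, which is the zero of the increasing
affine function det. The determinant would then have opposite signs at the two points, contrary to
the sign ε being fixed. -/
theorem linePhase_injOn {s w : ℝ} (hs : 0 < s) (hw : 0 < w) (a ε : ℝ) :
    Set.InjOn (linePhase s w a) {x | 0 < ε * (x * w - s * (a - x))} := by
  have key : ∀ x y : ℝ, x < y → 0 < ε * (x * w - s * (a - x)) →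
      0 < ε * (y * w - s * (a - y)) → linePhase s w a x ≠ linePhase s w a y := by
    intro x y hxy hx hy heq
    obtain ⟨z, hz, hz'⟩ := exists_hasDerivAt_eq_zero hxy
      (fun u _ => (hasDerivAt_linePhase hs hw a u).continuousAt.continuousWithinAt) heq
      (fun u _ => hasDerivAt_linePhase hs hw a u)
    obtain ⟨m, hm0, -, -, hm⟩ := exists_dirDiff (x := z) (y := a - z) hs hw
    rw [hm] at hz'
    have hdet : z * w - s * (a - z) = 0 := by
      rcases mul_eq_zero.1 hz' with h | h
      · exact absurd h hm0.ne'
      · rcases div_eq_zero_iff.1 h with h | h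
        · exact h
        · exact absurd h (mul_pos hs hw).ne'
    have hsw : 0 < s + w := by linarith
    have e1 : 0 < ε * ((x - z) * (s + w)) := by
      rwa [show (x - z) * (s + w) = x * w - s * (a - x) by linear_combination -hdet]
    have e2 : 0 < ε * ((y - z) * (s + w)) := by
      rwa [show (y - z) * (s + w) = y * w - s * (a - y) by linear_combination -hdet]
    have p1 : (x - z) * (s + w) < 0 := mul_neg_of_neg_of_pos (by linarith [hz.1]) hsw
    have p2 : 0 < (y - z) * (s + w) := mul_pos (by linarith [hz.2]) hsw
    rcases lt_trichotomy ε 0 with h | h | h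
    · nlinarith
    · simp [h] at e1
    · nlinarith
  intro x hx y hy hxy
  rcases lt_trichotomy x y with h | h | h
  · exact absurd hxy (key x y h hx hy)
  · exact h
  · exact absurd hxy.symm (key y x h hy hx)

end BilinearWave

namespace BilinearWave

/-! ### Fibre estimates -/

/-- The absolute constant of the fibre estimate. -/
noncomputable def fibreConst : ℝ := 1280 * Real.exp (128 ^ 2)

theorem fibreConst_ge : 16 ≤ fibreConst := by
  have : 1 ≤ Real.exp (128 ^ 2) := Real.one_le_exp (by positivity)
  unfold fibreConst
  linarith

/-- The part of a line on which both frequencies lie in the cone and their determinant has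
size at most (comparable to, if `b` holds) `θ N ^ 2`. -/
def lineRegion (N θ : ℝ) (b : Prop) (s w a : ℝ) : Set ℝ :=
  {x | |x| ≤ s ∧ |a - x| ≤ w ∧ |x * w - s * (a - x)| ≤ 2 * (θ * N ^ 2) ∧
    (b → θ * N ^ 2 / 2 ≤ |x * w - s * (a - x)|)}

/-- The bound without oscillation: the region lies in an interval of length 8θN about the critical
point, and the sum is estimated by Cauchy–Schwarz. It serves the smallest angle, where the phase
derivative has no lower bound. -/
theorem setLIntegral_lineRegion_le_of_card {E : Finset ℝ} {N θ s w : ℝ} (hN : 0 < N)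
    (hs : N / 4 ≤ s) (hw : N / 4 ≤ w) (a : ℝ) (b : Prop) (c : ℝ → ℂ) (u : ℝ → ℝ) :
    ∫⁻ x in lineRegion N θ b s w a,
        ‖∑ t ∈ E, c t * Complex.exp (Complex.I * ((t * u x : ℝ) : ℂ))‖ₑ ^ 2 ≤
      ENNReal.ofReal (E.card * (8 * (θ * N)) * ∑ t ∈ E, ‖c t‖ ^ 2) := by
  have hsw : 0 < s + w := by linarith
  set x₀ := s * a / (s + w) with hx₀
  have hsub : lineRegion N θ b s w a ⊆ Set.Icc (x₀ - 4 * (θ * N)) (x₀ + 4 * (θ * N)) := by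
    rintro x ⟨-, -, hx, -⟩
    rw [lineDet_eq s w a x hsw.ne', abs_mul, abs_of_pos hsw] at hx
    have h1 : |x - x₀| ≤ 4 * (θ * N) := by
      have h2 : N / 2 * |x - x₀| ≤ N / 2 * (4 * (θ * N)) := by
        calc N / 2 * |x - x₀| ≤ (s + w) * |x - x₀| := by gcongr; linarith
          _ ≤ 2 * (θ * N ^ 2) := hx
          _ = _ := by ring
      exact le_of_mul_le_mul_left h2 (by positivity)
    rw [abs_le] at h1
    exact ⟨by linarith [h1.1], by linarith [h1.2]⟩
  have hpt : ∀ x, ‖∑ t ∈ E, c t * Complex.exp (Complex.I * ((t * u x : ℝ) : ℂ))‖ₑ ^ 2 ≤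
      ENNReal.ofReal (E.card * ∑ t ∈ E, ‖c t‖ ^ 2) := by
    intro x
    rw [← ofReal_norm, ← ENNReal.ofReal_pow (norm_nonneg _)]
    refine ENNReal.ofReal_le_ofReal ?_
    calc _ ≤ (∑ t ∈ E, ‖c t‖) ^ 2 := by
          gcongr
          refine (norm_sum_le _ _).trans (le_of_eq (Finset.sum_congr rfl fun t _ => ?_))
          rw [norm_mul, mul_comm Complex.I, Complex.norm_exp_ofReal_mul_I, mul_one]
      _ ≤ _ := sq_sum_le_card_mul_sum_sq
  calc _ ≤ ∫⁻ x in lineRegion N θ b s w a, ENNReal.ofReal (E.card * ∑ t ∈ E, ‖c t‖ ^ 2) :=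
        lintegral_mono fun x => hpt x
    _ ≤ ∫⁻ x in Set.Icc (x₀ - 4 * (θ * N)) (x₀ + 4 * (θ * N)),
          ENNReal.ofReal (E.card * ∑ t ∈ E, ‖c t‖ ^ 2) := lintegral_mono_set hsub
    _ = _ := by
        rw [setLIntegral_const, Real.volume_Icc, ← ENNReal.ofReal_mul (by positivity)]
        congr 1
        ring

/-- Almost orthogonality in the phase variable. Dividing the count Q by ℓ times the phase derivative
~θ leaves Q·θ²N/θ = Q·θN. -/
theorem setLIntegral_lineRegion_le_of_separated {E : Finset ℝ} {N θ s w ℓ Q σ : ℝ} (hN : 0 < N)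
    (hθ : 0 < θ) (hℓ : ℓ * (θ ^ 2 * N) = 1) (hσ : σ = 1 ∨ σ = -1)
    (hQ : ∀ s : ℝ, ((E.filter fun t => t ∈ Set.Icc s (s + ℓ)).card : ℝ) ≤ Q)
    (hs : N / 4 ≤ s) (hw : N / 4 ≤ w) (hs2 : s ≤ 2 * N) (hw2 : w ≤ 2 * N) (a : ℝ) {b : Prop}
    (hb : b) (c : ℝ → ℂ) :
    ∫⁻ x in lineRegion N θ b s w a,
        ‖∑ t ∈ E, c t * Complex.exp (Complex.I * ((t * (σ * linePhase s w a x) : ℝ) : ℂ))‖ₑ ^ 2 ≤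
      ENNReal.ofReal (fibreConst * Q * (θ * N) * ∑ t ∈ E, ‖c t‖ ^ 2) := by
  have hℓ0 : 0 < ℓ := by
    by_contra h
    push Not at h
    have : ℓ * (θ ^ 2 * N) ≤ 0 := mul_nonpos_of_nonpos_of_nonneg h (by positivity)
    linarith
  have hs0 : 0 < s := by linarith
  have hw0 : 0 < w := by linarith
  have hσa : |σ| = 1 := by rcases hσ with h | h <;> simp [h]
  have hσ0 : σ ≠ 0 := by rcases hσ with h | h <;> simp [h]
  have hQ0 : 0 ≤ Q := (Nat.cast_nonneg _).trans (hQ 0)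
  set g : ℝ → ℝ≥0∞ := fun x =>
    ‖∑ t ∈ E, c t * Complex.exp (Complex.I * ((t * (σ * linePhase s w a x) : ℝ) : ℂ))‖ₑ ^ 2
    with hg
  -- The sign of ε selects one side of the critical point, where the phase is injective. The two
  -- sides together cover the region, because the determinant does not vanish on it.
  have part : ∀ ε : ℝ,
      ∫⁻ x in lineRegion N θ b s w a ∩ {x | 0 < ε * (x * w - s * (a - x))}, g x ≤
      ENNReal.ofReal (fibreConst / 2 * Q * (θ * N) * ∑ t ∈ E, ‖c t‖ ^ 2) := by
    intro ε
    have hmeas : MeasurableSet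
        (lineRegion N θ b s w a ∩ {x | 0 < ε * (x * w - s * (a - x))}) := by
      have e : lineRegion N θ b s w a = {x | |x| ≤ s} ∩ ({x | |a - x| ≤ w} ∩
          ({x | |x * w - s * (a - x)| ≤ 2 * (θ * N ^ 2)} ∩
            {x | θ * N ^ 2 / 2 ≤ |x * w - s * (a - x)|})) := by
        ext x; simp [lineRegion, hb]
      rw [e]
      refine MeasurableSet.inter (MeasurableSet.inter ?_ (MeasurableSet.inter ?_
        (MeasurableSet.inter ?_ ?_))) ?_
      · exact (isClosed_le (by fun_prop) (by fun_prop)).measurableSet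
      · exact (isClosed_le (by fun_prop) (by fun_prop)).measurableSet
      · exact (isClosed_le (by fun_prop) (by fun_prop)).measurableSet
      · exact (isClosed_le (by fun_prop) (by fun_prop)).measurableSet
      · exact (isOpen_lt (by fun_prop) (by fun_prop)).measurableSet
    -- The derivative is at least (1/4)(θN²/2)/(4N²) = θ/32. The variation of the phase is at most
    -- 32(2θN²)²/N³ = 128θ²N = 128/ℓ, hence A = 128.
    have h := setLIntegral_expSum_le (E := E) (ℓ := ℓ) (Q := Q) (κ := θ / 32) (A := 128)
      (v₀ := σ * linePhase s w a (s * a / (s + w))) hℓ0 (by positivity) hQ hmeas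
      (u := fun x => σ * linePhase s w a x)
      (u' := fun x => σ * (x / Real.sqrt (x ^ 2 + s ^ 2) -
        (a - x) / Real.sqrt ((a - x) ^ 2 + w ^ 2)))
      (fun x _ => (hasDerivAt_linePhase hs0 hw0 a x).const_mul σ)
      (fun x hx y hy hxy => linePhase_injOn hs0 hw0 a ε hx.2 hy.2 (mul_left_cancel₀ hσ0 hxy))
      (by
        rintro x ⟨⟨h1, h2, -, h4⟩, -⟩
        obtain ⟨m, hm0, -, hm, hm'⟩ := exists_dirDiff (x := x) (y := a - x) hs0 hw0
        rw [hm', abs_mul, hσa, one_mul, abs_mul, abs_of_pos hm0, abs_div,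
          abs_of_pos (mul_pos hs0 hw0)]
        have hsw : s * w ≤ 4 * N ^ 2 := by nlinarith
        calc θ / 32 = 1 / 4 * ((θ * N ^ 2 / 2) / (4 * N ^ 2)) := by field_simp; norm_num
          _ ≤ m * (|x * w - s * (a - x)| / (s * w)) := by
              gcongr
              · exact hm h1 h2
              · exact h4 hb)
      (by
        rintro x ⟨⟨-, -, h3, -⟩, -⟩
        have h := abs_linePhase_sub_le hN hs hw a x h3
        rw [← mul_sub, abs_mul, hσa, one_mul]
        calc ℓ * |linePhase s w a x - linePhase s w a (s * a / (s + w))| ≤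
            ℓ * (32 * (2 * (θ * N ^ 2)) ^ 2 / N ^ 3) := by gcongr
          _ = 128 * (ℓ * (θ ^ 2 * N)) := by field_simp; ring
          _ = 128 := by rw [hℓ]; ring
          _ ≤ 128 := le_rfl) c
    refine h.trans (le_of_eq ?_)
    congr 2
    have e : 1 / ℓ = θ ^ 2 * N := by rw [← hℓ]; field_simp
    calc Real.exp (128 ^ 2) * (20 * Q / (ℓ * (θ / 32)))
        = Real.exp (128 ^ 2) * (640 * Q / θ * (1 / ℓ)) := by field_simp; ring
      _ = _ := by rw [e]; unfold fibreConst; field_simp; ring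
  have hsub : lineRegion N θ b s w a ⊆
      (lineRegion N θ b s w a ∩ {x | 0 < 1 * (x * w - s * (a - x))}) ∪
      (lineRegion N θ b s w a ∩ {x | 0 < (-1) * (x * w - s * (a - x))}) := by
    intro x hx
    have h4 := hx.2.2.2 hb
    have : 0 < |x * w - s * (a - x)| := lt_of_lt_of_le (by positivity) h4
    rcases lt_or_gt_of_ne (abs_pos.1 this) with h | h
    · right; exact ⟨hx, by simp only [Set.mem_ofPred_eq]; linarith⟩
    · left; exact ⟨hx, by simp only [Set.mem_ofPred_eq]; linarith⟩
  calc ∫⁻ x in lineRegion N θ b s w a, g x ≤ _ := lintegral_mono_set hsub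
    _ ≤ _ := lintegral_union_le _ _ _
    _ ≤ _ := add_le_add (part 1) (part (-1))
    _ = _ := by
        have : 0 ≤ fibreConst := by linarith [fibreConst_ge]
        rw [← ENNReal.ofReal_add (by positivity) (by positivity)]
        congr 1
        ring

/-- Slicing by lines parallel to the first axis, the direction in which the phase is analysed. -/
theorem lintegral_plane {g : Plane → ℝ≥0∞} (hg : Measurable g) :
    ∫⁻ ξ, g ξ = ∫⁻ s : ℝ, ∫⁻ x : ℝ, g !₂[x, s] := by
  have m1 := (EuclideanSpace.volume_preserving_symm_measurableEquiv_toLp (Fin 2)).symm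
  have m2 := (volume_preserving_finTwoArrow ℝ).symm
  rw [← m1.lintegral_comp hg]
  have hg' : Measurable fun z : Fin 2 → ℝ => g (WithLp.toLp 2 z) :=
    hg.comp (MeasurableEquiv.toLp 2 (Fin 2 → ℝ)).measurable
  have h2 := m2.lintegral_comp hg'
  refine Eq.trans ?_ (h2.symm.trans ?_)
  · rfl
  · rw [Measure.volume_eq_prod, lintegral_prod_symm]
    · refine lintegral_congr fun s => lintegral_congr fun x => ?_
      congr 1
    · exact (hg'.comp (MeasurableEquiv.finTwoArrow (α := ℝ)).symm.measurable).aemeasurable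

/-- The frequency cone at height comparable to `N`. -/
def InCone (N : ℝ) (ξ : Plane) : Prop := |ξ 0| ≤ ξ 1 ∧ N / 4 ≤ ξ 1 ∧ ξ 1 ≤ 2 * N

/-- The determinant of a pair of vectors. -/
def planeDet (p : Plane × Plane) : ℝ := p.1 0 * p.2 1 - p.1 1 * p.2 0

/-- Pairs of frequencies of size `N` at angle at most (comparable to, if `b` holds) `θ`. -/
def angleRegion (N θ : ℝ) (b : Prop) : Set (Plane × Plane) :=
  {p | InCone N p.1 ∧ InCone N p.2 ∧ |planeDet p| ≤ 2 * (θ * N ^ 2) ∧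
    (b → θ * N ^ 2 / 2 ≤ |planeDet p|)}

theorem continuous_planeDet : Continuous planeDet := by
  unfold planeDet; fun_prop

theorem isClosed_inCone (N : ℝ) : IsClosed {ξ : Plane | InCone N ξ} := by
  have h0 : Continuous fun ξ : Plane => |ξ 0| := by fun_prop
  have h1 : Continuous fun ξ : Plane => ξ 1 := by fun_prop
  exact (isClosed_le h0 h1).inter
    ((isClosed_le continuous_const h1).inter (isClosed_le h1 continuous_const))

theorem isClosed_angleRegion (N θ : ℝ) (b : Prop) : IsClosed (angleRegion N θ b) := by
  have hd := continuous_planeDet.abs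
  refine IsClosed.inter ((isClosed_inCone N).preimage continuous_fst) (IsClosed.inter
    ((isClosed_inCone N).preimage continuous_snd) (IsClosed.inter
      (isClosed_le hd continuous_const) ?_))
  by_cases hb : b
  · simp only [hb, forall_const]
    exact isClosed_le continuous_const hd
  · simp only [hb, false_imp_iff]
    exact isClosed_univ

theorem norm_plane (x s : ℝ) : ‖(!₂[x, s] : Plane)‖ = Real.sqrt (x ^ 2 + s ^ 2) := by
  rw [EuclideanSpace.norm_eq, Fin.sum_univ_two]
  simp

/-- The space-time exponentials restricted to a fibre of the angular region. -/
noncomputable def fibreExp (R : Set (Plane × Plane)) (σ : ℝ) (η : Plane) (t : ℝ) (ξ : Plane) : ℂ :=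
  ((fun ξ => (ξ, η - ξ)) ⁻¹' R).indicator
    (fun ξ => Complex.exp (Complex.I * ((t * (σ * (‖ξ‖ + ‖η - ξ‖)) : ℝ) : ℂ))) ξ

theorem measurable_fibreExp {R : Set (Plane × Plane)} (hR : MeasurableSet R) (σ : ℝ) (η : Plane)
    (t : ℝ) : Measurable (fibreExp R σ η t) := by
  refine Measurable.indicator (Continuous.measurable (by fun_prop)) ?_
  exact hR.preimage (by fun_prop)

/-- The fibre estimate: almost orthogonality in time on the fibre `ξ + ζ = η`. -/
theorem isBesselFamily_fibreExp {E : Finset ℝ} {N θ ℓ Q σ : ℝ} (hN : 0 < N)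
    (hθ : 0 < θ) (hℓ : ℓ * (θ ^ 2 * N) = 1) (hσ : σ = 1 ∨ σ = -1)
    (hQ : ∀ s : ℝ, ((E.filter fun t => t ∈ Set.Icc s (s + ℓ)).card : ℝ) ≤ Q) {b : Prop}
    (hb : b ∨ (E.card : ℝ) ≤ 2 * Q) (η : Plane) :
    IsBesselFamily volume E (fibreExp (angleRegion N θ b) σ η)
      (2 * fibreConst * Q * θ * N ^ 2) := by
  intro c
  have hQ0 : 0 ≤ Q := (Nat.cast_nonneg _).trans (hQ 0)
  have hC := fibreConst_ge
  set R := angleRegion N θ b with hR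
  have hRm : MeasurableSet R := (isClosed_angleRegion N θ b).measurableSet
  set T := ∑ t ∈ E, ‖c t‖ ^ 2 with hT
  have hmeas : Measurable fun ξ => ∑ t ∈ E, c t * fibreExp R σ η t ξ :=
    Finset.measurable_fun_sum E fun t _ => measurable_const.mul (measurable_fibreExp hRm σ η t)
  rw [lintegral_plane (hmeas.enorm.pow_const 2)]
  have hs : ∀ s : ℝ, ∫⁻ x : ℝ, ‖∑ t ∈ E, c t * fibreExp R σ η t !₂[x, s]‖ₑ ^ 2 ≤
      (Set.Icc 0 (2 * N)).indicator
        (fun _ => ENNReal.ofReal (fibreConst * Q * (θ * N) * T)) s := by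
    intro s
    -- For other heights s one of the two frequencies leaves the cone and the slice is empty. The
    -- admissible heights have total length at most 2N, which gives the last factor of the constant.
    by_cases hs : (N / 4 ≤ s ∧ s ≤ 2 * N) ∧ (N / 4 ≤ η 1 - s ∧ η 1 - s ≤ 2 * N)
    · obtain ⟨⟨h1, h2⟩, h3, h4⟩ := hs
      rw [Set.indicator_of_mem (show s ∈ Set.Icc 0 (2 * N) from ⟨by linarith, h2⟩)]
      have hpt : ∀ x : ℝ, ‖∑ t ∈ E, c t * fibreExp R σ η t !₂[x, s]‖ₑ ^ 2 ≤
          (lineRegion N θ b s (η 1 - s) (η 0)).indicator (fun x =>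
            ‖∑ t ∈ E, c t * Complex.exp (Complex.I *
              ((t * (σ * linePhase s (η 1 - s) (η 0) x) : ℝ) : ℂ))‖ₑ ^ 2) x := by
        intro x
        by_cases hx : ((!₂[x, s] : Plane), η - !₂[x, s]) ∈ R
        · have hx' : x ∈ lineRegion N θ b s (η 1 - s) (η 0) := by
            obtain ⟨a1, a2, a3, a4⟩ := hx
            simp only [InCone, planeDet] at a1 a2 a3 a4
            simp at a1 a2 a3 a4
            exact ⟨a1.1, a2.1, a3, a4⟩
          rw [Set.indicator_of_mem hx']
          have e : η - !₂[x, s] = !₂[η 0 - x, η 1 - s] := by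
            ext i; fin_cases i <;> simp
          have e' : ∀ t, fibreExp R σ η t !₂[x, s] = Complex.exp (Complex.I *
              ((t * (σ * linePhase s (η 1 - s) (η 0) x) : ℝ) : ℂ)) := fun t => by
            rw [fibreExp, Set.indicator_of_mem (by exact hx), e, norm_plane, norm_plane]
            rfl
          simp_rw [e']
          exact le_rfl
        · have : ∀ t, fibreExp R σ η t !₂[x, s] = 0 := fun t => by
            rw [fibreExp, Set.indicator_of_notMem (by exact hx)]
          simp [this]
      have hm : MeasurableSet (lineRegion N θ b s (η 1 - s) (η 0)) := by
        have : lineRegion N θ b s (η 1 - s) (η 0) = (fun x : ℝ => ((!₂[x, s] : Plane), η - !₂[x, s])) ⁻¹' R := by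
          ext x
          simp only [Set.mem_preimage, hR, angleRegion, lineRegion, InCone, planeDet,
            Set.mem_ofPred_eq]
          simp [h1, h2, h3, h4]
        rw [this]
        refine hRm.preimage (Continuous.measurable ?_)
        fun_prop
      refine (lintegral_mono hpt).trans ?_
      rw [lintegral_indicator hm]
      -- With a lower bound for the angle the oscillation is used; otherwise the cardinality bound
      -- with |E| ≤ 2Q. In the second case 2·8 = 16 is absorbed by `fibreConst`.
      by_cases hb' : b
      · exact setLIntegral_lineRegion_le_of_separated hN hθ hℓ hσ hQ h1 h3 h2 h4 (η 0) hb' c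
      · have hcard := hb.resolve_left hb'
        refine (setLIntegral_lineRegion_le_of_card hN h1 h3 (η 0) b c _).trans ?_
        apply ENNReal.ofReal_le_ofReal
        have hT0 : 0 ≤ T := by positivity
        calc (E.card : ℝ) * (8 * (θ * N)) * T ≤ 2 * Q * (8 * (θ * N)) * T := by gcongr
          _ = 16 * Q * (θ * N) * T := by ring
          _ ≤ _ := by gcongr
    · have : ∀ x t : ℝ, fibreExp R σ η t !₂[x, s] = 0 := by
        intro x t
        rw [fibreExp, Set.indicator_of_notMem]
        rintro ⟨a1, a2, -, -⟩
        simp only [InCone] at a1 a2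
        apply hs
        simp at a1 a2
        exact ⟨⟨a1.2.1, a1.2.2⟩, a2.2.1, by linarith [a2.2.2]⟩
      simp [this]
  refine (lintegral_mono hs).trans ?_
  rw [lintegral_indicator measurableSet_Icc, setLIntegral_const, Real.volume_Icc,
    ← ENNReal.ofReal_mul (by positivity)]
  apply ENNReal.ofReal_le_ofReal
  apply le_of_eq
  ring

end BilinearWave

namespace BilinearWave

/-! ### Bilinear operators with general symbols -/

/-- The operator `F ↦ ∫ e^{i⟨x, ξ + ζ⟩} M(ξ, ζ) F̂(ξ, ζ) d(ξ, ζ)`. -/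
noncomputable def freqOp (M : Plane × Plane → ℂ) (F : Plane × Plane → ℂ) (x : Plane) : ℂ :=
  ∫ p : Plane × Plane, Complex.exp (Complex.I * (inner ℝ x (p.1 + p.2) : ℝ)) * M p * fourierPair F p

theorem norm_exp_I_mul (r : ℝ) : ‖Complex.exp (Complex.I * (r : ℂ))‖ = 1 := by
  rw [mul_comm, Complex.norm_exp_ofReal_mul_I]

theorem norm_exp_neg_I_mul (r : ℝ) : ‖Complex.exp (-Complex.I * (r : ℂ))‖ = 1 := by
  have := norm_exp_I_mul (-r)
  push_cast at this
  rwa [mul_neg, ← neg_mul] at this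

theorem norm_fourierPair_le (F : Plane × Plane → ℂ) (p : Plane × Plane) :
    ‖fourierPair F p‖ ≤ ∫ q, ‖F q‖ := by
  refine (norm_integral_le_integral_norm _).trans (le_of_eq ?_)
  refine integral_congr_ae (Filter.Eventually.of_forall fun q => ?_)
  simp only [norm_mul, norm_exp_neg_I_mul, one_mul]

theorem continuous_fourierPair {F : Plane × Plane → ℂ} (hF : Integrable F) :
    Continuous (fourierPair F) := by
  refine continuous_of_dominated (bound := fun q => ‖F q‖) ?_ ?_ hF.norm ?_
  · intro p
    refine AEStronglyMeasurable.mul (Continuous.aestronglyMeasurable ?_) hF.1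
    fun_prop
  · intro p
    refine Filter.Eventually.of_forall fun q => ?_
    simp only [norm_mul, norm_exp_neg_I_mul, one_mul, le_refl]
  · refine Filter.Eventually.of_forall fun q => ?_
    fun_prop

/-- The integration kernel of `freqOp`. -/
noncomputable def freqKernel (M : Plane × Plane → ℂ) (x : Plane) (q : Plane × Plane) : ℂ :=
  ∫ p : Plane × Plane,
    Complex.exp (Complex.I * (inner ℝ (x - q.1) p.1 + inner ℝ (x - q.2) p.2 : ℝ)) * M p

/-- Fubini. In this form a factor depending on (y, z) can be moved from F to the kernel, and from
there to the symbol by integration by parts. -/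
theorem freqOp_eq_integral_kernel {M F : Plane × Plane → ℂ} (hM : Integrable M)
    (hF : Integrable F) (x : Plane) :
    freqOp M F x = ∫ q, freqKernel M x q * F q := by
  have hint : Integrable (fun z : (Plane × Plane) × (Plane × Plane) =>
      Complex.exp (Complex.I *
        (inner ℝ (x - z.2.1) z.1.1 + inner ℝ (x - z.2.2) z.1.2 : ℝ)) * (M z.1 * F z.2))
      (volume.prod volume) := by
    refine (hM.mul_prod hF).bdd_mul (c := 1) (Continuous.aestronglyMeasurable (by fun_prop)) ?_
    exact Filter.Eventually.of_forall fun z => (norm_exp_I_mul _).le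
  have h := integral_integral_swap (f := fun p q : Plane × Plane => Complex.exp (Complex.I *
        (inner ℝ (x - q.1) p.1 + inner ℝ (x - q.2) p.2 : ℝ)) * (M p * F q)) hint
  calc freqOp M F x = ∫ p, ∫ q, Complex.exp (Complex.I *
        (inner ℝ (x - q.1) p.1 + inner ℝ (x - q.2) p.2 : ℝ)) * (M p * F q) := by
        refine integral_congr_ae (Filter.Eventually.of_forall fun p => ?_)
        simp only [fourierPair]
        rw [← integral_const_mul]
        refine integral_congr_ae (Filter.Eventually.of_forall fun q => ?_)
        simp only
        have : Complex.exp (Complex.I *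
            ((inner ℝ (x - q.1) p.1 + inner ℝ (x - q.2) p.2 : ℝ) : ℂ)) =
            Complex.exp (Complex.I * ((inner ℝ x (p.1 + p.2) : ℝ) : ℂ)) *
            Complex.exp (-Complex.I * ((inner ℝ q.1 p.1 + inner ℝ q.2 p.2 : ℝ) : ℂ)) := by
          rw [← Complex.exp_add]
          congr 1
          rw [inner_sub_left, inner_sub_left, inner_add_right]
          push_cast
          ring
        rw [this]
        ring
    _ = _ := h
    _ = _ := by
        refine integral_congr_ae (Filter.Eventually.of_forall fun q => ?_)
        simp only [freqKernel]
        rw [← integral_mul_const]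
        refine integral_congr_ae (Filter.Eventually.of_forall fun p => ?_)
        simp only
        ring

/-- The direction `(e_i, -e_i)` in the frequency space. -/
noncomputable def antiDir (i : Fin 2) : Plane × Plane :=
  (EuclideanSpace.single i 1, -EuclideanSpace.single i 1)

/-- The derivative in direction `(e_i, -e_i)`. -/
noncomputable def antiDeriv (i : Fin 2) (M : Plane × Plane → ℂ) (p : Plane × Plane) : ℂ :=
  fderiv ℝ M p (antiDir i)

theorem integrable_antiDeriv {M : Plane × Plane → ℂ} (hM : ContDiff ℝ 1 M)
    (hc : HasCompactSupport M) (i : Fin 2) : Integrable (antiDeriv i M) := by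
  have hcont : Continuous (antiDeriv i M) :=
    (hM.continuous_fderiv one_ne_zero).clm_apply continuous_const
  refine hcont.integrable_of_hasCompactSupport ?_
  exact (hc.fderiv (𝕜 := ℝ)).comp_left (g := fun L : (Plane × Plane) →L[ℝ] ℂ => L (antiDir i))
    (by simp)

/-- Differentiating the symbol multiplies the kernel by a coordinate of `y - z`. -/
theorem freqKernel_antiDeriv {M : Plane × Plane → ℂ} (hM : ContDiff ℝ 1 M)
    (hc : HasCompactSupport M) (i : Fin 2) (x : Plane) (q : Plane × Plane) :
    freqKernel (antiDeriv i M) x q =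
      Complex.I * ((q.1 i - q.2 i : ℝ) : ℂ) * freqKernel M x q := by
  set ψ : Plane × Plane → ℝ := fun p => inner ℝ (x - q.1) p.1 + inner ℝ (x - q.2) p.2 with hψ
  set L : (Plane × Plane) →L[ℝ] ℝ :=
    (innerSL ℝ (x - q.1)).comp (ContinuousLinearMap.fst ℝ Plane Plane) +
    (innerSL ℝ (x - q.2)).comp (ContinuousLinearMap.snd ℝ Plane Plane) with hL
  have hψL : ∀ p, ψ p = L p := fun p => by
    simp only [hψ, hL, add_apply, ContinuousLinearMap.comp_apply, innerSL_apply_apply]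
    rfl
  have hd : ∀ p, HasFDerivAt (fun p => Complex.exp (Complex.I * (ψ p : ℂ)))
      (Complex.exp (Complex.I * (ψ p : ℂ)) •
        (Complex.I • (Complex.ofRealCLM.comp L))) p := by
    intro p
    have h1 : HasFDerivAt (fun p => (ψ p : ℂ)) (Complex.ofRealCLM.comp L) p := by
      have := (Complex.ofRealCLM.hasFDerivAt (x := ψ p)).comp p (f := ψ)
        (by rw [show ψ = fun p => L p from funext hψL]; exact L.hasFDerivAt)
      exact this
    exact (h1.const_mul Complex.I).cexp
  have hdv : ∀ p, fderiv ℝ (fun p => Complex.exp (Complex.I * (ψ p : ℂ))) p (antiDir i) =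
      -(Complex.I * ((q.1 i - q.2 i : ℝ) : ℂ)) * Complex.exp (Complex.I * (ψ p : ℂ)) := by
    intro p
    rw [(hd p).fderiv]
    simp [hL, antiDir, EuclideanSpace.inner_single_right]
    ring
  have hMi : Integrable M := hM.continuous.integrable_of_hasCompactSupport hc
  have hbdd : ∀ g : Plane × Plane → ℂ, Integrable g →
      Integrable fun p => Complex.exp (Complex.I * (ψ p : ℂ)) * g p := by
    intro g hg
    refine hg.bdd_mul (c := 1) (Continuous.aestronglyMeasurable (by fun_prop)) ?_
    exact Filter.Eventually.of_forall fun p => (norm_exp_I_mul _).le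
  have : (volume : Measure (Plane × Plane)).IsAddHaarMeasure := by
    rw [Measure.volume_eq_prod]; infer_instance
  -- Integration by parts in the direction (e_i, -e_i): the exponential has frequencies x - y and x
  -- - z there, so x cancels and only y_i - z_i remains.
  have h := integral_mul_fderiv_eq_neg_fderiv_mul_of_integrable (μ := volume) (v := antiDir i)
    (f := fun p => Complex.exp (Complex.I * (ψ p : ℂ))) (g := M)
    (by
      simp_rw [hdv, mul_assoc]
      exact ((hbdd M hMi).const_mul _))
    (hbdd _ (integrable_antiDeriv hM hc i)) (hbdd _ hMi)
    (fun p _ => (hd p).differentiableAt) (fun p _ => (hM.differentiable one_ne_zero) p)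
  simp_rw [hdv] at h
  calc freqKernel (antiDeriv i M) x q = _ := h
    _ = _ := by
      simp_rw [mul_assoc]
      rw [integral_const_mul]
      unfold freqKernel
      ring

/-- Multiplication of `F` by a coordinate of `y - z` corresponds to differentiating the symbol. -/
theorem freqOp_antiDeriv {M G : Plane × Plane → ℂ} (hM : ContDiff ℝ 1 M)
    (hc : HasCompactSupport M) (i : Fin 2) (hG : Integrable G)
    (hG' : Integrable fun q => ((q.1 i - q.2 i : ℝ) : ℂ) * G q) (x : Plane) :
    freqOp M (fun q => ((q.1 i - q.2 i : ℝ) : ℂ) * G q) x =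
      -Complex.I * freqOp (antiDeriv i M) G x := by
  have hMi : Integrable M := hM.continuous.integrable_of_hasCompactSupport hc
  rw [freqOp_eq_integral_kernel hMi hG', freqOp_eq_integral_kernel (integrable_antiDeriv hM hc i) hG,
    ← integral_const_mul]
  refine integral_congr_ae (Filter.Eventually.of_forall fun q => ?_)
  simp only
  rw [freqKernel_antiDeriv hM hc i x q]
  linear_combination (((q.1 i - q.2 i : ℝ) : ℂ) * freqKernel M x q * G q) * Complex.I_mul_I

theorem norm_le_of_inCone {N : ℝ} {ξ : Plane} (h : InCone N ξ) : ‖ξ‖ ≤ 4 * N := by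
  obtain ⟨h1, h2, h3⟩ := h
  rw [EuclideanSpace.norm_eq, Real.sqrt_le_left (by linarith [abs_nonneg (ξ 0)]), Fin.sum_univ_two]
  simp only [Real.norm_eq_abs, sq_abs]
  have : ξ 0 ^ 2 ≤ ξ 1 ^ 2 := sq_le_sq' (by linarith [abs_le.1 h1]) (abs_le.1 h1).2
  nlinarith [abs_nonneg (ξ 0)]

theorem isCompact_angleRegion (N θ : ℝ) (b : Prop) : IsCompact (angleRegion N θ b) := by
  refine Metric.isCompact_of_isClosed_isBounded (isClosed_angleRegion N θ b) ?_
  refine (Metric.isBounded_closedBall (x := (0 : Plane × Plane)) (r := 4 * N)).subset ?_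
  rintro p ⟨h1, h2, -, -⟩
  rw [mem_closedBall_zero_iff, Prod.norm_def]
  exact max_le (norm_le_of_inCone h1) (norm_le_of_inCone h2)

/-- The wave phase attached to a pair of frequencies. -/
noncomputable def pairExp (σ t : ℝ) (p : Plane × Plane) : ℂ :=
  Complex.exp (Complex.I * ((t * (σ * (‖p.1‖ + ‖p.2‖)) : ℝ) : ℂ))

theorem continuous_pairExp (σ t : ℝ) : Continuous (pairExp σ t) := by
  unfold pairExp; fun_prop

/-- The space-time estimate for symbols supported on pairs of frequencies at angle `θ`. -/
theorem sum_lintegral_freqOp_sq_le {E : Finset ℝ} (hE : (E : Set ℝ) ⊆ Set.Icc 1 2)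
    {N θ ℓ Q σ B : ℝ} (hN : 0 < N)
    (hθ : 0 < θ) (hℓ : ℓ * (θ ^ 2 * N) = 1) (hσ : σ = 1 ∨ σ = -1)
    (hQ : ∀ s : ℝ, ((E.filter fun t => t ∈ Set.Icc s (s + ℓ)).card : ℝ) ≤ Q) {b : Prop}
    (hb : b ∨ (E.card : ℝ) ≤ 2 * Q) {n : ℝ → Plane × Plane → ℂ} (hn : ∀ t ∈ E, Measurable (n t))
    (hsupp : ∀ t ∈ E, ∀ p, p ∉ angleRegion N θ b → n t p = 0)
    (hB : ∀ t ∈ E, ∀ p, ‖n t p‖ ≤ B)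
    (hL : ∀ t ∈ E, ∀ s ∈ E, ∀ p, ‖n t p - n s p‖ ≤ B * |t - s|)
    {G : Plane × Plane → ℂ} (hG : Integrable G) (hG2 : MemLp G 2) :
    ∑ t ∈ E, ∫⁻ x, ‖freqOp (fun p => pairExp σ t p * n t p) G x‖ₑ ^ 2 ≤
      ENNReal.ofReal ((2 * Real.pi) ^ 6 * (4 * B ^ 2 * (2 * fibreConst * Q * θ * N ^ 2))) *
        ∫⁻ q, ‖G q‖ₑ ^ 2 := by
  have hQ0 : 0 ≤ Q := (Nat.cast_nonneg _).trans (hQ 0)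
  have hC : 0 ≤ fibreConst := by linarith [fibreConst_ge]
  set R := angleRegion N θ b with hR
  have hRm : MeasurableSet R := (isClosed_angleRegion N θ b).measurableSet
  set K := 2 * fibreConst * Q * θ * N ^ 2 with hK
  have hK0 : 0 ≤ K := by positivity
  set H : Plane × Plane → ℂ := fourierPair G with hH
  have hHc : Continuous H := continuous_fourierPair hG
  set Ψ : ℝ → Plane × Plane → ℂ := fun t p => pairExp σ t p * n t p * H p with hΨ
  have hΨi : ∀ t ∈ E, Integrable (Ψ t) := by
    intro t ht
    have h1 : Integrable (R.indicator fun _ : Plane × Plane => B * ∫ q, ‖G q‖) :=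
      (integrableOn_const (isCompact_angleRegion N θ b).measure_lt_top.ne).integrable_indicator hRm
    refine h1.mono (((continuous_pairExp σ t).measurable.mul (hn t ht)).mul
      hHc.measurable).aestronglyMeasurable (Filter.Eventually.of_forall fun p => ?_)
    by_cases hp : p ∈ R
    · rw [Set.indicator_of_mem hp]
      refine le_trans ?_ (Real.le_norm_self _)
      simp only [hΨ, norm_mul]
      rw [show ‖pairExp σ t p‖ = 1 from norm_exp_I_mul _, one_mul]
      have := hB t ht p
      have := norm_nonneg (n t p)
      gcongr
      · linarith
      · exact norm_fourierPair_le G p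
    · simp only [hΨ, hsupp t ht p hp, mul_zero, zero_mul, norm_zero]
      positivity
  -- The shear (ξ, η) ↦ (ξ, η - ξ) preserves measure and turns the operator into the Fourier
  -- integral in η of the fibre integrals h t.
  have mp := measurePreserving_prod_sub (G := Plane) volume volume
  set e : Plane × Plane → Plane × Plane := fun z => (z.1, z.2 - z.1) with he
  have emb : MeasurableEmbedding e := by
    refine Measurable.measurableEmbedding (Continuous.measurable (by fun_prop)) ?_
    rintro ⟨z1, z2⟩ ⟨w1, w2⟩ h
    simp only [he, Prod.mk.injEq] at h
    obtain ⟨rfl, h⟩ := h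
    simpa using h
  set h : ℝ → Plane → ℂ := fun t η => ∫ ξ, Ψ t (ξ, η - ξ) with hh
  have hshear : ∀ t ∈ E, Integrable (fun z : Plane × Plane => Ψ t (z.1, z.2 - z.1))
      (volume.prod volume) := fun t ht => (mp.integrable_comp_emb emb).2 (hΨi t ht)
  have hh1 : ∀ t ∈ E, Integrable (h t) := fun t ht => (hshear t ht).integral_prod_right
  have hop : ∀ t ∈ E, ∀ x, freqOp (fun p => pairExp σ t p * n t p) G x = expIntegral (h t) x := by
    intro t ht x
    have hint : Integrable (fun p : Plane × Plane =>
        Complex.exp (Complex.I * (inner ℝ x (p.1 + p.2) : ℝ)) * Ψ t p) := by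
      refine (hΨi t ht).bdd_mul (c := 1) (Continuous.aestronglyMeasurable (by fun_prop)) ?_
      exact Filter.Eventually.of_forall fun p => (norm_exp_I_mul _).le
    calc freqOp (fun p => pairExp σ t p * n t p) G x = ∫ p : Plane × Plane,
          Complex.exp (Complex.I * (inner ℝ x (p.1 + p.2) : ℝ)) * Ψ t p := by
          refine integral_congr_ae (Filter.Eventually.of_forall fun p => ?_)
          simp only [hΨ, hH]
          ring
      _ = ∫ z : Plane × Plane, Complex.exp (Complex.I * (inner ℝ x ((e z).1 + (e z).2) : ℝ)) *
            Ψ t (e z) := (mp.integral_comp emb _).symm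
      _ = ∫ η, ∫ ξ, Complex.exp (Complex.I * (inner ℝ x (ξ + (η - ξ)) : ℝ)) * Ψ t (ξ, η - ξ) := by
          rw [Measure.volume_eq_prod]
          exact integral_prod_symm _ ((mp.integrable_comp_emb emb).2 hint)
      _ = _ := by
          refine integral_congr_ae (Filter.Eventually.of_forall fun η => ?_)
          simp only [add_sub_cancel]
          rw [integral_const_mul]
  -- On almost every fibre, the Bessel bound for the exponentials, passed through the slowly varying
  -- amplitudes and dualized.
  have hfib : ∀ᵐ η, ∑ t ∈ E, ‖h t η‖ₑ ^ 2 ≤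
      ENNReal.ofReal (4 * B ^ 2 * K) * ∫⁻ ξ, ‖H (ξ, η - ξ)‖ₑ ^ 2 := by
    have hae : ∀ᵐ η, ∀ t ∈ E, Integrable (fun ξ => Ψ t (ξ, η - ξ)) :=
      (Filter.eventually_all_finset E).2 fun t ht => (hshear t ht).prod_left_ae
    filter_upwards [hae] with η hη
    have hbes := (isBesselFamily_fibreExp hN hθ hℓ hσ hQ hb η).mul_lipschitz hE hK0
      (fun t _ => measurable_fibreExp hRm σ η t) (n := fun t ξ => n t (ξ, η - ξ))
      (fun t ht ξ => hB t ht _) (fun t ht s hs ξ => hL t ht s hs _)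
    have heq : ∀ t ∈ E, (fun ξ => fibreExp R σ η t ξ * n t (ξ, η - ξ) * H (ξ, η - ξ)) =
        fun ξ => Ψ t (ξ, η - ξ) := by
      intro t ht
      funext ξ
      simp only [hΨ]
      by_cases hp : (ξ, η - ξ) ∈ R
      · rw [fibreExp, Set.indicator_of_mem (by exact hp)]
        rfl
      · rw [hsupp t ht _ hp]; ring
    have := hbes.sum_enorm_integral_sq_le (by positivity)
      (fun t ht => (measurable_fibreExp hRm σ η t).mul ((hn t ht).comp (by fun_prop)))
      (h := fun ξ => H (ξ, η - ξ)) (Continuous.aestronglyMeasurable (by fun_prop))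
      (fun t ht => by rw [heq t ht]; exact hη t ht)
    refine le_trans (le_of_eq ?_) this
    refine Finset.sum_congr rfl fun t ht => ?_
    rw [heq t ht]
  have htot : ∑ t ∈ E, ∫⁻ η, ‖h t η‖ₑ ^ 2 ≤
      ENNReal.ofReal (4 * B ^ 2 * K) * ∫⁻ p, ‖H p‖ₑ ^ 2 := by
    rw [← lintegral_finsetSum' _ fun t ht => (hh1 t ht).1.enorm.pow_const 2]
    refine (lintegral_mono_ae hfib).trans (le_of_eq ?_)
    rw [lintegral_const_mul' _ _ ENNReal.ofReal_ne_top]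
    congr 1
    have hm : Measurable fun p => ‖H p‖ₑ ^ 2 := hHc.measurable.enorm.pow_const 2
    have h1 := mp.lintegral_comp hm
    rw [← Measure.volume_eq_prod] at h1
    rw [← h1, Measure.volume_eq_prod, lintegral_prod_symm]
    exact (hm.comp emb.measurable).aemeasurable
  have hHfin : ∫⁻ p, ‖H p‖ₑ ^ 2 = ENNReal.ofReal ((2 * Real.pi) ^ 4) * ∫⁻ q, ‖G q‖ₑ ^ 2 :=
    lintegral_fourierPair_sq hG hG2
  have hfin : ∑ t ∈ E, ∫⁻ η, ‖h t η‖ₑ ^ 2 < ∞ := by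
    refine htot.trans_lt (ENNReal.mul_lt_top ENNReal.ofReal_lt_top ?_)
    rw [hHfin, ← eLpNorm_two_sq]
    exact ENNReal.mul_lt_top ENNReal.ofReal_lt_top (ENNReal.pow_lt_top hG2.2)
  -- Plancherel needs square integrability of h t, which is read off from the estimate just proved.
  have hh2 : ∀ t ∈ E, MemLp (h t) 2 := by
    intro t ht
    refine ⟨(hh1 t ht).1, ?_⟩
    have h1 := (Finset.single_le_sum (f := fun t => ∫⁻ η, ‖h t η‖ₑ ^ 2)
      (fun _ _ => zero_le) ht).trans_lt hfin
    simp only [← eLpNorm_two_sq] at h1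
    by_contra h2
    rw [not_lt, top_le_iff] at h2
    rw [h2] at h1
    simp at h1
  calc _ = ∑ t ∈ E, ENNReal.ofReal ((2 * Real.pi) ^ 2) * ∫⁻ η, ‖h t η‖ₑ ^ 2 := by
        refine Finset.sum_congr rfl fun t ht => ?_
        rw [← lintegral_expIntegral_sq (hh1 t ht) (hh2 t ht)]
        exact lintegral_congr fun x => by rw [hop t ht x]
    _ ≤ ENNReal.ofReal ((2 * Real.pi) ^ 2) * (ENNReal.ofReal (4 * B ^ 2 * K) *
          (ENNReal.ofReal ((2 * Real.pi) ^ 4) * ∫⁻ q, ‖G q‖ₑ ^ 2)) := by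
        rw [← Finset.mul_sum, ← hHfin]
        gcongr
    _ = _ := by
        rw [← mul_assoc, ← mul_assoc, ← ENNReal.ofReal_mul (by positivity),
          ← ENNReal.ofReal_mul (by positivity)]
        congr 2
        ring

end BilinearWave

namespace BilinearWave

/-! ### Symbol bounds -/

theorem norm_multiDeriv_le {a : Plane → ℂ} (h : symbolNorm 0 a ≤ 1) (α : Fin 2 → ℕ)
    (hα : α 0 + α 1 ≤ 20) (ξ : Plane) :
    (1 + ‖ξ‖) ^ (α 0 + α 1) * ‖multiDeriv α a ξ‖ ≤ 1 := by
  have h1 : ENNReal.ofReal ((1 + ‖ξ‖) ^ (-((0 : ℝ) - ((α 0 + α 1 : ℕ) : ℝ)))) *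
      ‖multiDeriv α a ξ‖ₑ ≤ 1 := by
    refine le_trans ?_ h
    unfold symbolNorm
    exact le_iSup_of_le α (le_iSup_of_le hα (le_iSup_of_le ξ le_rfl))
  rw [zero_sub, neg_neg, Real.rpow_natCast, ← ofReal_norm, ← ENNReal.ofReal_mul (by positivity),
    ENNReal.ofReal_le_one] at h1
  exact h1

/-- `multiDeriv` differentiates in one fixed order, so the mixed second derivative in the other
order must be brought to that form before the symbol norm controls it. -/
theorem partialDeriv_comm {a : Plane → ℂ} (ha : ContDiff ℝ 20 a) (i k : Fin 2) (ξ : Plane) :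
    partialDeriv i (partialDeriv k a) ξ = partialDeriv k (partialDeriv i a) ξ := by
  have hd : Differentiable ℝ (fderiv ℝ a) :=
    (ha.fderiv_right (m := 1) (by norm_num)).differentiable one_ne_zero
  have key : ∀ i k : Fin 2, partialDeriv i (partialDeriv k a) ξ =
      fderiv ℝ (fderiv ℝ a) ξ (EuclideanSpace.single i 1) (EuclideanSpace.single k 1) := by
    intro i k
    have h := ((hd ξ).hasFDerivAt.clm_apply
      (hasFDerivAt_const (EuclideanSpace.single k (1 : ℝ)) ξ)).fderiv
    change fderiv ℝ (fun ξ => fderiv ℝ a ξ (EuclideanSpace.single k 1)) ξ _ = _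
    rw [h]
    simp
  rw [key, key]
  exact ((ha.contDiffAt (x := ξ)).isSymmSndFDerivAt (by simp; norm_num)).eq _ _

theorem norm_symbol_le {a : Plane → ℂ} (h : symbolNorm 0 a ≤ 1) (ξ : Plane) : ‖a ξ‖ ≤ 1 := by
  simpa [multiDeriv] using norm_multiDeriv_le h ![0, 0] (by simp) ξ

theorem norm_partialDeriv_symbol_le {a : Plane → ℂ} (h : symbolNorm 0 a ≤ 1) (i : Fin 2)
    (ξ : Plane) : (1 + ‖ξ‖) * ‖partialDeriv i a ξ‖ ≤ 1 := by
  fin_cases i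
  · simpa [multiDeriv] using norm_multiDeriv_le h ![1, 0] (by simp) ξ
  · simpa [multiDeriv] using norm_multiDeriv_le h ![0, 1] (by simp) ξ

theorem norm_partialDeriv_partialDeriv_symbol_le {a : Plane → ℂ} (ha : ContDiff ℝ 20 a)
    (h : symbolNorm 0 a ≤ 1) (i k : Fin 2)
    (ξ : Plane) : (1 + ‖ξ‖) ^ 2 * ‖partialDeriv i (partialDeriv k a) ξ‖ ≤ 1 := by
  have h11 := norm_multiDeriv_le h ![1, 1] (by simp) ξ
  fin_cases i <;> fin_cases k
  · simpa [multiDeriv] using norm_multiDeriv_le h ![2, 0] (by simp) ξ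
  · simpa [multiDeriv] using h11
  · have := partialDeriv_comm ha 1 0 ξ
    simp only [Fin.mk_one, Fin.zero_eta] at this ⊢
    rw [this]
    simpa [multiDeriv] using h11
  · simpa [multiDeriv] using norm_multiDeriv_le h ![0, 2] (by simp) ξ

theorem fderiv_apply_eq_partialDeriv (g : Plane → ℂ) (ξ v : Plane) :
    fderiv ℝ g ξ v = (v 0 : ℂ) * partialDeriv 0 g ξ + (v 1 : ℂ) * partialDeriv 1 g ξ := by
  have e : v = v 0 • EuclideanSpace.single 0 (1 : ℝ) + v 1 • EuclideanSpace.single 1 (1 : ℝ) := by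
    ext i; fin_cases i <;> simp
  conv_lhs => rw [e]
  rw [map_add, map_smul, map_smul]
  simp [partialDeriv]

/-- A bounded function of `t ∈ [1, 2]` with the same bound for its Lipschitz constant. -/
def LipBdd (B : ℝ) (f : ℝ → ℂ) : Prop :=
  (∀ t ∈ Set.Icc (1 : ℝ) 2, ‖f t‖ ≤ B) ∧
    ∀ t ∈ Set.Icc (1 : ℝ) 2, ∀ s ∈ Set.Icc (1 : ℝ) 2, ‖f t - f s‖ ≤ B * |t - s|

theorem LipBdd.nonneg {B : ℝ} {f : ℝ → ℂ} (h : LipBdd B f) : 0 ≤ B :=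
  (norm_nonneg _).trans (h.1 1 (by norm_num))

theorem LipBdd.mono {B C : ℝ} {f : ℝ → ℂ} (h : LipBdd B f) (hBC : B ≤ C) : LipBdd C f :=
  ⟨fun t ht => (h.1 t ht).trans hBC, fun t ht s hs => (h.2 t ht s hs).trans (by gcongr)⟩

theorem LipBdd.add {B C : ℝ} {f g : ℝ → ℂ} (hf : LipBdd B f) (hg : LipBdd C g) :
    LipBdd (B + C) (fun t => f t + g t) := by
  refine ⟨fun t ht => (norm_add_le _ _).trans (add_le_add (hf.1 t ht) (hg.1 t ht)),
    fun t ht s hs => ?_⟩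
  have e : f t + g t - (f s + g s) = (f t - f s) + (g t - g s) := by ring
  rw [e, add_mul]
  exact (norm_add_le _ _).trans (add_le_add (hf.2 t ht s hs) (hg.2 t ht s hs))

theorem LipBdd.mul {B C : ℝ} {f g : ℝ → ℂ} (hf : LipBdd B f) (hg : LipBdd C g) :
    LipBdd (2 * B * C) (fun t => f t * g t) := by
  have hB := hf.nonneg
  have hC := hg.nonneg
  refine ⟨fun t ht => ?_, fun t ht s hs => ?_⟩
  · rw [norm_mul]
    calc ‖f t‖ * ‖g t‖ ≤ B * C := mul_le_mul (hf.1 t ht) (hg.1 t ht) (norm_nonneg _) hB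
      _ ≤ 2 * B * C := by nlinarith [mul_nonneg hB hC]
  · have e : f t * g t - f s * g s = (f t - f s) * g t + f s * (g t - g s) := by ring
    rw [e]
    refine (norm_add_le _ _).trans ?_
    rw [norm_mul, norm_mul]
    calc _ ≤ (B * |t - s|) * C + B * (C * |t - s|) := by
          gcongr
          · exact hf.2 t ht s hs
          · exact hg.1 t ht
          · exact hf.1 s hs
          · exact hg.2 t ht s hs
      _ = _ := by ring

theorem LipBdd.const_mul {B : ℝ} {f : ℝ → ℂ} (hf : LipBdd B f) {z : ℂ} {C : ℝ} (hz : ‖z‖ ≤ C) :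
    LipBdd (C * B) (fun t => z * f t) := by
  have hB := hf.nonneg
  refine ⟨fun t ht => ?_, fun t ht s hs => ?_⟩
  · rw [norm_mul]
    exact mul_le_mul hz (hf.1 t ht) (norm_nonneg _) ((norm_nonneg _).trans hz)
  · rw [← mul_sub, norm_mul, mul_assoc]
    exact mul_le_mul hz (hf.2 t ht s hs) (norm_nonneg _) ((norm_nonneg _).trans hz)

theorem lipBdd_id : LipBdd 2 (fun t => (t : ℂ)) := by
  refine ⟨fun t ht => ?_, fun t ht s hs => ?_⟩
  · rw [Complex.norm_real, Real.norm_of_nonneg (by linarith [ht.1])]; exact ht.2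
  · rw [← Complex.ofReal_sub, Complex.norm_real, Real.norm_eq_abs]
    nlinarith [abs_nonneg (t - s)]

theorem lipBdd_zero {B : ℝ} (hB : 0 ≤ B) : LipBdd B (fun _ => 0) :=
  ⟨fun t _ => by simpa, fun t _ s _ => by simp; positivity⟩

theorem abs_coord_le_norm (ξ : Plane) (i : Fin 2) : |ξ i| ≤ ‖ξ‖ := by
  simpa using PiLp.norm_apply_le ξ i

/-- Dilates of a differentiable function with controlled partial derivatives. -/
theorem lipBdd_comp_smul {g : Plane → ℂ} (hg : Differentiable ℝ g) (ξ : Plane) {B : ℝ}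
    (h0 : ∀ t ∈ Set.Icc (1 : ℝ) 2, ‖g (t • ξ)‖ ≤ B)
    (h1 : ∀ t ∈ Set.Icc (1 : ℝ) 2, ∀ i, 2 * (‖ξ‖ * ‖partialDeriv i g (t • ξ)‖) ≤ B) :
    LipBdd B (fun t => g (t • ξ)) := by
  refine ⟨h0, fun t ht s hs => ?_⟩
  have hd : ∀ r : ℝ, HasDerivAt (fun r : ℝ => g (r • ξ)) (fderiv ℝ g (r • ξ) ξ) r := by
    intro r
    have h1 : HasDerivAt (fun r : ℝ => r • ξ) ξ r := by
      simpa using (hasDerivAt_id r).smul_const ξ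
    exact (hg (r • ξ)).hasFDerivAt.comp_hasDerivAt r h1
  have h := (convex_Icc (1 : ℝ) 2).norm_image_sub_le_of_norm_hasDerivWithin_le
    (f := fun r : ℝ => g (r • ξ)) (C := B) (fun r _ => (hd r).hasDerivWithinAt)
    (fun r hr => by
      rw [fderiv_apply_eq_partialDeriv]
      refine (norm_add_le _ _).trans ?_
      rw [norm_mul, norm_mul, Complex.norm_real, Complex.norm_real, Real.norm_eq_abs,
        Real.norm_eq_abs]
      have a0 := mul_le_mul_of_nonneg_right (abs_coord_le_norm ξ 0)
        (norm_nonneg (partialDeriv 0 g (r • ξ)))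
      have a1 := mul_le_mul_of_nonneg_right (abs_coord_le_norm ξ 1)
        (norm_nonneg (partialDeriv 1 g (r • ξ)))
      linarith [h1 r hr 0, h1 r hr 1]) hs ht
  rwa [Real.norm_eq_abs] at h

theorem norm_le_norm_smul {t : ℝ} (ht : t ∈ Set.Icc (1 : ℝ) 2) (ξ : Plane) : ‖ξ‖ ≤ ‖t • ξ‖ := by
  rw [norm_smul, Real.norm_of_nonneg (by linarith [ht.1])]
  nlinarith [ht.1, norm_nonneg ξ]

/-- The t-derivative is ξ·∇a(tξ), and the factor |ξ| ≤ |tξ| is compensated by the symbol decay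
1/(1+|tξ|) of the gradient. -/
theorem lipBdd_symbol {a : Plane → ℂ} (ha : ContDiff ℝ 20 a) (h : symbolNorm 0 a ≤ 1)
    (ξ : Plane) : LipBdd 2 (fun t => a (t • ξ)) := by
  refine lipBdd_comp_smul (ha.differentiable (by norm_num)) ξ
    (fun t _ => (norm_symbol_le h _).trans (by norm_num)) (fun t ht i => ?_)
  have h1 := norm_partialDeriv_symbol_le h i (t • ξ)
  have h2 := norm_le_norm_smul ht ξ
  nlinarith [norm_nonneg (partialDeriv i a (t • ξ)), norm_nonneg ξ]

theorem lipBdd_partialDeriv_symbol {a : Plane → ℂ} (ha : ContDiff ℝ 20 a)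
    (h : symbolNorm 0 a ≤ 1) (i : Fin 2) (ξ : Plane) :
    LipBdd (2 / (1 + ‖ξ‖)) (fun t => partialDeriv i a (t • ξ)) := by
  have hd : Differentiable ℝ (partialDeriv i a) := by
    have : ContDiff ℝ 1 (partialDeriv i a) :=
      (ha.fderiv_right (m := 1) (by norm_num)).clm_apply contDiff_const
    exact this.differentiable one_ne_zero
  refine lipBdd_comp_smul hd ξ (fun t ht => ?_) (fun t ht k => ?_)
  · have h1 := norm_partialDeriv_symbol_le h i (t • ξ)
    have h2 := norm_le_norm_smul ht ξ
    rw [le_div_iff₀ (by positivity)]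
    nlinarith [norm_nonneg (partialDeriv i a (t • ξ)), norm_nonneg ξ]
  · have h1 := norm_partialDeriv_partialDeriv_symbol_le ha h k i (t • ξ)
    have h2 := norm_le_norm_smul ht ξ
    rw [le_div_iff₀ (by positivity)]
    set z := ‖partialDeriv k (partialDeriv i a) (t • ξ)‖
    have hz : 0 ≤ z := norm_nonneg _
    have h3 : ‖ξ‖ * (1 + ‖ξ‖) ≤ (1 + ‖t • ξ‖) ^ 2 := by nlinarith [norm_nonneg ξ]
    nlinarith [mul_le_mul_of_nonneg_right h3 hz]

end BilinearWave

namespace BilinearWave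

/-! ### Localized amplitudes -/

/-- The amplitude `χ_j(ξ) a(tξ)`. -/
noncomputable def waveAmp (χ : Plane → ℝ) (a : Plane → ℂ) (j : ℕ) (t : ℝ) (ξ : Plane) : ℂ :=
  (dyadicPiece χ j ξ : ℂ) * a (t • ξ)

/-- The support condition on the symbol. -/
def ConeSupported (a : Plane → ℂ) : Prop :=
  ∀ ξ : Plane, a ξ ≠ 0 → 0 < ξ 0 ∧ ξ 0 < (2 : ℝ) ^ (-10 : ℤ) * ξ 1

theorem IsDyadicCutoff.norm_mem_of_ne_zero {χ : Plane → ℝ} (hχ : IsDyadicCutoff χ) {j : ℕ}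
    {ξ : Plane} (h : dyadicPiece χ j ξ ≠ 0) : (2 : ℝ) ^ j / 2 ≤ ‖ξ‖ ∧ ‖ξ‖ ≤ 2 * 2 ^ j := by
  have h1 := hχ.supp (subset_tsupport _ h)
  simp only [Set.mem_ofPred_eq, norm_smul, zpow_neg, zpow_natCast, norm_inv, norm_pow,
    Real.norm_ofNat] at h1
  have hp : (0 : ℝ) < 2 ^ j := by positivity
  rw [inv_mul_eq_div, le_div_iff₀ hp, div_le_iff₀ hp] at h1
  exact ⟨by linarith [h1.1], h1.2⟩

theorem waveAmp_support {χ : Plane → ℝ} (hχ : IsDyadicCutoff χ) {a : Plane → ℂ}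
    (hcone : ConeSupported a) {j : ℕ} {t : ℝ} (ht : 0 < t) {ξ : Plane}
    (h : waveAmp χ a j t ξ ≠ 0) :
    0 < ξ 0 ∧ ξ 0 < (2 : ℝ) ^ (-10 : ℤ) * ξ 1 ∧ InCone (2 ^ j) ξ := by
  have h1 : dyadicPiece χ j ξ ≠ 0 := fun h0 => h (by simp [waveAmp, h0])
  have h2 : a (t • ξ) ≠ 0 := fun h0 => h (by simp [waveAmp, h0])
  obtain ⟨n1, n2⟩ := hχ.norm_mem_of_ne_zero h1
  obtain ⟨c1, c2⟩ := hcone _ h2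
  simp only [PiLp.smul_apply, smul_eq_mul] at c1 c2
  have c1' : 0 < ξ 0 := (mul_pos_iff_of_pos_left ht).1 c1
  have c2' : ξ 0 < (2 : ℝ) ^ (-10 : ℤ) * ξ 1 := by
    refine lt_of_mul_lt_mul_left (a := t) ?_ ht.le
    linarith
  have hp : (2 : ℝ) ^ (-10 : ℤ) = 1 / 1024 := by norm_num
  have hξ1 : 0 < ξ 1 := by rw [hp] at c2'; linarith
  have h01 : |ξ 0| ≤ ξ 1 := by rw [abs_of_pos c1']; rw [hp] at c2'; linarith
  refine ⟨c1', c2', h01, ?_, ?_⟩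
  · have : ‖ξ‖ ≤ 2 * ξ 1 := by
      rw [EuclideanSpace.norm_eq, Real.sqrt_le_left (by linarith), Fin.sum_univ_two]
      simp only [Real.norm_eq_abs, sq_abs]
      rw [abs_of_pos c1'] at h01
      nlinarith
    linarith
  · have := abs_coord_le_norm ξ 1
    rw [abs_of_pos hξ1] at this
    linarith

theorem waveAmp_eq_zero {χ : Plane → ℝ} (hχ : IsDyadicCutoff χ) {a : Plane → ℂ}
    (hcone : ConeSupported a) {j : ℕ} {t : ℝ} (ht : 0 < t) {ξ : Plane}
    (h : ¬ InCone (2 ^ j) ξ) : waveAmp χ a j t ξ = 0 := by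
  by_contra h0
  exact h (waveAmp_support hχ hcone ht h0).2.2

theorem IsDyadicCutoff.contDiff_dyadicPiece {χ : Plane → ℝ} (hχ : IsDyadicCutoff χ) (j : ℕ) :
    ContDiff ℝ 1 (dyadicPiece χ j) :=
  (hχ.smooth.of_le (by exact_mod_cast le_top)).comp (contDiff_const_smul _)

theorem contDiff_waveAmp {χ : Plane → ℝ} (hχ : IsDyadicCutoff χ) {a : Plane → ℂ}
    (ha : ContDiff ℝ 20 a) (j : ℕ) (t : ℝ) : ContDiff ℝ 1 (waveAmp χ a j t) :=
  (Complex.ofRealCLM.contDiff.comp (hχ.contDiff_dyadicPiece j)).mul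
    ((ha.of_le (by norm_num)).comp (contDiff_const_smul _))

theorem partialDeriv_waveAmp_eq_zero {χ : Plane → ℝ} (hχ : IsDyadicCutoff χ) {a : Plane → ℂ}
    (hcone : ConeSupported a) {j : ℕ} {t : ℝ} (ht : 0 < t) {ξ : Plane}
    (h : ¬ InCone (2 ^ j) ξ) (i : Fin 2) : partialDeriv i (waveAmp χ a j t) ξ = 0 := by
  have : waveAmp χ a j t =ᶠ[nhds ξ] fun _ => 0 := by
    filter_upwards [(isClosed_inCone (2 ^ j)).isOpen_compl.mem_nhds h] with ζ hζ
    exact waveAmp_eq_zero hχ hcone ht hζ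
  rw [partialDeriv, this.fderiv_eq]
  simp

theorem hasDerivAt_line {f : Plane → ℂ} (hf : Differentiable ℝ f) (ξ v : Plane) :
    HasDerivAt (fun s : ℝ => f (ξ + s • v)) (fderiv ℝ f ξ v) 0 := by
  have := (hf ξ).hasFDerivAt.hasLineDerivAt v
  exact this

theorem partialDeriv_waveAmp {χ : Plane → ℝ} (hχ : IsDyadicCutoff χ) {a : Plane → ℂ}
    (ha : ContDiff ℝ 20 a) (j : ℕ) (t : ℝ) (i : Fin 2) (ξ : Plane) :
    partialDeriv i (waveAmp χ a j t) ξ =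
      ((((2 : ℝ) ^ j)⁻¹ * fderiv ℝ χ ((2 : ℝ) ^ (-(j : ℤ)) • ξ) (EuclideanSpace.single i 1) : ℝ) : ℂ)
        * a (t • ξ) +
      (dyadicPiece χ j ξ : ℂ) * ((t : ℂ) * partialDeriv i a (t • ξ)) := by
  have hχd : Differentiable ℝ χ := hχ.smooth.differentiable (by simp)
  have had : Differentiable ℝ a := ha.differentiable (by norm_num)
  set e : Plane := EuclideanSpace.single i 1
  have h1 : HasFDerivAt (fun ξ : Plane => (dyadicPiece χ j ξ : ℂ))
      (Complex.ofRealCLM.comp ((fderiv ℝ χ ((2 : ℝ) ^ (-(j : ℤ)) • ξ)).comp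
        ((2 : ℝ) ^ (-(j : ℤ)) • ContinuousLinearMap.id ℝ Plane))) ξ := by
    refine (Complex.ofRealCLM.hasFDerivAt).comp ξ ?_
    exact (hχd _).hasFDerivAt.comp ξ
      ((2 : ℝ) ^ (-(j : ℤ)) • ContinuousLinearMap.id ℝ Plane).hasFDerivAt
  have h2 : HasFDerivAt (fun ξ : Plane => a (t • ξ))
      ((fderiv ℝ a (t • ξ)).comp (t • ContinuousLinearMap.id ℝ Plane)) ξ :=
    (had _).hasFDerivAt.comp ξ (t • ContinuousLinearMap.id ℝ Plane).hasFDerivAt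
  have h3 := (h1.mul h2).fderiv
  change fderiv ℝ (fun ξ : Plane => (dyadicPiece χ j ξ : ℂ) * a (t • ξ)) ξ e = _
  have h3' : fderiv ℝ (fun ξ : Plane => (dyadicPiece χ j ξ : ℂ) * a (t • ξ)) ξ = _ := h3
  rw [h3']
  simp [partialDeriv, e]
  ring

theorem IsDyadicCutoff.exists_fderiv_bound {χ : Plane → ℝ} (hχ : IsDyadicCutoff χ) :
    ∃ C : ℝ, 0 ≤ C ∧ ∀ ξ i, |fderiv ℝ χ ξ (EuclideanSpace.single i 1)| ≤ C := by
  have hc : HasCompactSupport χ := by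
    refine HasCompactSupport.intro (isCompact_closedBall (0 : Plane) 2) fun ξ hξ => ?_
    by_contra h
    apply hξ
    rw [mem_closedBall_zero_iff]
    exact (hχ.supp (subset_tsupport _ h)).2
  have hcont : Continuous (fderiv ℝ χ) := hχ.smooth.continuous_fderiv (by simp)
  obtain ⟨C, hC⟩ := (hc.fderiv (𝕜 := ℝ)).exists_bound_of_continuous hcont
  refine ⟨C, (norm_nonneg _).trans (hC 0), fun ξ i => ?_⟩
  have := (fderiv ℝ χ ξ).le_opNorm (EuclideanSpace.single i 1)
  rw [PiLp.norm_single, norm_one, mul_one] at this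
  exact this.trans (hC ξ)

theorem IsDyadicCutoff.norm_dyadicPiece_le {χ : Plane → ℝ} (hχ : IsDyadicCutoff χ) (j : ℕ)
    (ξ : Plane) : ‖(dyadicPiece χ j ξ : ℂ)‖ ≤ 1 := by
  rw [Complex.norm_real, dyadicPiece, Real.norm_of_nonneg (hχ.nonneg _)]
  exact hχ.le_one _

theorem lipBdd_waveAmp {χ : Plane → ℝ} (hχ : IsDyadicCutoff χ) {a : Plane → ℂ}
    (ha : ContDiff ℝ 20 a) (h : symbolNorm 0 a ≤ 1) (j : ℕ) (ξ : Plane) :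
    LipBdd 2 (fun t => waveAmp χ a j t ξ) := by
  exact ((lipBdd_symbol ha h ξ).const_mul (hχ.norm_dyadicPiece_le j ξ)).mono (by norm_num)

/-- A frequency derivative gains 2^{-j}: from the scaling when it falls on the cutoff, and from the
symbol decay, with |ξ| ≥ 2^j/2 on the support, when it falls on a. -/
theorem lipBdd_partialDeriv_waveAmp {χ : Plane → ℝ} (hχ : IsDyadicCutoff χ) {a : Plane → ℂ}
    (ha : ContDiff ℝ 20 a) (h : symbolNorm 0 a ≤ 1) {C : ℝ}
    (hC : ∀ ξ i, |fderiv ℝ χ ξ (EuclideanSpace.single i 1)| ≤ C) (j : ℕ) (i : Fin 2) (ξ : Plane) :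
    LipBdd ((2 * C + 16) / 2 ^ j) (fun t => partialDeriv i (waveAmp χ a j t) ξ) := by
  simp_rw [partialDeriv_waveAmp hχ ha]
  have hp : (0 : ℝ) < 2 ^ j := by positivity
  have h1 := (lipBdd_symbol ha h ξ).const_mul (C := C / 2 ^ j)
    (z := ((((2 : ℝ) ^ j)⁻¹ *
      fderiv ℝ χ ((2 : ℝ) ^ (-(j : ℤ)) • ξ) (EuclideanSpace.single i 1) : ℝ) : ℂ)) (by
      rw [Complex.norm_real, Real.norm_eq_abs, abs_mul, abs_of_pos (inv_pos.2 hp),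
        inv_mul_eq_div]
      gcongr
      exact hC _ _)
  have h2 : LipBdd (16 / 2 ^ j)
      (fun t => (dyadicPiece χ j ξ : ℂ) * ((t : ℂ) * partialDeriv i a (t • ξ))) := by
    by_cases h0 : dyadicPiece χ j ξ = 0
    · simp only [h0, Complex.ofReal_zero, zero_mul]
      exact lipBdd_zero (by positivity)
    · refine ((lipBdd_id.mul (lipBdd_partialDeriv_symbol ha h i ξ)).const_mul
        (hχ.norm_dyadicPiece_le j ξ)).mono ?_
      have := (hχ.norm_mem_of_ne_zero h0).1
      calc 1 * (2 * 2 * (2 / (1 + ‖ξ‖))) = 8 / (1 + ‖ξ‖) := by ring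
        _ ≤ 8 / (2 ^ j / 2) := by gcongr; linarith
        _ = _ := by field_simp; norm_num
  exact (h1.add h2).mono (le_of_eq (by ring))

/-- A cutoff function for the (normalized) angle between the frequencies. -/
structure IsAngularCutoff (ρ : ℝ → ℝ) (b : Prop) (C : ℝ) : Prop where
  contDiff : ContDiff ℝ 1 ρ
  abs_le : ∀ y, |ρ y| ≤ 1
  abs_deriv_le : ∀ y, |deriv ρ y| ≤ C
  supp : ∀ y, ρ y ≠ 0 → |y| ≤ 2 ∧ (b → 1 / 2 ≤ |y|)

theorem IsAngularCutoff.deriv_eq_zero {ρ : ℝ → ℝ} {b : Prop} {C : ℝ} (h : IsAngularCutoff ρ b C)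
    {y : ℝ} (hy : ¬ (|y| ≤ 2 ∧ (b → 1 / 2 ≤ |y|))) : deriv ρ y = 0 := by
  have hcl : IsClosed {y : ℝ | |y| ≤ 2 ∧ (b → 1 / 2 ≤ |y|)} := by
    refine (isClosed_le continuous_abs continuous_const).inter ?_
    by_cases hb : b
    · simp only [hb, forall_const]
      exact isClosed_le continuous_const continuous_abs
    · simp only [hb, false_imp_iff]
      exact isClosed_univ
  have : ρ =ᶠ[nhds y] fun _ => 0 := by
    filter_upwards [hcl.isOpen_compl.mem_nhds hy] with z hz
    by_contra h0
    exact hz (h.supp z h0)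
  rw [this.deriv_eq]
  simp

/-- The bilinear symbol localized to the angle `θ`, without the oscillating factor. -/
noncomputable def pairSymbol (χ : Plane → ℝ) (a : Plane → ℂ) (j : ℕ) (θ : ℝ) (ρ : ℝ → ℝ)
    (t : ℝ) (p : Plane × Plane) : ℂ :=
  waveAmp χ a j t p.1 * waveAmp χ a j t p.2 * (ρ (planeDet p / (θ * (2 ^ j) ^ 2)) : ℂ)

/-- The derivative of the determinant in direction `(e_i, -e_i)`. -/
def detDir (i : Fin 2) (p : Plane × Plane) : ℝ :=
  if i = 0 then p.2 1 + p.1 1 else -(p.1 0 + p.2 0)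

/-- The amplitude of the derivative of the full symbol in direction `(e_i, -e_i)`. -/
noncomputable def pairSymbolDeriv (χ : Plane → ℝ) (a : Plane → ℂ) (j : ℕ) (θ : ℝ) (ρ : ℝ → ℝ)
    (σ : ℝ) (i : Fin 2) (t : ℝ) (p : Plane × Plane) : ℂ :=
  Complex.I * ((σ * (p.1 i / ‖p.1‖ - p.2 i / ‖p.2‖) : ℝ) : ℂ) *
      ((t : ℂ) * pairSymbol χ a j θ ρ t p) +
    ((ρ (planeDet p / (θ * (2 ^ j) ^ 2)) : ℂ) *
        (partialDeriv i (waveAmp χ a j t) p.1 * waveAmp χ a j t p.2 +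
          (-1) * (waveAmp χ a j t p.1 * partialDeriv i (waveAmp χ a j t) p.2)) +
      ((deriv ρ (planeDet p / (θ * (2 ^ j) ^ 2)) * (detDir i p / (θ * (2 ^ j) ^ 2)) : ℝ) : ℂ) *
        (waveAmp χ a j t p.1 * waveAmp χ a j t p.2))

theorem mem_angleRegion_of_cutoff {N θ : ℝ} (hN : 0 < N) (hθ : 0 < θ) {b : Prop}
    {p : Plane × Plane} (h1 : InCone N p.1) (h2 : InCone N p.2)
    (h : |planeDet p / (θ * N ^ 2)| ≤ 2 ∧ (b → 1 / 2 ≤ |planeDet p / (θ * N ^ 2)|)) :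
    p ∈ angleRegion N θ b := by
  have hpos : 0 < θ * N ^ 2 := by positivity
  rw [abs_div, abs_of_pos hpos, div_le_iff₀ hpos, le_div_iff₀ hpos] at h
  exact ⟨h1, h2, h.1, fun hb => by linarith [h.2 hb]⟩

section Symbol

variable {χ : Plane → ℝ} {a : Plane → ℂ} {j : ℕ} {θ : ℝ} {ρ : ℝ → ℝ} {b : Prop} {C t : ℝ}

theorem pairSymbol_eq_zero (hχ : IsDyadicCutoff χ) (hcone : ConeSupported a) (hθ : 0 < θ)
    (hρ : IsAngularCutoff ρ b C) (ht : 0 < t) {p : Plane × Plane}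
    (hp : p ∉ angleRegion (2 ^ j) θ b) : pairSymbol χ a j θ ρ t p = 0 := by
  by_contra h0
  simp only [pairSymbol, mul_ne_zero_iff] at h0
  obtain ⟨⟨h1, h2⟩, h3⟩ := h0
  refine hp (mem_angleRegion_of_cutoff (by positivity) hθ (waveAmp_support hχ hcone ht h1).2.2
    (waveAmp_support hχ hcone ht h2).2.2 (hρ.supp _ (by exact_mod_cast h3)))

/-- The cone and the range allowed to the cutoff are closed, so off them the factors vanish in a
neighbourhood and their derivatives vanish too. Hence differentiation does not enlarge the angular
region. -/
theorem pairSymbolDeriv_eq_zero (hχ : IsDyadicCutoff χ) (hcone : ConeSupported a) (hθ : 0 < θ)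
    (hρ : IsAngularCutoff ρ b C) (ht : 0 < t) (σ : ℝ) (i : Fin 2) {p : Plane × Plane}
    (hp : p ∉ angleRegion (2 ^ j) θ b) : pairSymbolDeriv χ a j θ ρ σ i t p = 0 := by
  rw [pairSymbolDeriv, pairSymbol_eq_zero hχ hcone hθ hρ ht hp]
  by_cases h1 : InCone (2 ^ j) p.1
  · by_cases h2 : InCone (2 ^ j) p.2
    · have hd : ¬ (|planeDet p / (θ * (2 ^ j) ^ 2)| ≤ 2 ∧
          (b → 1 / 2 ≤ |planeDet p / (θ * (2 ^ j) ^ 2)|)) :=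
        fun h => hp (mem_angleRegion_of_cutoff (by positivity) hθ h1 h2 h)
      have hr : ρ (planeDet p / (θ * (2 ^ j) ^ 2)) = 0 := by
        by_contra h; exact hd (hρ.supp _ h)
      rw [hρ.deriv_eq_zero hd, hr]
      simp
    · rw [waveAmp_eq_zero hχ hcone ht h2, partialDeriv_waveAmp_eq_zero hχ hcone ht h2]
      simp
  · rw [waveAmp_eq_zero hχ hcone ht h1, partialDeriv_waveAmp_eq_zero hχ hcone ht h1]
    simp

theorem contDiff_planeDet : ContDiff ℝ 1 planeDet := by
  unfold planeDet; fun_prop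

theorem contDiff_pairSymbol (hχ : IsDyadicCutoff χ) (ha : ContDiff ℝ 20 a)
    (hρ : IsAngularCutoff ρ b C) (θ : ℝ) (t : ℝ) : ContDiff ℝ 1 (pairSymbol χ a j θ ρ t) := by
  have h := contDiff_waveAmp hχ ha j t
  refine ((h.comp contDiff_fst).mul (h.comp contDiff_snd)).mul ?_
  exact Complex.ofRealCLM.contDiff.comp (hρ.contDiff.comp (contDiff_planeDet.div_const _))

theorem ne_zero_of_inCone {N : ℝ} (hN : 0 < N) {ξ : Plane} (h : InCone N ξ) : ξ ≠ 0 := by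
  rintro rfl
  have := h.2.1
  simp at this
  linarith

/-- The norms in the phase are singular only at the origin. In the angular region both frequencies
are nonzero, and off this closed set the symbol vanishes identically near each point. -/
theorem contDiff_fullSymbol (hχ : IsDyadicCutoff χ) (ha : ContDiff ℝ 20 a)
    (hcone : ConeSupported a) (hθ : 0 < θ)
    (hρ : IsAngularCutoff ρ b C) (σ : ℝ) (ht : 0 < t) :
    ContDiff ℝ 1 (fun p => pairExp σ t p * pairSymbol χ a j θ ρ t p) := by
  rw [contDiff_iff_contDiffAt]
  intro p
  by_cases hp : p ∈ angleRegion (2 ^ j) θ b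
  · have h1 := ne_zero_of_inCone (by positivity) hp.1
    have h2 := ne_zero_of_inCone (by positivity) hp.2.1
    refine ContDiffAt.mul ?_ (contDiff_pairSymbol hχ ha hρ θ t).contDiffAt
    have n1 : ContDiffAt ℝ 1 (fun p : Plane × Plane => ‖p.1‖) p := contDiffAt_fst.norm ℝ h1
    have n2 : ContDiffAt ℝ 1 (fun p : Plane × Plane => ‖p.2‖) p := contDiffAt_snd.norm ℝ h2
    refine (contDiffAt_const.mul (Complex.ofRealCLM.contDiff.contDiffAt.comp p ?_)).cexp
    exact contDiffAt_const.mul (contDiffAt_const.mul (n1.add n2))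
  · have : (fun p => pairExp σ t p * pairSymbol χ a j θ ρ t p) =ᶠ[nhds p] fun _ => 0 := by
      filter_upwards [(isClosed_angleRegion (2 ^ j) θ b).isOpen_compl.mem_nhds hp] with q hq
      rw [pairSymbol_eq_zero hχ hcone hθ hρ ht hq, mul_zero]
    exact contDiffAt_const.congr_of_eventuallyEq this

theorem hasCompactSupport_fullSymbol (hχ : IsDyadicCutoff χ)
    (hcone : ConeSupported a) (hθ : 0 < θ)
    (hρ : IsAngularCutoff ρ b C) (σ : ℝ) (ht : 0 < t) :
    HasCompactSupport (fun p => pairExp σ t p * pairSymbol χ a j θ ρ t p) :=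
  HasCompactSupport.intro (isCompact_angleRegion (2 ^ j) θ b) fun q hq => by
    rw [pairSymbol_eq_zero hχ hcone hθ hρ ht hq, mul_zero]

theorem hasDerivAt_norm_line {ξ : Plane} (hξ : ξ ≠ 0) (v : Plane) :
    HasDerivAt (fun s : ℝ => ‖ξ + s • v‖) (inner ℝ ξ v / ‖ξ‖) 0 := by
  have h1 : HasDerivAt (fun s : ℝ => ξ + s • v) v 0 := by
    simpa using ((hasDerivAt_id (0 : ℝ)).smul_const v).const_add ξ
  have h2 := h1.norm_sq
  have h3 := h2.sqrt (by simpa using hξ)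
  simp only [zero_smul, add_zero, norm_nonneg, Real.sqrt_sq] at h3
  refine h3.congr_deriv ?_
  have := norm_ne_zero_iff.2 hξ
  field_simp

/-- On the angular region, differentiate along the line p + s(e_i, -e_i), where the norms are smooth
and the determinant is affine in s. Off the region both sides vanish. -/
theorem antiDeriv_fullSymbol (hχ : IsDyadicCutoff χ) (ha : ContDiff ℝ 20 a)
    (hcone : ConeSupported a) (hθ : 0 < θ)
    (hρ : IsAngularCutoff ρ b C) (σ : ℝ) (ht : 0 < t) (i : Fin 2) (p : Plane × Plane) :
    antiDeriv i (fun p => pairExp σ t p * pairSymbol χ a j θ ρ t p) p =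
      pairExp σ t p * pairSymbolDeriv χ a j θ ρ σ i t p := by
  by_cases hp : p ∈ angleRegion (2 ^ j) θ b
  · have h1 := ne_zero_of_inCone (by positivity) hp.1
    have h2 := ne_zero_of_inCone (by positivity) hp.2.1
    set e : Plane := EuclideanSpace.single i 1 with he
    have hline : ∀ s : ℝ, p + s • antiDir i = (p.1 + s • e, p.2 + s • (-e)) := fun s => rfl
    have hA := ((contDiff_fullSymbol hχ ha hcone hθ hρ σ ht (j := j)).differentiable
      one_ne_zero p).hasFDerivAt.hasLineDerivAt (antiDir i)
    have hA' : HasDerivAt (fun s : ℝ => pairExp σ t (p + s • antiDir i) *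
      pairSymbol χ a j θ ρ t (p + s • antiDir i))
      (antiDeriv i (fun p => pairExp σ t p * pairSymbol χ a j θ ρ t p) p) 0 := hA
    refine hA'.unique ?_
    simp_rw [hline]
    have hw := (contDiff_waveAmp hχ ha j t).differentiable one_ne_zero
    have w1 := hasDerivAt_line hw p.1 e
    have w2 := hasDerivAt_line hw p.2 (-e)
    have n1 := hasDerivAt_norm_line h1 e
    have n2 := hasDerivAt_norm_line h2 (-e)
    have hexp : HasDerivAt (fun s : ℝ => pairExp σ t (p.1 + s • e, p.2 + s • (-e)))
        (pairExp σ t p * (Complex.I *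
          ((t * (σ * (p.1 i / ‖p.1‖ - p.2 i / ‖p.2‖)) : ℝ) : ℂ))) 0 := by
      have h := (((n1.add n2).const_mul σ).const_mul t).ofReal_comp.const_mul Complex.I |>.cexp
      refine HasDerivAt.congr_deriv
        (f := fun s : ℝ => pairExp σ t (p.1 + s • e, p.2 + s • (-e))) h ?_
      simp only [zero_smul, add_zero, pairExp, Pi.add_apply]
      congr 3
      rw [he, inner_neg_right, EuclideanSpace.inner_single_right,
        EuclideanSpace.inner_single_right]
      simp only [one_mul, conj_trivial]
      ring
    have hdet : HasDerivAt (fun s : ℝ => planeDet (p.1 + s • e, p.2 + s • (-e)))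
        (detDir i p) 0 := by
      have l : HasDerivAt (fun s : ℝ => planeDet p + s * detDir i p) (detDir i p) 0 := by
        simpa using ((hasDerivAt_id (0 : ℝ)).mul_const (detDir i p)).const_add (planeDet p)
      refine l.congr_of_eventuallyEq (Filter.Eventually.of_forall fun s => ?_)
      fin_cases i <;> simp [planeDet, detDir, he] <;> ring
    have hcut : HasDerivAt
        (fun s : ℝ => ρ (planeDet (p.1 + s • e, p.2 + s • (-e)) / (θ * (2 ^ j) ^ 2)))
        (deriv ρ (planeDet p / (θ * (2 ^ j) ^ 2)) * (detDir i p / (θ * (2 ^ j) ^ 2))) 0 := by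
      have hd := (hρ.contDiff.differentiable one_ne_zero
        (planeDet p / (θ * (2 ^ j) ^ 2))).hasDerivAt
      have hd' := hdet.div_const (θ * (2 ^ j) ^ 2)
      refine HasDerivAt.comp (0 : ℝ) (h₂ := ρ) ?_ hd'
      simpa using hd
    have hall := hexp.mul ((w1.mul w2).mul hcut.ofReal_comp)
    refine HasDerivAt.congr_deriv hall ?_
    simp only [zero_smul, add_zero, pairSymbolDeriv, pairSymbol, Pi.mul_apply, map_neg]
    simp only [partialDeriv, ← he]
    push_cast
    ring
  · rw [pairSymbolDeriv_eq_zero hχ hcone hθ hρ ht σ i hp, mul_zero, antiDeriv]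
    have : (fun p => pairExp σ t p * pairSymbol χ a j θ ρ t p) =ᶠ[nhds p] fun _ => 0 := by
      filter_upwards [(isClosed_angleRegion (2 ^ j) θ b).isOpen_compl.mem_nhds hp] with q hq
      rw [pairSymbol_eq_zero hχ hcone hθ hρ ht hq, mul_zero]
    rw [this.fderiv_eq]
    simp

end Symbol

end BilinearWave

namespace BilinearWave

/-! ### The estimate for a fixed angle -/

/-- If c and d are the cosine and sine of the angle, the unit vectors are at squared distance 2 -
2c. In the cone 0 ≤ c ≤ 1, so 2 - 2c ≤ 4(1 - c²) = 4d², and |d| ≤ 2θN²/(N²/16) = 32θ. -/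
theorem abs_dir_sub_le {N θ : ℝ} (hN : 0 < N) {b : Prop} {p : Plane × Plane}
    (hp : p ∈ angleRegion N θ b) (i : Fin 2) :
    |p.1 i / ‖p.1‖ - p.2 i / ‖p.2‖| ≤ 64 * θ := by
  obtain ⟨h1, h2, h3, -⟩ := hp
  have lower : ∀ ξ : Plane, InCone N ξ → N / 4 ≤ ‖ξ‖ := fun ξ h =>
    h.2.1.trans ((le_abs_self _).trans (abs_coord_le_norm ξ 1))
  have A1 := lower _ h1
  have A2 := lower _ h2
  set A := ‖p.1‖ with hA
  set B := ‖p.2‖ with hB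
  have hA0 : 0 < A := by linarith
  have hB0 : 0 < B := by linarith
  have sqA : A ^ 2 = p.1 0 ^ 2 + p.1 1 ^ 2 := by
    rw [hA, EuclideanSpace.norm_sq_eq, Fin.sum_univ_two]; simp
  have sqB : B ^ 2 = p.2 0 ^ 2 + p.2 1 ^ 2 := by
    rw [hB, EuclideanSpace.norm_sq_eq, Fin.sum_univ_two]; simp
  set c := (p.1 0 * p.2 0 + p.1 1 * p.2 1) / (A * B) with hc
  set d := planeDet p / (A * B) with hd
  have hcd : c ^ 2 + d ^ 2 = 1 := by
    have : (p.1 0 * p.2 0 + p.1 1 * p.2 1) ^ 2 + planeDet p ^ 2 = A ^ 2 * B ^ 2 := by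
      rw [sqA, sqB, planeDet]; ring
    rw [hc, hd, div_pow, div_pow, ← add_div, this]
    field_simp
  have hc0 : 0 ≤ c := by
    refine div_nonneg ?_ (by positivity)
    have h4 : |p.1 0 * p.2 0| ≤ p.1 1 * p.2 1 := by
      rw [abs_mul]
      exact mul_le_mul h1.1 h2.1 (abs_nonneg _) ((abs_nonneg _).trans h1.1)
    linarith [neg_abs_le (p.1 0 * p.2 0)]
  have hsum : (p.1 0 / A - p.2 0 / B) ^ 2 + (p.1 1 / A - p.2 1 / B) ^ 2 = 2 - 2 * c := by
    have e1 : (p.1 0 / A - p.2 0 / B) ^ 2 + (p.1 1 / A - p.2 1 / B) ^ 2 =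
        (p.1 0 ^ 2 + p.1 1 ^ 2) / A ^ 2 + (p.2 0 ^ 2 + p.2 1 ^ 2) / B ^ 2 - 2 * c := by
      rw [hc]; field_simp; ring
    rw [e1, ← sqA, ← sqB, div_self (by positivity), div_self (by positivity)]
    ring
  have hc1 : c ≤ 1 := by nlinarith [sq_nonneg d]
  have hdd : |d| ≤ 32 * θ := by
    rw [hd, abs_div, abs_of_pos (mul_pos hA0 hB0), div_le_iff₀ (mul_pos hA0 hB0)]
    have : N ^ 2 / 16 ≤ A * B := by nlinarith
    have hθ : 0 ≤ θ := by
      by_contra hneg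
      push Not at hneg
      nlinarith [abs_nonneg (planeDet p), mul_neg_of_neg_of_pos hneg (pow_pos hN 2)]
    nlinarith [mul_le_mul_of_nonneg_left this hθ]
  have hi : (p.1 i / A - p.2 i / B) ^ 2 ≤ (2 * |d|) ^ 2 := by
    have h5 : (p.1 i / A - p.2 i / B) ^ 2 ≤ 2 - 2 * c := by
      rw [← hsum]
      fin_cases i
      · simp only [Fin.zero_eta]; linarith [sq_nonneg (p.1 1 / A - p.2 1 / B)]
      · simp only [Fin.mk_one]; linarith [sq_nonneg (p.1 0 / A - p.2 0 / B)]
    rw [mul_pow, sq_abs]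
    nlinarith [mul_nonneg hc0 (sub_nonneg.2 hc1)]
  exact (abs_le_of_sq_le_sq hi (by positivity)).trans (by linarith)

theorem lipBdd_congr {B : ℝ} {f g : ℝ → ℂ} (hf : LipBdd B f)
    (h : ∀ t ∈ Set.Icc (1 : ℝ) 2, g t = f t) : LipBdd B g :=
  ⟨fun t ht => by rw [h t ht]; exact hf.1 t ht,
    fun t ht s hs => by rw [h t ht, h s hs]; exact hf.2 t ht s hs⟩

section Symbol

variable {χ : Plane → ℝ} {a : Plane → ℂ} {j : ℕ} {θ : ℝ} {ρ : ℝ → ℝ} {b : Prop} {C t : ℝ}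

theorem lipBdd_pairSymbol (hχ : IsDyadicCutoff χ) (ha : ContDiff ℝ 20 a)
    (hnorm : symbolNorm 0 a ≤ 1) (hρ : IsAngularCutoff ρ b C) (p : Plane × Plane) :
    LipBdd 8 (fun t => pairSymbol χ a j θ ρ t p) := by
  have hz : ‖(ρ (planeDet p / (θ * (2 ^ j) ^ 2)) : ℂ)‖ ≤ 1 := by
    rw [Complex.norm_real]; exact hρ.abs_le _
  have h := ((lipBdd_waveAmp hχ ha hnorm j p.1).mul
    (lipBdd_waveAmp hχ ha hnorm j p.2)).const_mul hz
  refine lipBdd_congr (h.mono (by norm_num)) fun t _ => ?_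
  rw [pairSymbol]
  ring

theorem abs_detDir_le {N : ℝ} {p : Plane × Plane} (h1 : InCone N p.1) (h2 : InCone N p.2)
    (i : Fin 2) : |detDir i p| ≤ 4 * N := by
  obtain ⟨a1, a2, a3⟩ := h1
  obtain ⟨b1, b2, b3⟩ := h2
  rw [abs_le] at a1 b1
  rw [abs_le, detDir]
  split_ifs <;> constructor <;> linarith

/-- Each term of the differentiated symbol is O(θ): the phase contributes a difference of unit
vectors, the amplitudes contribute 2^{-j}, and the angular cutoff contributes 1/(θ2^j). This gain of
θ is what produces the decay θ²/|y-z|² in the weight. -/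
theorem lipBdd_pairSymbolDeriv (hχ : IsDyadicCutoff χ) (ha : ContDiff ℝ 20 a)
    (hnorm : symbolNorm 0 a ≤ 1) (hcone : ConeSupported a) (hθ : 0 < θ) (hθ1 : θ ≤ 1)
    (hθN : 1 ≤ θ ^ 2 * 2 ^ j) (hρ : IsAngularCutoff ρ b C) {C₁ : ℝ} (hC₁0 : 0 ≤ C₁)
    (hC₁ : ∀ ξ i, |fderiv ℝ χ ξ (EuclideanSpace.single i 1)| ≤ C₁) {σ : ℝ}
    (hσ : σ = 1 ∨ σ = -1) (i : Fin 2) (p : Plane × Plane) :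
    LipBdd ((2176 + 16 * C₁ + 32 * C) * θ) (fun t => pairSymbolDeriv χ a j θ ρ σ i t p) := by
  have hC0 : 0 ≤ C := (abs_nonneg _).trans (hρ.abs_deriv_le 0)
  have hN : (0 : ℝ) < 2 ^ j := by positivity
  by_cases hp : p ∈ angleRegion (2 ^ j) θ b
  · have hσa : |σ| = 1 := by rcases hσ with h | h <;> simp [h]
    -- The hypothesis θ²2^j ≥ 1 enters here: angles below 2^{-j/2} would make the cutoff derivative
    -- larger than θ.
    have hinv : 1 / (θ * 2 ^ j) ≤ θ := by
      rw [div_le_iff₀ (by positivity)]; linarith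
    have hinv' : 1 / (2 : ℝ) ^ j ≤ θ := by
      refine le_trans ?_ hinv
      apply one_div_le_one_div_of_le (by positivity)
      nlinarith
    have z1 : ‖Complex.I * ((σ * (p.1 i / ‖p.1‖ - p.2 i / ‖p.2‖) : ℝ) : ℂ)‖ ≤ 64 * θ := by
      rw [norm_mul, Complex.norm_I, one_mul, Complex.norm_real, Real.norm_eq_abs, abs_mul, hσa,
        one_mul]
      exact abs_dir_sub_le hN hp i
    have z2 : ‖(ρ (planeDet p / (θ * (2 ^ j) ^ 2)) : ℂ)‖ ≤ 1 := by
      rw [Complex.norm_real]; exact hρ.abs_le _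
    have z3 : ‖((deriv ρ (planeDet p / (θ * (2 ^ j) ^ 2)) *
        (detDir i p / (θ * (2 ^ j) ^ 2)) : ℝ) : ℂ)‖ ≤ 4 * C * θ := by
      rw [Complex.norm_real, Real.norm_eq_abs, abs_mul, abs_div,
        abs_of_pos (show 0 < θ * (2 ^ j) ^ 2 by positivity)]
      calc _ ≤ C * (4 * 2 ^ j / (θ * (2 ^ j) ^ 2)) := by
            gcongr
            · exact hρ.abs_deriv_le _
            · exact abs_detDir_le hp.1 hp.2.1 i
        _ = 4 * C * (1 / (θ * 2 ^ j)) := by field_simp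
        _ ≤ _ := by gcongr
    have b1 := lipBdd_waveAmp hχ ha hnorm j p.1
    have b2 := lipBdd_waveAmp hχ ha hnorm j p.2
    have d1 := lipBdd_partialDeriv_waveAmp hχ ha hnorm hC₁ j i p.1
    have d2 := lipBdd_partialDeriv_waveAmp hχ ha hnorm hC₁ j i p.2
    have t1 := (lipBdd_id.mul (lipBdd_pairSymbol (j := j) (θ := θ) hχ ha hnorm hρ p)).const_mul z1
    have t2 := ((d1.mul b2).add ((b1.mul d2).const_mul (z := (-1 : ℂ)) (C := 1)
      (by simp))).const_mul z2
    have t3 := (b1.mul b2).const_mul z3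
    refine (t1.add (t2.add t3)).mono ?_
    have : (2 * C₁ + 16) / (2 : ℝ) ^ j ≤ (2 * C₁ + 16) * θ := by
      rw [div_eq_mul_one_div]
      gcongr
    nlinarith
  · refine lipBdd_congr (lipBdd_zero (by positivity)) fun t ht => ?_
    exact pairSymbolDeriv_eq_zero hχ hcone hθ hρ (by linarith [ht.1]) σ i hp

/-- Up to the unimodular factor with time -t this is a derivative of a C¹ function, hence
continuous, so the quotients by norms need no separate treatment. -/
theorem measurable_pairSymbolDeriv (hχ : IsDyadicCutoff χ) (ha : ContDiff ℝ 20 a)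
    (hcone : ConeSupported a) (hθ : 0 < θ)
    (hρ : IsAngularCutoff ρ b C) (σ : ℝ) (ht : 0 < t) (i : Fin 2) :
    Measurable (pairSymbolDeriv χ a j θ ρ σ i t) := by
  have e : pairSymbolDeriv χ a j θ ρ σ i t = fun p => pairExp σ (-t) p *
      antiDeriv i (fun p => pairExp σ t p * pairSymbol χ a j θ ρ t p) p := by
    funext p
    rw [antiDeriv_fullSymbol hχ ha hcone hθ hρ σ ht i p, ← mul_assoc, pairExp, pairExp,
      ← Complex.exp_add]
    have : Complex.I * ((-t * (σ * (‖p.1‖ + ‖p.2‖)) : ℝ) : ℂ) +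
        Complex.I * ((t * (σ * (‖p.1‖ + ‖p.2‖)) : ℝ) : ℂ) = 0 := by push_cast; ring
    rw [this, Complex.exp_zero, one_mul]
  rw [e]
  refine ((continuous_pairExp σ (-t)).mul ?_).measurable
  exact ((contDiff_fullSymbol hχ ha hcone hθ hρ σ ht).continuous_fderiv one_ne_zero).clm_apply
    continuous_const

end Symbol

/-! ### Linearity and continuity of `freqOp`, and the splitting at |y - z| = θ -/

theorem fourierPair_add {F G : Plane × Plane → ℂ} (hF : Integrable F) (hG : Integrable G)
    (p : Plane × Plane) :
    fourierPair (fun q => F q + G q) p = fourierPair F p + fourierPair G p := by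
  have h : ∀ {F : Plane × Plane → ℂ}, Integrable F → Integrable fun q : Plane × Plane =>
      Complex.exp (-Complex.I * ((inner ℝ q.1 p.1 + inner ℝ q.2 p.2 : ℝ) : ℂ)) * F q :=
    fun hF => hF.bdd_mul (c := 1) (Continuous.aestronglyMeasurable (by fun_prop))
      (Filter.Eventually.of_forall fun q => (norm_exp_neg_I_mul _).le)
  simp only [fourierPair, mul_add]
  exact integral_add (h hF) (h hG)

theorem fourierPair_const_mul (F : Plane × Plane → ℂ) (z : ℂ) (p : Plane × Plane) :
    fourierPair (fun q => z * F q) p = z * fourierPair F p := by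
  simp only [fourierPair]
  rw [← integral_const_mul]
  refine integral_congr_ae (Filter.Eventually.of_forall fun q => ?_)
  simp only
  ring

theorem integrable_mul_fourierPair {M F : Plane × Plane → ℂ} (hM : Integrable M)
    (hF : Integrable F) : Integrable fun p => M p * fourierPair F p :=
  hM.mul_bdd (c := ∫ q, ‖F q‖) (continuous_fourierPair hF).aestronglyMeasurable
    (Filter.Eventually.of_forall fun p => norm_fourierPair_le F p)

theorem integrable_freqOp_integrand {M F : Plane × Plane → ℂ} (hM : Integrable M)
    (hF : Integrable F) (x : Plane) : Integrable fun p : Plane × Plane =>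
      Complex.exp (Complex.I * (inner ℝ x (p.1 + p.2) : ℝ)) * M p * fourierPair F p := by
  simp_rw [mul_assoc]
  exact (integrable_mul_fourierPair hM hF).bdd_mul (c := 1)
    (Continuous.aestronglyMeasurable (by fun_prop))
      (Filter.Eventually.of_forall fun q => (norm_exp_I_mul _).le)

theorem freqOp_add {M F G : Plane × Plane → ℂ} (hM : Integrable M) (hF : Integrable F)
    (hG : Integrable G) (x : Plane) :
    freqOp M (fun q => F q + G q) x = freqOp M F x + freqOp M G x := by
  simp only [freqOp, fourierPair_add hF hG, mul_add]
  exact integral_add (integrable_freqOp_integrand hM hF x) (integrable_freqOp_integrand hM hG x)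

theorem continuous_freqOp {M F : Plane × Plane → ℂ} (hM : Integrable M) (hF : Integrable F) :
    Continuous (freqOp M F) := by
  refine continuous_of_dominated (bound := fun p => ‖M p * fourierPair F p‖) ?_ ?_
    (integrable_mul_fourierPair hM hF).norm ?_
  · exact fun x => (integrable_freqOp_integrand hM hF x).1
  · intro x
    refine Filter.Eventually.of_forall fun p => ?_
    rw [mul_assoc, norm_mul, norm_exp_I_mul, one_mul]
  · refine Filter.Eventually.of_forall fun p => ?_
    fun_prop

/-- The weight `1` for `|y - z| ≤ θ` and `θ² / |y - z|²` otherwise. -/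
noncomputable def angleWeight (θ r : ℝ) : ℝ := if r ≤ θ then 1 else θ ^ 2 / r ^ 2

theorem memLp_two_of_lintegral {X : Type*} [MeasurableSpace X] {μ : Measure X} {f : X → ℂ}
    (hf : AEStronglyMeasurable f μ) (h : ∫⁻ x, ‖f x‖ₑ ^ 2 ∂μ < ∞) : MemLp f 2 μ := by
  refine ⟨hf, ?_⟩
  rw [← eLpNorm_two_sq] at h
  by_contra h2
  rw [not_lt, top_le_iff] at h2
  simp [h2] at h

/-- The near-diagonal part of a function. -/
noncomputable def nearPart (θ : ℝ) (F : Plane × Plane → ℂ) (q : Plane × Plane) : ℂ :=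
  if ‖q.1 - q.2‖ ≤ θ then F q else 0

/-- The off-diagonal part of `F`, divided by `y - z`. -/
noncomputable def farFactor (θ : ℝ) (i : Fin 2) (q : Plane × Plane) : ℝ :=
  if ‖q.1 - q.2‖ ≤ θ then 0 else (q.1 i - q.2 i) / ‖q.1 - q.2‖ ^ 2

theorem measurable_farFactor (θ : ℝ) (i : Fin 2) : Measurable (farFactor θ i) := by
  unfold farFactor
  refine Measurable.ite ?_ measurable_const ?_
  · have hc : Continuous fun q : Plane × Plane => ‖q.1 - q.2‖ := by fun_prop
    exact (isClosed_le hc continuous_const).measurableSet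
  · have h1 : Continuous fun q : Plane × Plane => q.1 i - q.2 i := by fun_prop
    have h2 : Continuous fun q : Plane × Plane => ‖q.1 - q.2‖ ^ 2 := by fun_prop
    exact h1.measurable.div h2.measurable

theorem abs_coord_sub_le (q : Plane × Plane) (i : Fin 2) : |q.1 i - q.2 i| ≤ ‖q.1 - q.2‖ := by
  simpa using abs_coord_le_norm (q.1 - q.2) i

theorem farFactor_sq_le {θ : ℝ} (hθ : 0 < θ) (i : Fin 2) (q : Plane × Plane) :
    θ ^ 2 * farFactor θ i q ^ 2 ≤ angleWeight θ ‖q.1 - q.2‖ := by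
  unfold farFactor angleWeight
  split_ifs with h
  · norm_num
  · have hr : 0 < ‖q.1 - q.2‖ := hθ.trans (not_le.1 h)
    have h1 : (q.1 i - q.2 i) ^ 2 ≤ ‖q.1 - q.2‖ ^ 2 :=
      sq_le_sq' (by linarith [(abs_le.1 (abs_coord_sub_le q i)).1])
        (abs_le.1 (abs_coord_sub_le q i)).2
    rw [div_pow, mul_div_assoc']
    rw [div_le_div_iff₀ (by positivity) (by positivity)]
    calc _ ≤ θ ^ 2 * ‖q.1 - q.2‖ ^ 2 * ‖q.1 - q.2‖ ^ 2 := by gcongr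
      _ = _ := by ring

/-- Off the diagonal 1 = Σ_i (y_i - z_i)²/|y - z|². One factor y_i - z_i is left outside, to be
converted into a derivative of the symbol. -/
theorem eq_nearPart_add {θ : ℝ} (hθ : 0 < θ) (F : Plane × Plane → ℂ) (q : Plane × Plane) :
    F q = nearPart θ F q + (((q.1 0 - q.2 0 : ℝ) : ℂ) * (farFactor θ 0 q * F q) +
      ((q.1 1 - q.2 1 : ℝ) : ℂ) * (farFactor θ 1 q * F q)) := by
  unfold nearPart farFactor
  split_ifs with h
  · simp
  · have hr : 0 < ‖q.1 - q.2‖ := hθ.trans (not_le.1 h)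
    have h2 : ‖q.1 - q.2‖ ^ 2 = (q.1 0 - q.2 0) ^ 2 + (q.1 1 - q.2 1) ^ 2 := by
      rw [EuclideanSpace.norm_sq_eq, Fin.sum_univ_two]; simp
    have h3 : (q.1 0 - q.2 0) * ((q.1 0 - q.2 0) / ‖q.1 - q.2‖ ^ 2) +
        (q.1 1 - q.2 1) * ((q.1 1 - q.2 1) / ‖q.1 - q.2‖ ^ 2) = 1 := by
      rw [mul_div_assoc', mul_div_assoc', ← add_div, ← sq, ← sq, ← h2]
      exact div_self (by positivity)
    have h4 : (((q.1 0 - q.2 0) * ((q.1 0 - q.2 0) / ‖q.1 - q.2‖ ^ 2) +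
        (q.1 1 - q.2 1) * ((q.1 1 - q.2 1) / ‖q.1 - q.2‖ ^ 2) : ℝ) : ℂ) = 1 := by
      rw [h3]; simp
    rw [Complex.ofReal_add, Complex.ofReal_mul, Complex.ofReal_mul] at h4
    linear_combination (-F q) * h4

theorem enorm_add_three_sq_le (x y z : ℂ) :
    ‖x + (y + z)‖ₑ ^ 2 ≤ 3 * (‖x‖ₑ ^ 2 + (‖y‖ₑ ^ 2 + ‖z‖ₑ ^ 2)) := by
  have h : ‖x + (y + z)‖ ^ 2 ≤ 3 * (‖x‖ ^ 2 + (‖y‖ ^ 2 + ‖z‖ ^ 2)) := by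
    have h1 : ‖x + (y + z)‖ ≤ ‖x‖ + (‖y‖ + ‖z‖) :=
      (norm_add_le _ _).trans (by gcongr; exact norm_add_le _ _)
    calc ‖x + (y + z)‖ ^ 2 ≤ (‖x‖ + (‖y‖ + ‖z‖)) ^ 2 := by gcongr
      _ ≤ _ := by nlinarith [sq_nonneg (‖x‖ - ‖y‖), sq_nonneg (‖x‖ - ‖z‖), sq_nonneg (‖y‖ - ‖z‖)]
  have h2 := ENNReal.ofReal_le_ofReal h
  rw [ENNReal.ofReal_mul (by norm_num), ENNReal.ofReal_add (by positivity) (by positivity),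
    ENNReal.ofReal_add (by positivity) (by positivity)] at h2
  simpa [ENNReal.ofReal_pow] using h2

end BilinearWave

namespace BilinearWave

/-- The constant in the estimate for a fixed angle. -/
noncomputable def pieceConst (B : ℝ) : ℝ :=
  24 * (2 * Real.pi) ^ 6 * fibreConst * (64 + 2 * B ^ 2)

theorem pieceConst_pos (B : ℝ) : 0 < pieceConst B := by
  have := fibreConst_ge
  have := Real.pi_pos
  unfold pieceConst
  positivity

/-- The near part is estimated with the undifferentiated symbol, bounded by 8. In each far part the
factor y_i - z_i is moved to the symbol, whose new bound Bθ supplies the θ² needed to dominate the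
squared norm of `G i` by the weighted norm of F. -/
theorem sum_lintegral_piece_le {χ : Plane → ℝ} {a : Plane → ℂ} {j : ℕ} {θ : ℝ} {ρ : ℝ → ℝ}
    {b : Prop} {C : ℝ} (hχ : IsDyadicCutoff χ) (ha : ContDiff ℝ 20 a)
    (hnorm : symbolNorm 0 a ≤ 1) (hcone : ConeSupported a) (hθ : 0 < θ) (hθ1 : θ ≤ 1)
    (hθN : 1 ≤ θ ^ 2 * 2 ^ j) (hρ : IsAngularCutoff ρ b C) {C₁ : ℝ} (hC₁0 : 0 ≤ C₁)
    (hC₁ : ∀ ξ i, |fderiv ℝ χ ξ (EuclideanSpace.single i 1)| ≤ C₁) {σ : ℝ}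
    (hσ : σ = 1 ∨ σ = -1) {E : Finset ℝ} (hE : (E : Set ℝ) ⊆ Set.Icc 1 2) {ℓ Q : ℝ}
    (hℓ : ℓ * (θ ^ 2 * 2 ^ j) = 1)
    (hQ : ∀ s : ℝ, ((E.filter fun t => t ∈ Set.Icc s (s + ℓ)).card : ℝ) ≤ Q)
    (hb : b ∨ (E.card : ℝ) ≤ 2 * Q) {F : Plane × Plane → ℂ} (hF : Integrable F)
    (hfin : ∫⁻ q, ENNReal.ofReal (angleWeight θ ‖q.1 - q.2‖) * ‖F q‖ₑ ^ 2 < ∞) :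
    ∑ t ∈ E, ∫⁻ x, ‖freqOp (fun p => pairExp σ t p * pairSymbol χ a j θ ρ t p) F x‖ₑ ^ 2 ≤
      ENNReal.ofReal (pieceConst (2176 + 16 * C₁ + 32 * C) * (Q * (θ * (2 ^ j) ^ 2))) *
        ∫⁻ q, ENNReal.ofReal (angleWeight θ ‖q.1 - q.2‖) * ‖F q‖ₑ ^ 2 := by
  have hN : (0 : ℝ) < 2 ^ j := by positivity
  have hQ0 : 0 ≤ Q := (Nat.cast_nonneg _).trans (hQ 0)
  have hfC : 0 ≤ fibreConst := by linarith [fibreConst_ge]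
  set B := 2176 + 16 * C₁ + 32 * C with hB
  set J := ∫⁻ q : Plane × Plane, ENNReal.ofReal (angleWeight θ ‖q.1 - q.2‖) * ‖F q‖ₑ ^ 2 with hJ
  have htpos : ∀ t ∈ E, 0 < t := fun t ht => by linarith [(hE ht).1]
  set Fn := nearPart θ F with hFn
  set G : Fin 2 → Plane × Plane → ℂ := fun i q => (farFactor θ i q : ℂ) * F q with hG
  have hset : MeasurableSet {q : Plane × Plane | ‖q.1 - q.2‖ ≤ θ} := by
    have hc : Continuous fun q : Plane × Plane => ‖q.1 - q.2‖ := by fun_prop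
    exact (isClosed_le hc continuous_const).measurableSet
  have hFn_eq : Fn = {q : Plane × Plane | ‖q.1 - q.2‖ ≤ θ}.indicator F := by
    funext q
    simp only [hFn, nearPart, Set.indicator, Set.mem_ofPred_eq]
  have hFn1 : Integrable Fn := by rw [hFn_eq]; exact hF.indicator hset
  have hFnJ : ∫⁻ q, ‖Fn q‖ₑ ^ 2 ≤ J := by
    refine lintegral_mono fun q => ?_
    simp only [hFn, nearPart, angleWeight]
    split_ifs <;> simp
  have hfb : ∀ i q, ‖(farFactor θ i q : ℂ)‖ ≤ 1 / θ := by
    intro i q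
    rw [Complex.norm_real, Real.norm_eq_abs]
    refine abs_le_of_sq_le_sq ?_ (by positivity)
    have h1 := farFactor_sq_le hθ i q
    have h2 : angleWeight θ ‖q.1 - q.2‖ ≤ 1 := by
      unfold angleWeight
      split_ifs with h
      · exact le_rfl
      · have := not_le.1 h
        rw [div_le_one (pow_pos (hθ.trans this) 2)]
        gcongr
    rw [div_pow, one_pow, le_div_iff₀ (by positivity)]
    linarith
  have hG1 : ∀ i, Integrable (G i) := fun i =>
    hF.bdd_mul (c := 1 / θ)
      (Complex.measurable_ofReal.comp (measurable_farFactor θ i)).aestronglyMeasurable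
      (Filter.Eventually.of_forall (hfb i))
  have hGJ : ∀ i, ENNReal.ofReal (θ ^ 2) * ∫⁻ q, ‖G i q‖ₑ ^ 2 ≤ J := by
    intro i
    rw [← lintegral_const_mul' _ _ ENNReal.ofReal_ne_top]
    refine lintegral_mono fun q => ?_
    simp only [hG]
    rw [enorm_mul, mul_pow, ← mul_assoc]
    gcongr
    rw [← ofReal_norm, Complex.norm_real, ← ENNReal.ofReal_pow (norm_nonneg _),
      ← ENNReal.ofReal_mul (by positivity), Real.norm_eq_abs, sq_abs]
    exact ENNReal.ofReal_le_ofReal (farFactor_sq_le hθ i q)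
  have hG2 : ∀ i, MemLp (G i) 2 := by
    intro i
    refine memLp_two_of_lintegral (hG1 i).1 ?_
    by_contra h
    rw [not_lt, top_le_iff] at h
    have h1 := hGJ i
    rw [h, ENNReal.mul_top (by simpa using hθ.ne')] at h1
    exact absurd hfin (not_lt.2 h1)
  have hFn2 : MemLp Fn 2 := memLp_two_of_lintegral hFn1.1 (hFnJ.trans_lt hfin)
  have hxG : ∀ i, Integrable fun q : Plane × Plane => ((q.1 i - q.2 i : ℝ) : ℂ) * G i q := by
    intro i
    have : (fun q : Plane × Plane => ((q.1 i - q.2 i : ℝ) : ℂ) * G i q) = fun q =>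
        (((q.1 i - q.2 i) * farFactor θ i q : ℝ) : ℂ) * F q := by
      funext q; simp only [hG]; push_cast; ring
    rw [this]
    refine hF.bdd_mul (c := 1) ?_ (Filter.Eventually.of_forall fun q => ?_)
    · have h1 : Continuous fun q : Plane × Plane => q.1 i - q.2 i := by fun_prop
      exact (Complex.measurable_ofReal.comp
        (h1.measurable.mul (measurable_farFactor θ i))).aestronglyMeasurable
    · rw [Complex.norm_real, Real.norm_eq_abs, abs_mul]
      unfold farFactor
      split_ifs with h
      · simp
      · have hr : 0 < ‖q.1 - q.2‖ := hθ.trans (not_le.1 h)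
        have h2 := abs_coord_sub_le q i
        rw [abs_div, abs_of_pos (pow_pos hr 2), mul_div_assoc', div_le_one (by positivity), sq]
        gcongr
  have hM : ∀ t ∈ E, ContDiff ℝ 1 (fun p => pairExp σ t p * pairSymbol χ a j θ ρ t p) :=
    fun t ht => contDiff_fullSymbol hχ ha hcone hθ hρ σ (htpos t ht)
  have hMc : ∀ t ∈ E,
      HasCompactSupport (fun p => pairExp σ t p * pairSymbol χ a j θ ρ t p) :=
    fun t ht => hasCompactSupport_fullSymbol hχ hcone hθ hρ σ (htpos t ht)
  have hMi : ∀ t ∈ E, Integrable (fun p => pairExp σ t p * pairSymbol χ a j θ ρ t p) :=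
    fun t ht => (hM t ht).continuous.integrable_of_hasCompactSupport (hMc t ht)
  have hanti : ∀ t ∈ E, ∀ i, antiDeriv i (fun p => pairExp σ t p * pairSymbol χ a j θ ρ t p) =
      fun p => pairExp σ t p * pairSymbolDeriv χ a j θ ρ σ i t p := fun t ht i =>
    funext fun p => antiDeriv_fullSymbol hχ ha hcone hθ hρ σ (htpos t ht) i p
  have hsplit : ∀ t ∈ E, ∀ x,
      ‖freqOp (fun p => pairExp σ t p * pairSymbol χ a j θ ρ t p) F x‖ₑ ^ 2 ≤
      3 * (‖freqOp (fun p => pairExp σ t p * pairSymbol χ a j θ ρ t p) Fn x‖ₑ ^ 2 +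
        (‖freqOp (fun p => pairExp σ t p * pairSymbolDeriv χ a j θ ρ σ 0 t p) (G 0) x‖ₑ ^ 2 +
        ‖freqOp (fun p => pairExp σ t p * pairSymbolDeriv χ a j θ ρ σ 1 t p) (G 1) x‖ₑ ^ 2)) := by
    intro t ht x
    have e1 : F = fun q => Fn q + (((q.1 0 - q.2 0 : ℝ) : ℂ) * G 0 q +
        ((q.1 1 - q.2 1 : ℝ) : ℂ) * G 1 q) := funext fun q => eq_nearPart_add hθ F q
    conv_lhs => rw [e1]
    have hxx : Integrable fun q : Plane × Plane => ((q.1 0 - q.2 0 : ℝ) : ℂ) * G 0 q +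
        ((q.1 1 - q.2 1 : ℝ) : ℂ) * G 1 q := (hxG 0).add (hxG 1)
    rw [freqOp_add (hMi t ht) hFn1 hxx,
      freqOp_add (hMi t ht) (hxG 0) (hxG 1),
      freqOp_antiDeriv (hM t ht) (hMc t ht) 0 (hG1 0) (hxG 0),
      freqOp_antiDeriv (hM t ht) (hMc t ht) 1 (hG1 1) (hxG 1), hanti t ht, hanti t ht]
    refine (enorm_add_three_sq_le _ _ _).trans (le_of_eq ?_)
    have hI : ‖-Complex.I‖ₑ = 1 := by rw [← ofReal_norm]; simp
    rw [enorm_mul, enorm_mul, hI, one_mul, one_mul]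
  have m1 : ∀ t ∈ E, Measurable fun x =>
      ‖freqOp (fun p => pairExp σ t p * pairSymbol χ a j θ ρ t p) Fn x‖ₑ ^ 2 := fun t ht =>
    (continuous_freqOp (hMi t ht) hFn1).measurable.enorm.pow_const 2
  have m2 : ∀ t ∈ E, Measurable fun x =>
      ‖freqOp (fun p => pairExp σ t p * pairSymbolDeriv χ a j θ ρ σ 0 t p) (G 0) x‖ₑ ^ 2 := by
    intro t ht
    rw [← hanti t ht]
    exact (continuous_freqOp (integrable_antiDeriv (hM t ht) (hMc t ht) 0)
      (hG1 0)).measurable.enorm.pow_const 2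
  have est1 : ∑ t ∈ E,
      ∫⁻ x, ‖freqOp (fun p => pairExp σ t p * pairSymbol χ a j θ ρ t p) Fn x‖ₑ ^ 2 ≤
      ENNReal.ofReal ((2 * Real.pi) ^ 6 *
        (4 * 8 ^ 2 * (2 * fibreConst * Q * θ * (2 ^ j) ^ 2))) * J := by
    refine (sum_lintegral_freqOp_sq_le hE hN hθ hℓ hσ hQ hb (B := 8)
      (n := fun t => pairSymbol χ a j θ ρ t)
      (fun t _ => (contDiff_pairSymbol hχ ha hρ θ t).continuous.measurable)
      (fun t ht p hp => pairSymbol_eq_zero hχ hcone hθ hρ (htpos t ht) hp)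
      (fun t ht p => (lipBdd_pairSymbol hχ ha hnorm hρ p).1 t (hE ht))
      (fun t ht s hs p => (lipBdd_pairSymbol hχ ha hnorm hρ p).2 t (hE ht) s (hE hs))
      hFn1 hFn2).trans ?_
    gcongr
  have est2 : ∀ i, ∑ t ∈ E,
      ∫⁻ x, ‖freqOp (fun p => pairExp σ t p * pairSymbolDeriv χ a j θ ρ σ i t p) (G i) x‖ₑ ^ 2 ≤
      ENNReal.ofReal ((2 * Real.pi) ^ 6 *
        (4 * B ^ 2 * (2 * fibreConst * Q * θ * (2 ^ j) ^ 2))) * J := by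
    intro i
    have hlip := fun p => lipBdd_pairSymbolDeriv hχ ha hnorm hcone hθ hθ1 hθN hρ hC₁0 hC₁ hσ i p
    refine (sum_lintegral_freqOp_sq_le hE hN hθ hℓ hσ hQ hb (B := B * θ)
      (n := fun t => pairSymbolDeriv χ a j θ ρ σ i t)
      (fun t ht => measurable_pairSymbolDeriv hχ ha hcone hθ hρ σ (htpos t ht) i)
      (fun t ht p hp => pairSymbolDeriv_eq_zero hχ hcone hθ hρ (htpos t ht) σ i hp)
      (fun t ht p => (hlip p).1 t (hE ht))
      (fun t ht s hs p => (hlip p).2 t (hE ht) s (hE hs)) (hG1 i) (hG2 i)).trans ?_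
    calc _ = ENNReal.ofReal ((2 * Real.pi) ^ 6 *
        (4 * B ^ 2 * (2 * fibreConst * Q * θ * (2 ^ j) ^ 2))) *
          (ENNReal.ofReal (θ ^ 2) * ∫⁻ q, ‖G i q‖ₑ ^ 2) := by
          rw [← mul_assoc (ENNReal.ofReal _) (ENNReal.ofReal (θ ^ 2)),
            ← ENNReal.ofReal_mul (by positivity)]
          congr 2
          ring
      _ ≤ _ := by gcongr; exact hGJ i
  calc _ ≤ ∑ t ∈ E, ∫⁻ x,
      3 * (‖freqOp (fun p => pairExp σ t p * pairSymbol χ a j θ ρ t p) Fn x‖ₑ ^ 2 +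
        (‖freqOp (fun p => pairExp σ t p * pairSymbolDeriv χ a j θ ρ σ 0 t p) (G 0) x‖ₑ ^ 2 +
        ‖freqOp (fun p => pairExp σ t p * pairSymbolDeriv χ a j θ ρ σ 1 t p) (G 1) x‖ₑ ^ 2)) :=
        Finset.sum_le_sum fun t ht => lintegral_mono (hsplit t ht)
    _ = 3 * ((∑ t ∈ E,
          ∫⁻ x, ‖freqOp (fun p => pairExp σ t p * pairSymbol χ a j θ ρ t p) Fn x‖ₑ ^ 2) +
        ((∑ t ∈ E, ∫⁻ x,
          ‖freqOp (fun p => pairExp σ t p * pairSymbolDeriv χ a j θ ρ σ 0 t p) (G 0) x‖ₑ ^ 2) +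
        (∑ t ∈ E, ∫⁻ x,
          ‖freqOp (fun p => pairExp σ t p * pairSymbolDeriv χ a j θ ρ σ 1 t p) (G 1) x‖ₑ ^ 2))) := by
        rw [← Finset.sum_add_distrib, ← Finset.sum_add_distrib, Finset.mul_sum]
        refine Finset.sum_congr rfl fun t ht => ?_
        rw [lintegral_const_mul' _ _ (by norm_num), lintegral_add_left (m1 t ht),
          lintegral_add_left (m2 t ht)]
    _ ≤ 3 * (ENNReal.ofReal ((2 * Real.pi) ^ 6 *
        (4 * 8 ^ 2 * (2 * fibreConst * Q * θ * (2 ^ j) ^ 2))) * J +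
        (ENNReal.ofReal ((2 * Real.pi) ^ 6 *
        (4 * B ^ 2 * (2 * fibreConst * Q * θ * (2 ^ j) ^ 2))) * J +
        ENNReal.ofReal ((2 * Real.pi) ^ 6 *
        (4 * B ^ 2 * (2 * fibreConst * Q * θ * (2 ^ j) ^ 2))) * J)) :=
        mul_le_mul_right (add_le_add est1 (add_le_add (est2 0) (est2 1))) 3
    _ = _ := by
        rw [← add_mul, ← add_mul, ← mul_assoc, ← ENNReal.ofReal_add (by positivity) (by positivity),
          ← ENNReal.ofReal_add (by positivity) (by positivity),
          show (3 : ℝ≥0∞) = ENNReal.ofReal 3 by simp, ← ENNReal.ofReal_mul (by norm_num)]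
        congr 2
        unfold pieceConst
        ring

/-! ### Angular decomposition -/

theorem exists_bump : ∃ (φ : ℝ → ℝ) (C : ℝ), 0 ≤ C ∧ ContDiff ℝ 1 φ ∧
    (∀ y, 0 ≤ φ y ∧ φ y ≤ 1) ∧ (∀ y, |y| ≤ 1 → φ y = 1) ∧ (∀ y, φ y ≠ 0 → |y| ≤ 2) ∧
    ∀ y, |deriv φ y| ≤ C := by
  let f : ContDiffBump (0 : ℝ) := ⟨1, 2, by norm_num, by norm_num⟩
  have hf : ContDiff ℝ 1 f := f.contDiff
  obtain ⟨C, hC⟩ := f.hasCompactSupport.deriv.exists_bound_of_continuous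
    (hf.continuous_deriv le_rfl)
  refine ⟨f, C, (norm_nonneg _).trans (hC 0), hf, fun y => ⟨f.nonneg, f.le_one⟩, fun y hy => ?_,
    fun y hy => ?_, hC⟩
  · apply f.one_of_mem_closedBall
    simpa using hy
  · by_contra h
    refine hy (f.zero_of_le_dist ?_)
    rw [Real.dist_eq, sub_zero]
    exact (not_le.1 h).le

theorem isAngularCutoff_of_bump {φ : ℝ → ℝ} {C : ℝ} (hC0 : 0 ≤ C) (h1 : ContDiff ℝ 1 φ)
    (h2 : ∀ y, 0 ≤ φ y ∧ φ y ≤ 1) (h3 : ∀ y, φ y ≠ 0 → |y| ≤ 2)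
    (h4 : ∀ y, |deriv φ y| ≤ C) : IsAngularCutoff φ False (3 * C) where
  contDiff := h1
  abs_le y := by rw [abs_of_nonneg (h2 y).1]; exact (h2 y).2
  abs_deriv_le y := (h4 y).trans (by linarith)
  supp y hy := ⟨h3 y hy, False.elim⟩

/-- For |y| < 1/2 both bumps equal 1 and cancel; for |y| > 2 both vanish. The chain rule gives the
derivative bound C + 2C. -/
theorem isAngularCutoff_sub_of_bump {φ : ℝ → ℝ} {C : ℝ} (h1 : ContDiff ℝ 1 φ)
    (h2 : ∀ y, 0 ≤ φ y ∧ φ y ≤ 1) (h2' : ∀ y, |y| ≤ 1 → φ y = 1) (h3 : ∀ y, φ y ≠ 0 → |y| ≤ 2)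
    (h4 : ∀ y, |deriv φ y| ≤ C) :
    IsAngularCutoff (fun y => φ y - φ (2 * y)) True (3 * C) where
  contDiff := h1.sub (h1.comp (contDiff_const.mul contDiff_id))
  abs_le y := by
    have a := h2 y
    have b := h2 (2 * y)
    rw [abs_le]
    constructor <;> linarith [a.1, a.2, b.1, b.2]
  abs_deriv_le y := by
    have hd := h1.differentiable one_ne_zero
    have e1 : HasDerivAt (fun y : ℝ => φ (2 * y)) (deriv φ (2 * y) * 2) y := by
      have h := (hd (2 * y)).hasDerivAt
      have l : HasDerivAt (fun y : ℝ => 2 * y) 2 y := by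
        simpa using (hasDerivAt_id y).const_mul (2 : ℝ)
      exact h.comp y l
    have e := ((hd y).hasDerivAt.sub e1).deriv
    have e' : deriv (fun y => φ y - φ (2 * y)) y = deriv φ y - deriv φ (2 * y) * 2 := e
    rw [e']
    have a := h4 y
    have b := h4 (2 * y)
    rw [abs_le] at a b ⊢
    constructor <;> linarith [a.1, a.2, b.1, b.2]
  supp y hy := by
    constructor
    · by_contra h
      push Not at h
      have e1 : φ y = 0 := by
        by_contra h0
        exact absurd (h3 y h0) (not_le.2 h)
      have e2 : φ (2 * y) = 0 := by
        by_contra h0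
        have := h3 _ h0
        rw [abs_mul, abs_two] at this
        linarith
      exact hy (by rw [e1, e2]; ring)
    · intro _
      by_contra h
      push Not at h
      refine hy ?_
      rw [h2' y (by linarith), h2' (2 * y) (by rw [abs_mul, abs_two]; linarith)]
      ring

/-- The cutoff used at the angular scale `2^{-l}`, `l ≤ n`. -/
noncomputable def angleCutoff (φ : ℝ → ℝ) (n l : ℕ) (y : ℝ) : ℝ :=
  if l < n then φ y - φ (2 * y) else φ y

/-- The sum telescopes: the undivided bump at the last index l = n restores the remainder, leaving
the bump at scale 1. -/
theorem sum_angleCutoff (φ : ℝ → ℝ) (n : ℕ) (y : ℝ) :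
    ∑ l ∈ Finset.range (n + 1), angleCutoff φ n l (y * 2 ^ l) = φ y := by
  rw [Finset.sum_range_succ]
  have h : ∑ l ∈ Finset.range n, angleCutoff φ n l (y * 2 ^ l) =
      ∑ l ∈ Finset.range n, (φ (y * 2 ^ l) - φ (y * 2 ^ (l + 1))) := by
    refine Finset.sum_congr rfl fun l hl => ?_
    rw [angleCutoff, if_pos (Finset.mem_range.1 hl), pow_succ]
    congr 2
    ring
  rw [h, Finset.sum_range_sub' (fun l => φ (y * 2 ^ l)), angleCutoff, if_neg (lt_irrefl n)]
  simp

end BilinearWave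

namespace BilinearWave

theorem angleCutoff_of_lt (φ : ℝ → ℝ) {n l : ℕ} (h : l < n) :
    angleCutoff φ n l = fun y => φ y - φ (2 * y) := by
  funext y; rw [angleCutoff, if_pos h]

theorem angleCutoff_of_not_lt (φ : ℝ → ℝ) {n l : ℕ} (h : ¬ l < n) : angleCutoff φ n l = φ := by
  funext y; rw [angleCutoff, if_neg h]

theorem isAngularCutoff_angleCutoff {φ : ℝ → ℝ} {C : ℝ} (hC0 : 0 ≤ C) (h1 : ContDiff ℝ 1 φ)
    (h2 : ∀ y, 0 ≤ φ y ∧ φ y ≤ 1) (h2' : ∀ y, |y| ≤ 1 → φ y = 1) (h3 : ∀ y, φ y ≠ 0 → |y| ≤ 2)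
    (h4 : ∀ y, |deriv φ y| ≤ C) (n l : ℕ) :
    IsAngularCutoff (angleCutoff φ n l) (l < n) (3 * C) := by
  by_cases h : l < n
  · rw [angleCutoff_of_lt φ h, eq_true h]
    exact isAngularCutoff_sub_of_bump h1 h2 h2' h3 h4
  · rw [angleCutoff_of_not_lt φ h, eq_false h]
    exact isAngularCutoff_of_bump hC0 h1 h2 h3 h4

/-- The narrow cone makes the determinant at most N² in absolute value wherever the amplitudes are
nonzero, so the bump to which the cutoffs sum equals 1 there. -/
theorem sum_pairSymbol {χ : Plane → ℝ} (hχ : IsDyadicCutoff χ) {a : Plane → ℂ}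
    (hcone : ConeSupported a) (j : ℕ) {φ : ℝ → ℝ} (hφ : ∀ y, |y| ≤ 1 → φ y = 1) (n : ℕ) {t : ℝ}
    (ht : 0 < t) (p : Plane × Plane) :
    ∑ l ∈ Finset.range (n + 1), pairSymbol χ a j ((2 ^ l)⁻¹) (angleCutoff φ n l) t p =
      waveAmp χ a j t p.1 * waveAmp χ a j t p.2 := by
  simp only [pairSymbol]
  rw [← Finset.mul_sum]
  by_cases h1 : waveAmp χ a j t p.1 = 0
  · simp [h1]
  by_cases h2 : waveAmp χ a j t p.2 = 0
  · simp [h2]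
  obtain ⟨a1, a2, -, -, a3⟩ := waveAmp_support hχ hcone ht h1
  obtain ⟨b1, b2, -, -, b3⟩ := waveAmp_support hχ hcone ht h2
  have hN : (0 : ℝ) < 2 ^ j := by positivity
  set N : ℝ := 2 ^ j
  rw [show (2 : ℝ) ^ (-10 : ℤ) = 1 / 1024 by norm_num] at a2 b2
  have e : ∀ l : ℕ, planeDet p / ((2 ^ l)⁻¹ * N ^ 2) = planeDet p / N ^ 2 * 2 ^ l := by
    intro l
    field_simp
  have hy : |planeDet p / N ^ 2| ≤ 1 := by
    rw [abs_div, abs_of_pos (pow_pos hN 2), div_le_one (by positivity), abs_le, planeDet]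
    have c1 : p.1 0 * p.2 1 ≤ N / 512 * (2 * N) :=
      mul_le_mul (by linarith) b3 (by linarith) (by positivity)
    have c2 : p.1 1 * p.2 0 ≤ 2 * N * (N / 512) :=
      mul_le_mul a3 (by linarith) b1.le (by positivity)
    have c3 : 0 ≤ p.1 0 * p.2 1 := mul_nonneg a1.le (by linarith)
    have c4 : 0 ≤ p.1 1 * p.2 0 := mul_nonneg (by linarith) b1.le
    constructor <;> nlinarith
  have hs : ∑ l ∈ Finset.range (n + 1),
      ((angleCutoff φ n l (planeDet p / ((2 ^ l)⁻¹ * N ^ 2)) : ℝ) : ℂ) = 1 := by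
    simp only [e]
    rw [← Complex.ofReal_sum, sum_angleCutoff, hφ _ hy, Complex.ofReal_one]
  rw [hs, mul_one]

theorem bilinearOp_eq_sum_freqOp {χ : Plane → ℝ} (hχ : IsDyadicCutoff χ) {a : Plane → ℂ}
    (hcone : ConeSupported a) (j : ℕ) {φ : ℝ → ℝ} (hφ : ∀ y, |y| ≤ 1 → φ y = 1) (n : ℕ) (σ : ℝ)
    {t : ℝ} (ht : 0 < t) {F : Plane × Plane → ℂ} (hF : Integrable F)
    (hM : ∀ l, Integrable fun p =>
      pairExp σ t p * pairSymbol χ a j ((2 ^ l)⁻¹) (angleCutoff φ n l) t p) (x : Plane) :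
    bilinearOp χ a σ j F x t = ∑ l ∈ Finset.range (n + 1),
      freqOp (fun p => pairExp σ t p * pairSymbol χ a j ((2 ^ l)⁻¹) (angleCutoff φ n l) t p)
        F x := by
  simp only [freqOp]
  rw [← integral_finsetSum _ fun l _ => integrable_freqOp_integrand (hM l) hF x]
  refine integral_congr_ae (Filter.Eventually.of_forall fun p => ?_)
  simp only
  rw [← Finset.sum_mul, ← Finset.mul_sum, ← Finset.mul_sum, sum_pairSymbol hχ hcone j hφ n ht p]
  have : Complex.exp (Complex.I *
        ((inner ℝ x (p.1 + p.2) + σ * t * (‖p.1‖ + ‖p.2‖) : ℝ) : ℂ)) =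
      Complex.exp (Complex.I * (inner ℝ x (p.1 + p.2) : ℝ)) * pairExp σ t p := by
    rw [pairExp, ← Complex.exp_add]
    congr 1
    push_cast
    ring
  rw [this, waveAmp, waveAmp]
  ring

theorem enorm_sum_sq_le {ι : Type*} (s : Finset ι) (f : ι → ℂ) :
    ‖∑ i ∈ s, f i‖ₑ ^ 2 ≤ (s.card : ℝ≥0∞) * ∑ i ∈ s, ‖f i‖ₑ ^ 2 := by
  have h1 : ‖∑ i ∈ s, f i‖ ^ 2 ≤ s.card * ∑ i ∈ s, ‖f i‖ ^ 2 :=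
    (pow_le_pow_left₀ (norm_nonneg _) (norm_sum_le s f) 2).trans sq_sum_le_card_mul_sum_sq
  have h2 := ENNReal.ofReal_le_ofReal h1
  rw [ENNReal.ofReal_mul (by positivity), ENNReal.ofReal_natCast,
    ENNReal.ofReal_sum_of_nonneg fun i _ => by positivity] at h2
  simpa only [ENNReal.ofReal_pow (norm_nonneg _), ofReal_norm] using h2

/-! ### Covering numbers and the Assouad characteristic -/

/-- A closed interval of length δ may contain both endpoints, so 2 is the right count. Among three
distinct points all differences would be ±δ, but one of them is the sum of the other two. -/
theorem UniformlySeparated.card_filter_Icc_le_two {δ : ℝ} (hδ : 0 < δ) {E : Finset ℝ}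
    (hE : UniformlySeparated δ E) (u : ℝ) :
    (E.filter fun t => t ∈ Set.Icc u (u + δ)).card ≤ 2 := by
  by_contra h
  obtain ⟨x, y, z, hx, hy, hz, hxy, hxz, hyz⟩ := Finset.two_lt_card_iff.1 (not_le.1 h)
  simp only [Finset.mem_filter, Set.mem_Icc] at hx hy hz
  have key : ∀ {p q : ℝ} {n : ℤ}, u ≤ p → p ≤ u + δ → u ≤ q → q ≤ u + δ → p - q = δ * n →
      p ≠ q → (n = 1 ∨ n = -1) := by
    intro p q n h1 h2 h3 h4 h5 h6
    have hn : n ≠ 0 := by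
      rintro rfl
      exact h6 (by simpa [sub_eq_zero] using h5)
    have a1 : (n : ℝ) ≤ 1 := by
      have : δ * n ≤ δ * 1 := by linarith
      exact le_of_mul_le_mul_left this hδ
    have a2 : (-1 : ℝ) ≤ n := by
      have : δ * (-1) ≤ δ * n := by linarith
      exact le_of_mul_le_mul_left this hδ
    have a1' : n ≤ 1 := by exact_mod_cast a1
    have a2' : -1 ≤ n := by exact_mod_cast a2
    omega
  obtain ⟨m, hm⟩ := hE x hx.1 y hy.1
  obtain ⟨k, hk⟩ := hE y hy.1 z hz.1
  have hmk : x - z = δ * ((m + k : ℤ) : ℝ) := by push_cast; linarith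
  have r1 := key hx.2.1 hx.2.2 hy.2.1 hy.2.2 hm hxy
  have r2 := key hy.2.1 hy.2.2 hz.2.1 hz.2.2 hk hyz
  have r3 := key hx.2.1 hx.2.2 hz.2.1 hz.2.2 hmk hxz
  omega

theorem UniformlySeparated.card_filter_le {δ : ℝ} (hδ : 0 < δ) {E : Finset ℝ}
    (hE : UniformlySeparated δ E) (u v : ℝ) :
    ((E.filter fun t => t ∈ Set.Icc u v).card : ℕ∞) ≤
      2 * intervalCoveringNumber ((E : Set ℝ) ∩ Set.Icc u v) δ := by
  classical
  unfold intervalCoveringNumber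
  rw [ENat.mul_iInf_of_ne (by norm_num)]
  refine le_iInf fun P => ?_
  rw [ENat.mul_iInf_of_ne (by norm_num)]
  refine le_iInf fun hP => ?_
  have hsub : (E.filter fun t => t ∈ Set.Icc u v) ⊆
      P.biUnion fun w => E.filter fun t => t ∈ Set.Icc w (w + δ) := by
    intro t ht
    rw [Finset.mem_filter] at ht
    have := hP ⟨ht.1, ht.2⟩
    simp only [Set.mem_iUnion] at this
    obtain ⟨w, hw, hw'⟩ := this
    exact Finset.mem_biUnion.2 ⟨w, hw, Finset.mem_filter.2 ⟨ht.1, hw'⟩⟩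
  have := (Finset.card_le_card hsub).trans
    (Finset.card_biUnion_le_card_mul P _ 2 fun w _ => hE.card_filter_Icc_le_two hδ w)
  rw [mul_comm] at this
  exact_mod_cast this

theorem intervalCoveringNumber_le_card {δ : ℝ} (hδ : 0 ≤ δ) (E : Finset ℝ) {S : Set ℝ}
    (hS : S ⊆ E) : intervalCoveringNumber S δ ≤ E.card := by
  refine iInf₂_le E fun t ht => ?_
  simp only [Set.mem_iUnion]
  exact ⟨t, hS ht, le_rfl, by linarith⟩

theorem assouadChar_ne_top {γ δ : ℝ} (hγ : 0 ≤ γ) (hδ : 0 < δ) (E : Finset ℝ) :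
    assouadChar γ (E : Set ℝ) δ ≠ ∞ := by
  refine ne_top_of_le_ne_top (b := (E.card : ℝ≥0∞)) (ENNReal.natCast_ne_top _) ?_
  refine iSup₂_le fun u v => iSup_le fun h => ?_
  have h1 : (δ / (v - u)) ^ γ ≤ 1 := by
    have : 0 < v - u := hδ.trans_le h.2.2
    exact Real.rpow_le_one (by positivity) ((div_le_one this).2 h.2.2) hγ
  have h2 : (intervalCoveringNumber ((E : Set ℝ) ∩ Set.Icc u v) δ : ℝ≥0∞) ≤ E.card := by
    have := intervalCoveringNumber_le_card hδ.le E
      (Set.inter_subset_left : (E : Set ℝ) ∩ Set.Icc u v ⊆ E)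
    exact_mod_cast ENat.toENNReal_le.2 this
  calc _ ≤ (1 : ℝ≥0∞) * E.card := mul_le_mul' (ENNReal.ofReal_le_one.2 h1) h2
    _ = _ := one_mul _

theorem UniformlySeparated.card_filter_le_assouadChar {γ δ : ℝ} (hγ : 0 ≤ γ) (hδ : 0 < δ)
    {E : Finset ℝ} (hE : UniformlySeparated δ E) {u v : ℝ} (hu : 1 ≤ u) (hv : v ≤ 2)
    (huv : δ ≤ v - u) :
    ((E.filter fun t => t ∈ Set.Icc u v).card : ℝ) ≤
      2 * (assouadChar γ (E : Set ℝ) δ).toReal * ((v - u) / δ) ^ γ := by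
  have hL : 0 < v - u := hδ.trans_le huv
  set m := (E.filter fun t => t ∈ Set.Icc u v).card with hm
  have h1 : (m : ℝ≥0∞) ≤
      2 * (intervalCoveringNumber ((E : Set ℝ) ∩ Set.Icc u v) δ : ℝ≥0∞) := by
    have := ENat.toENNReal_le.2 (hE.card_filter_le hδ u v)
    simpa [hm] using this
  have h2 : ENNReal.ofReal ((δ / (v - u)) ^ γ) *
      (intervalCoveringNumber ((E : Set ℝ) ∩ Set.Icc u v) δ : ℝ≥0∞) ≤
        assouadChar γ (E : Set ℝ) δ :=
    le_iSup₂_of_le u v (le_iSup_of_le (⟨hu, hv, huv⟩ : 1 ≤ u ∧ v ≤ 2 ∧ δ ≤ v - u) le_rfl)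
  have h3 : ENNReal.ofReal ((δ / (v - u)) ^ γ) * m ≤ 2 * assouadChar γ (E : Set ℝ) δ :=
    calc _ ≤ ENNReal.ofReal ((δ / (v - u)) ^ γ) *
          (2 * (intervalCoveringNumber ((E : Set ℝ) ∩ Set.Icc u v) δ : ℝ≥0∞)) := by gcongr
      _ = 2 * (ENNReal.ofReal ((δ / (v - u)) ^ γ) *
          (intervalCoveringNumber ((E : Set ℝ) ∩ Set.Icc u v) δ : ℝ≥0∞)) := by ring
      _ ≤ _ := by gcongr
  have h4 := ENNReal.toReal_mono
    (ENNReal.mul_ne_top (by norm_num) (assouadChar_ne_top hγ hδ E)) h3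
  rw [ENNReal.toReal_mul, ENNReal.toReal_mul, ENNReal.toReal_ofReal (by positivity),
    ENNReal.toReal_natCast, ENNReal.toReal_ofNat] at h4
  have h5 : (δ / (v - u)) ^ γ * ((v - u) / δ) ^ γ = 1 := by
    rw [← Real.mul_rpow (by positivity) (by positivity), div_mul_div_cancel₀ hL.ne',
      div_self hδ.ne', Real.one_rpow]
  calc (m : ℝ) = (δ / (v - u)) ^ γ * m * ((v - u) / δ) ^ γ := by linear_combination (-(m : ℝ)) * h5
    _ ≤ _ := by gcongr

/-- The Assouad characteristic only sees intervals inside [1, 2]. A window sticking out is pushed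
back in by clamping its left endpoint to [1, 2 - ℓ], which loses no points of E. -/
theorem UniformlySeparated.card_filter_window_le {γ δ : ℝ} (hγ : 0 ≤ γ) (hδ : 0 < δ)
    {E : Finset ℝ} (hE : UniformlySeparated δ E) (hE12 : (E : Set ℝ) ⊆ Set.Icc 1 2) {ℓ : ℝ}
    (hℓδ : δ ≤ ℓ) (hℓ1 : ℓ ≤ 1) (s : ℝ) :
    ((E.filter fun t => t ∈ Set.Icc s (s + ℓ)).card : ℝ) ≤
      2 * (assouadChar γ (E : Set ℝ) δ).toReal * (ℓ / δ) ^ γ := by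
  set u := max 1 (min s (2 - ℓ)) with hu
  have hu1 : 1 ≤ u := le_max_left _ _
  have hu2 : u ≤ 2 - ℓ := max_le (by linarith) (min_le_right _ _)
  have h := hE.card_filter_le_assouadChar hγ hδ (u := u) (v := u + ℓ) hu1 (by linarith)
    (by linarith)
  rw [add_sub_cancel_left] at h
  refine le_trans ?_ h
  have hsub : (E.filter fun t => t ∈ Set.Icc s (s + ℓ)) ⊆
      E.filter fun t => t ∈ Set.Icc u (u + ℓ) := by
    intro t ht
    rw [Finset.mem_filter, Set.mem_Icc] at ht ⊢
    have h12 := hE12 ht.1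
    refine ⟨ht.1, max_le h12.1 ((min_le_left _ _).trans ht.2.1), ?_⟩
    have : min s (2 - ℓ) ≤ u := le_max_right _ _
    rcases min_choice s (2 - ℓ) with h' | h' <;> rw [h'] at this
    · linarith [ht.2.2]
    · linarith [h12.2]
  exact_mod_cast Finset.card_le_card hsub

/-! ### Summation over the angular scales -/

/-- With θ = 2^{-l} the left side is θ^{-s} if r ≤ θ and θ^{2-s}r^{-2} otherwise; since 0 ≤ s ≤ 2,
both are largest at θ = r. So one angle costs no loss against the weight. -/
theorem rpow_mul_angleWeight_le {s r : ℝ} (hs0 : 0 ≤ s) (hs1 : s ≤ 1) (hr : 0 < r) (l : ℕ) :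
    ((2 : ℝ) ^ l) ^ s * angleWeight ((2 ^ l)⁻¹) r ≤ r ^ (-s) := by
  have hp : (0 : ℝ) < 2 ^ l := by positivity
  unfold angleWeight
  split_ifs with h
  · rw [mul_one, Real.rpow_neg hr.le, ← Real.inv_rpow hr.le]
    exact Real.rpow_le_rpow hp.le ((le_inv_comm₀ hr hp).1 h) hs0
  · have h1 : (2 ^ l : ℝ)⁻¹ ≤ r := (not_le.1 h).le
    have h2 : ((2 ^ l : ℝ)⁻¹) ^ (2 - s) ≤ r ^ (2 - s) :=
      Real.rpow_le_rpow (by positivity) h1 (by linarith)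
    have e1 : ((2 : ℝ) ^ l) ^ s * ((2 ^ l)⁻¹ ^ 2 / r ^ 2) =
        ((2 ^ l : ℝ)⁻¹) ^ (2 - s) * (r ^ 2)⁻¹ := by
      rw [Real.rpow_sub (by positivity), Real.inv_rpow hp.le s, Real.rpow_two]
      field_simp
    have e2 : r ^ (-s) = r ^ (2 - s) * (r ^ 2)⁻¹ := by
      rw [sub_eq_add_neg, Real.rpow_add hr, Real.rpow_two]
      field_simp
    rw [e1, e2]
    gcongr

/-- A growing geometric series cut off at the last near index, hence dominated by its last term. In
the induction, if index n is near the indicators are dropped; otherwise the new term is zero. -/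
theorem sum_near_le {s r : ℝ} (hs0 : 0 < s) (hr : 0 < r) (n : ℕ) :
    ∑ l ∈ Finset.range n, (if r ≤ (2 ^ l : ℝ)⁻¹ then ((2 : ℝ) ^ l) ^ s else 0) ≤
      2 ^ s / (2 ^ s - 1) * r ^ (-s) := by
  have hx : 1 < (2 : ℝ) ^ s := Real.one_lt_rpow (by norm_num) hs0
  have hx1 : 0 < (2 : ℝ) ^ s - 1 := by linarith
  have hpow : ∀ l : ℕ, ((2 : ℝ) ^ l) ^ s = ((2 : ℝ) ^ s) ^ l := fun l => by
    rw [← Real.rpow_natCast, ← Real.rpow_natCast, ← Real.rpow_mul (by norm_num),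
      ← Real.rpow_mul (by norm_num), mul_comm]
  induction n with
  | zero => simp; positivity
  | succ n ih =>
    by_cases h : r ≤ (2 ^ n : ℝ)⁻¹
    · calc _ ≤ ∑ l ∈ Finset.range (n + 1), ((2 : ℝ) ^ s) ^ l := by
            refine Finset.sum_le_sum fun l _ => ?_
            rw [hpow]
            split_ifs
            · exact le_rfl
            · positivity
        _ = (((2 : ℝ) ^ s) ^ (n + 1) - 1) / (2 ^ s - 1) := geom_sum_eq hx.ne' _
        _ ≤ 2 ^ s / (2 ^ s - 1) * ((2 : ℝ) ^ n) ^ s := by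
            rw [hpow, div_mul_eq_mul_div]
            gcongr
            rw [pow_succ]
            linarith
        _ ≤ _ := by
            gcongr
            rw [Real.rpow_neg hr.le, ← Real.inv_rpow hr.le]
            exact Real.rpow_le_rpow (by positivity) ((le_inv_comm₀ hr (by positivity)).1 h) hs0.le
    · rw [Finset.sum_range_succ, if_neg h, add_zero]
      exact ih

/-- A geometric series of ratio at most 1/2 whose far terms are all at most r^{2-s}. -/
theorem sum_far_le {s r : ℝ} (hs1 : s ≤ 1) (hr : 0 < r) (n : ℕ) :
    ∑ l ∈ Finset.range n, (if r ≤ (2 ^ l : ℝ)⁻¹ then 0 else ((2 : ℝ) ^ (s - 2)) ^ l) ≤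
      2 * r ^ (2 - s) := by
  set y : ℝ := 2 ^ (s - 2) with hy
  have hy0 : 0 < y := by positivity
  have hy1 : y ≤ 1 / 2 := by
    calc y ≤ (2 : ℝ) ^ (-1 : ℝ) := Real.rpow_le_rpow_of_exponent_le (by norm_num) (by linarith)
      _ = 1 / 2 := by rw [Real.rpow_neg_one]; norm_num
  have hR : 0 < r ^ (2 - s) := by positivity
  have hact : ∀ l : ℕ, ¬ r ≤ (2 ^ l : ℝ)⁻¹ → y ^ l ≤ r ^ (2 - s) := by
    intro l h
    have e : y ^ l = ((2 ^ l : ℝ)⁻¹) ^ (2 - s) := by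
      rw [hy, ← Real.rpow_natCast, ← Real.rpow_natCast, ← Real.rpow_neg (by norm_num),
        ← Real.rpow_mul (by norm_num), ← Real.rpow_mul (by norm_num)]
      congr 1
      ring
    rw [e]
    exact Real.rpow_le_rpow (by positivity) (not_le.1 h).le (by linarith)
  -- Either no far index has occurred yet, or the partial sum leaves room 2yⁿ for the tail. This
  -- form closes under induction because 2y^{n+1} ≤ yⁿ.
  have key : ∀ n : ℕ,
      ∑ l ∈ Finset.range n, (if r ≤ (2 ^ l : ℝ)⁻¹ then 0 else y ^ l) = 0 ∨
      ∑ l ∈ Finset.range n, (if r ≤ (2 ^ l : ℝ)⁻¹ then 0 else y ^ l) ≤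
        2 * r ^ (2 - s) - 2 * y ^ n := by
    intro n
    induction n with
    | zero => left; simp
    | succ n ih =>
      have hpow : 2 * y ^ (n + 1) ≤ y ^ n := by
        rw [pow_succ]
        have : 0 < y ^ n := by positivity
        nlinarith
      have hn : 0 < y ^ n := by positivity
      rw [Finset.sum_range_succ]
      split_ifs with h
      · rw [add_zero]
        rcases ih with ih | ih
        · exact Or.inl ih
        · right; linarith
      · right
        rcases ih with ih | ih
        · rw [ih]; linarith [hact n h]
        · linarith
  rcases key n with h | h
  · rw [h]; positivity
  · have : 0 < y ^ n := by positivity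
    linarith

theorem sum_angleWeight_le {s r : ℝ} (hs0 : 0 < s) (hs1 : s ≤ 1) (hr : 0 < r) (n : ℕ) :
    ∑ l ∈ Finset.range n, ((2 : ℝ) ^ l) ^ s * angleWeight ((2 ^ l)⁻¹) r ≤
      6 / s * r ^ (-s) := by
  have e : ∀ l : ℕ, ((2 : ℝ) ^ l) ^ s * angleWeight ((2 ^ l)⁻¹) r =
      (if r ≤ (2 ^ l : ℝ)⁻¹ then ((2 : ℝ) ^ l) ^ s else 0) +
      (r ^ 2)⁻¹ * (if r ≤ (2 ^ l : ℝ)⁻¹ then 0 else ((2 : ℝ) ^ (s - 2)) ^ l) := by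
    intro l
    unfold angleWeight
    split_ifs with h
    · ring
    · have : ((2 : ℝ) ^ (s - 2)) ^ l = ((2 : ℝ) ^ l) ^ s * ((2 ^ l)⁻¹ ^ 2) := by
        rw [← Real.rpow_natCast, ← Real.rpow_mul (by norm_num), mul_comm, Real.rpow_mul (by norm_num),
          Real.rpow_natCast, Real.rpow_sub (by positivity), Real.rpow_two]
        field_simp
      rw [this]
      ring
  simp only [e]
  rw [Finset.sum_add_distrib, ← Finset.mul_sum]
  have h1 := sum_near_le hs0 hr n
  have h2 := sum_far_le hs1 hr n
  -- Since log 2 > 1/2. This turns the ratio of the near series into 4/s, the source of the factor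
  -- 1/(2γ - 1).
  have hlog : s / 2 ≤ (2 : ℝ) ^ s - 1 := by
    have a := Real.add_one_le_exp (Real.log 2 * s)
    rw [← Real.rpow_def_of_pos (by norm_num)] at a
    have b := Real.log_two_gt_d9
    nlinarith
  have hx2 : (2 : ℝ) ^ s ≤ 2 := by
    simpa using Real.rpow_le_rpow_of_exponent_le (x := (2 : ℝ)) (by norm_num) hs1
  have h3 : (2 : ℝ) ^ s / (2 ^ s - 1) ≤ 4 / s := by
    rw [div_le_div_iff₀ (by linarith) hs0]
    nlinarith
  have h4 : (r ^ 2)⁻¹ * (2 * r ^ (2 - s)) = 2 * r ^ (-s) := by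
    rw [sub_eq_add_neg, Real.rpow_add hr, Real.rpow_two]
    field_simp
  have h5 : 0 < r ^ (-s) := by positivity
  have h6 : 2 ≤ 2 / s := by rw [le_div_iff₀ hs0]; linarith
  calc _ ≤ 4 / s * r ^ (-s) + 2 * r ^ (-s) := by
        rw [← h4]
        gcongr
        exact h1.trans (by gcongr)
    _ ≤ 4 / s * r ^ (-s) + 2 / s * r ^ (-s) := by gcongr
    _ = _ := by ring

/-- The loss in summing over the angular scales. -/
theorem succ_mul_sum_angleWeight_le {γ r : ℝ} (hγ0 : 1 / 2 ≤ γ) (hγ1 : γ ≤ 1) (hr : 0 < r) {j : ℕ}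
    (hj : 1 ≤ j) :
    ((j / 2 + 1 : ℕ) : ℝ) * ∑ l ∈ Finset.range (j / 2 + 1),
        ((2 : ℝ) ^ l) ^ (2 * γ - 1) * angleWeight ((2 ^ l)⁻¹) r ≤
      6 * lossFactor γ j ^ 2 * r ^ (-(2 * γ - 1)) := by
  set s := 2 * γ - 1 with hs
  have hs1 : s ≤ 1 := by linarith
  have hs0 : 0 ≤ s := by linarith
  have hnj : ((j / 2 + 1 : ℕ) : ℝ) ≤ j := by exact_mod_cast (by omega : j / 2 + 1 ≤ j)
  set m := j / 2 + 1
  have hR : 0 < r ^ (-s) := by positivity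
  have hj1 : (1 : ℝ) ≤ j := by exact_mod_cast hj
  have hA : ∑ l ∈ Finset.range m, ((2 : ℝ) ^ l) ^ s * angleWeight ((2 ^ l)⁻¹) r ≤
      j * r ^ (-s) := by
    calc _ ≤ ∑ l ∈ Finset.range m, r ^ (-s) :=
          Finset.sum_le_sum fun l _ => rpow_mul_angleWeight_le hs0 hs1 hr l
      _ = m * r ^ (-s) := by rw [Finset.sum_const, Finset.card_range, nsmul_eq_mul]
      _ ≤ _ := by gcongr
  have hA' : (m : ℝ) * ∑ l ∈ Finset.range m, ((2 : ℝ) ^ l) ^ s * angleWeight ((2 ^ l)⁻¹) r ≤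
      6 * (j : ℝ) ^ 2 * r ^ (-s) := by
    calc _ ≤ (m : ℝ) * (j * r ^ (-s)) := by gcongr
      _ ≤ j * (j * r ^ (-s)) := by gcongr
      _ ≤ _ := by nlinarith [mul_pos (pow_pos (by linarith : (0 : ℝ) < j) 2) hR]
  unfold lossFactor
  split_ifs with h
  · exact hA'
  · have hs' : 0 < s := lt_of_le_of_ne hs0 fun h0 => h (by linarith)
    rcases min_choice (Real.sqrt j / s) (j : ℝ) with h' | h' <;> rw [h']
    · have hB := sum_angleWeight_le hs' hs1 hr m
      calc _ ≤ (m : ℝ) * (6 / s * r ^ (-s)) := by gcongr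
        _ ≤ (j : ℝ) * (6 / s * r ^ (-s)) := by gcongr
        -- Only j/s is needed at this point; s ≤ 1 is spent to reach the square of the stated loss
        -- √j/s.
        _ ≤ (j : ℝ) * (6 / s ^ 2 * r ^ (-s)) := by
            gcongr
            nlinarith
        _ = _ := by
            rw [div_pow, Real.sq_sqrt (by positivity)]
            ring
    · exact hA'

end BilinearWave

/-! ### The weighted space-time estimate for integrable functions -/

namespace BilinearWave

theorem ae_norm_sub_pos : ∀ᵐ q : Plane × Plane, 0 < ‖q.1 - q.2‖ := by
  have hc : Continuous fun q : Plane × Plane => ‖q.1 - q.2‖ := by fun_prop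
  have hm : MeasurableSet {q : Plane × Plane | ¬ 0 < ‖q.1 - q.2‖} :=
    (isOpen_lt continuous_const hc).isClosed_compl.measurableSet
  rw [ae_iff]
  refine (Measure.measure_prod_null hm).2 (Filter.Eventually.of_forall fun y => ?_)
  have : Prod.mk y ⁻¹' {q : Plane × Plane | ¬ 0 < ‖q.1 - q.2‖} = {y} := by
    ext z
    simp [sub_eq_zero, eq_comm]
  simp only [this, measure_singleton, Pi.zero_apply]

theorem measurable_weight (γ : ℝ) : Measurable fun p : Plane × Plane =>
    ENNReal.ofReal (‖p.1 - p.2‖ ^ (-(2 * γ - 1))) := by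
  have hc : Continuous fun q : Plane × Plane => ‖q.1 - q.2‖ := by fun_prop
  exact ENNReal.measurable_ofReal.comp (hc.measurable.pow_const _)

theorem lintegral_weightedMeasure (γ : ℝ) {F : Plane × Plane → ℂ}
    (hF : AEStronglyMeasurable F) :
    ∫⁻ q, ‖F q‖ₑ ^ 2 ∂(weightedMeasure γ) =
      ∫⁻ q, ENNReal.ofReal (‖q.1 - q.2‖ ^ (-(2 * γ - 1))) * ‖F q‖ₑ ^ 2 := by
  rw [weightedMeasure, lintegral_withDensity_eq_lintegral_mul₀ (measurable_weight γ).aemeasurable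
    (hF.enorm.pow_const 2)]
  rfl

theorem measurable_angleWeight (θ : ℝ) : Measurable fun q : Plane × Plane =>
    ENNReal.ofReal (angleWeight θ ‖q.1 - q.2‖) := by
  have hc : Continuous fun q : Plane × Plane => ‖q.1 - q.2‖ := by fun_prop
  refine ENNReal.measurable_ofReal.comp ?_
  unfold angleWeight
  exact Measurable.ite (isClosed_le hc continuous_const).measurableSet measurable_const
    (measurable_const.div (hc.measurable.pow_const 2))

theorem angleWeight_nonneg (θ r : ℝ) : 0 ≤ angleWeight θ r := by
  unfold angleWeight
  split_ifs <;> positivity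

/-- `bilinearOp` is an oscillatory integral with integrable symbol. -/
theorem exists_bilinearOp_eq_freqOp {χ : Plane → ℝ} (hχ : IsDyadicCutoff χ) {a : Plane → ℂ}
    (ha : ContDiff ℝ 20 a) (hcone : ConeSupported a) (σ : ℝ) (j : ℕ) {t : ℝ} (ht : 0 < t) :
    ∃ M : Plane × Plane → ℂ, Integrable M ∧ ∀ F : Plane × Plane → ℂ, Integrable F →
      ∀ x, bilinearOp χ a σ j F x t = freqOp M F x := by
  obtain ⟨φ, C, hC0, h1, h2, h3, h4, h5⟩ := exists_bump
  -- With n = 0 the angular decomposition consists of a single piece at θ = 1, which already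
  -- represents the whole operator.
  have hρ := fun l => isAngularCutoff_angleCutoff hC0 h1 h2 h3 h4 h5 0 l
  have hM : ∀ l, Integrable fun p =>
      pairExp σ t p * pairSymbol χ a j ((2 ^ l)⁻¹) (angleCutoff φ 0 l) t p := fun l =>
    (contDiff_fullSymbol hχ ha hcone (by positivity) (hρ l) σ
      ht).continuous.integrable_of_hasCompactSupport
      (hasCompactSupport_fullSymbol hχ hcone (by positivity) (hρ l) σ ht)
  refine ⟨_, hM 0, fun F hF x => ?_⟩
  rw [bilinearOp_eq_sum_freqOp hχ hcone j h3 0 σ ht hF hM x]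
  simp

/-- The space-time estimate in weighted form. -/
theorem exists_sum_lintegral_bilinearOp_le {χ : Plane → ℝ} (hχ : IsDyadicCutoff χ) :
    ∃ K : ℝ, 0 < K ∧ ∀ {γ : ℝ}, 1 / 2 ≤ γ → γ ≤ 1 → ∀ {a : Plane → ℂ}, ContDiff ℝ 20 a →
      symbolNorm 0 a ≤ 1 → ConeSupported a → ∀ {σ : ℝ}, (σ = 1 ∨ σ = -1) → ∀ {j : ℕ}, 1 ≤ j →
      ∀ {E : Finset ℝ}, (E : Set ℝ) ⊆ Set.Icc 1 2 →
      UniformlySeparated ((2 : ℝ) ^ (-(j : ℤ))) E →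
      ∀ {F : Plane × Plane → ℂ}, Integrable F → MemLp F 2 (weightedMeasure γ) →
      ∑ t ∈ E, ∫⁻ x, ‖bilinearOp χ a σ j F x t‖ₑ ^ 2 ≤
        ENNReal.ofReal (K * lossFactor γ j ^ 2 * (2 ^ j) ^ 2 *
          (assouadChar γ (E : Set ℝ) ((2 : ℝ) ^ (-(j : ℤ)))).toReal) *
          ∫⁻ q, ‖F q‖ₑ ^ 2 ∂(weightedMeasure γ) := by
  obtain ⟨C₁, hC₁0, hC₁⟩ := hχ.exists_fderiv_bound
  obtain ⟨φ, C, hC0, h1, h2, h3, h4, h5⟩ := exists_bump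
  set K₀ := pieceConst (2176 + 16 * C₁ + 32 * (3 * C)) with hK₀
  have hK₀pos : 0 < K₀ := pieceConst_pos _
  refine ⟨12 * K₀, by positivity, ?_⟩
  intro γ hγ0 hγ1 a ha hnorm hcone σ hσ j hj E hE hsep F hF1 hF2
  set s := 2 * γ - 1 with hs
  have hs1 : s ≤ 1 := by linarith
  have hs0 : 0 ≤ s := by linarith
  -- The floor keeps θ²2^j ≥ 1 at every scale, and θ²2^j is 1 or 2 at the last one.
  set n := j / 2 with hn
  have hN : (0 : ℝ) < 2 ^ j := by positivity
  have hδ : (0 : ℝ) < 2 ^ (-(j : ℤ)) := by positivity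
  have hδN : (2 : ℝ) ^ (-(j : ℤ)) = (2 ^ j)⁻¹ := by rw [zpow_neg, zpow_natCast]
  set X := (assouadChar γ (E : Set ℝ) ((2 : ℝ) ^ (-(j : ℤ)))).toReal with hX
  have hX0 : 0 ≤ X := ENNReal.toReal_nonneg
  have hρ := fun l => isAngularCutoff_angleCutoff hC0 h1 h2 h3 h4 h5 n l
  set M : ℕ → ℝ → Plane × Plane → ℂ := fun l t p =>
    pairExp σ t p * pairSymbol χ a j ((2 ^ l)⁻¹) (angleCutoff φ n l) t p with hM
  have htpos : ∀ t ∈ E, 0 < t := fun t ht => by linarith [(hE ht).1]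
  have hMi : ∀ t ∈ E, ∀ l, Integrable (M l t) := fun t ht l =>
    (contDiff_fullSymbol hχ ha hcone (by positivity) (hρ l) σ
      (htpos t ht)).continuous.integrable_of_hasCompactSupport
      (hasCompactSupport_fullSymbol hχ hcone (by positivity) (hρ l) σ (htpos t ht))
  set W := ∫⁻ q : Plane × Plane, ENNReal.ofReal (‖q.1 - q.2‖ ^ (-s)) * ‖F q‖ₑ ^ 2 with hW
  have hWeq : ∫⁻ q, ‖F q‖ₑ ^ 2 ∂(weightedMeasure γ) = W := lintegral_weightedMeasure γ hF1.1
  have hWfin : W < ∞ := by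
    rw [← hWeq, ← eLpNorm_two_sq]
    exact ENNReal.pow_lt_top hF2.2
  have hfin : ∀ l : ℕ, ∫⁻ q : Plane × Plane,
      ENNReal.ofReal (angleWeight ((2 ^ l)⁻¹) ‖q.1 - q.2‖) * ‖F q‖ₑ ^ 2 < ∞ := by
    intro l
    refine lt_of_le_of_lt (lintegral_mono_ae ?_) hWfin
    filter_upwards [ae_norm_sub_pos] with q hq
    gcongr
    refine le_trans ?_ (rpow_mul_angleWeight_le hs0 hs1 hq l)
    have : 1 ≤ ((2 : ℝ) ^ l) ^ s := Real.one_le_rpow (one_le_pow₀ (by norm_num)) hs0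
    exact le_mul_of_one_le_left (angleWeight_nonneg _ _) this
  have hpiece : ∀ l ∈ Finset.range (n + 1), ∑ t ∈ E, ∫⁻ x, ‖freqOp (M l t) F x‖ₑ ^ 2 ≤
      ENNReal.ofReal (2 * K₀ * X * (2 ^ j) ^ 2) * ∫⁻ q : Plane × Plane,
        ENNReal.ofReal (((2 : ℝ) ^ l) ^ s * angleWeight ((2 ^ l)⁻¹) ‖q.1 - q.2‖) *
          ‖F q‖ₑ ^ 2 := by
    intro l hl
    have hln : l ≤ n := Nat.lt_succ_iff.1 (Finset.mem_range.1 hl)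
    have hp : (0 : ℝ) < 2 ^ l := by positivity
    have hp1 : (1 : ℝ) ≤ 2 ^ l := one_le_pow₀ (by norm_num)
    have hlN : ((2 : ℝ) ^ l) ^ 2 ≤ 2 ^ j := by
      rw [← pow_mul]
      exact pow_le_pow_right₀ (by norm_num) (by omega)
    set ℓ : ℝ := (2 ^ l) ^ 2 / 2 ^ j with hℓ
    have hℓ1 : ℓ ≤ 1 := (div_le_one hN).2 hlN
    have hℓδ : (2 : ℝ) ^ (-(j : ℤ)) ≤ ℓ := by
      rw [hδN, hℓ, ← one_div]
      gcongr
      exact one_le_pow₀ hp1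
    have hratio : ℓ / (2 : ℝ) ^ (-(j : ℤ)) = (2 ^ l) ^ 2 := by
      rw [hδN, hℓ]
      field_simp
    -- The Assouad bound at window length ℓ, since ℓ/δ = 2^{2l}. Multiplied by θ = 2^{-l} it becomes
    -- 2X·2^{ls}, which explains the weight exponent s = 2γ - 1.
    set Q : ℝ := 2 * X * ((2 ^ l) ^ 2) ^ γ with hQ
    have hQw : ∀ u : ℝ, ((E.filter fun t => t ∈ Set.Icc u (u + ℓ)).card : ℝ) ≤ Q := by
      intro u
      have := hsep.card_filter_window_le (γ := γ) (by linarith) hδ hE hℓδ hℓ1 u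
      rwa [hratio] at this
    -- At l = n one has ℓ ≥ 1/2, so two windows, one at each end of [1, 2], contain all of E.
    have hb : l < n ∨ (E.card : ℝ) ≤ 2 * Q := by
      rcases hln.lt_or_eq with h | h
      · exact Or.inl h
      · right
        have hhalf : 1 / 2 ≤ ℓ := by
          rw [hℓ, div_le_div_iff₀ (by norm_num) hN, one_mul, ← pow_mul, ← pow_succ]
          exact pow_le_pow_right₀ (by norm_num) (by omega)
        have hcov : E ⊆ (E.filter fun t => t ∈ Set.Icc 1 (1 + ℓ)) ∪
            (E.filter fun t => t ∈ Set.Icc (2 - ℓ) (2 - ℓ + ℓ)) := by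
          intro t ht
          have h12 := hE ht
          simp only [Finset.mem_union, Finset.mem_filter, Set.mem_Icc]
          rcases le_total t (3 / 2) with h' | h'
          · exact Or.inl ⟨ht, h12.1, by linarith⟩
          · exact Or.inr ⟨ht, by linarith, by linarith [h12.2]⟩
        have hcard : (E.card : ℝ) ≤ (E.filter fun t => t ∈ Set.Icc 1 (1 + ℓ)).card +
            (E.filter fun t => t ∈ Set.Icc (2 - ℓ) (2 - ℓ + ℓ)).card := by
          exact_mod_cast (Finset.card_le_card hcov).trans (Finset.card_union_le _ _)
        linarith [hQw 1, hQw (2 - ℓ)]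
    have hθN : 1 ≤ ((2 ^ l : ℝ)⁻¹) ^ 2 * 2 ^ j := by
      rw [inv_pow, inv_mul_eq_div, one_le_div (by positivity)]
      exact hlN
    have hmain := sum_lintegral_piece_le hχ ha hnorm hcone (inv_pos.2 hp) (inv_le_one_of_one_le₀ hp1)
      hθN (hρ l) hC₁0 hC₁ hσ hE (ℓ := ℓ) (Q := Q)
      (by rw [hℓ]; field_simp) hQw hb hF1 (hfin l)
    refine hmain.trans (le_of_eq ?_)
    have e1 : ∀ q : Plane × Plane,
        ENNReal.ofReal (((2 : ℝ) ^ l) ^ s * angleWeight ((2 ^ l)⁻¹) ‖q.1 - q.2‖) * ‖F q‖ₑ ^ 2 =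
        ENNReal.ofReal (((2 : ℝ) ^ l) ^ s) *
          (ENNReal.ofReal (angleWeight ((2 ^ l)⁻¹) ‖q.1 - q.2‖) * ‖F q‖ₑ ^ 2) := by
      intro q
      rw [ENNReal.ofReal_mul (by positivity), mul_assoc]
    simp only [e1]
    rw [lintegral_const_mul' _ _ ENNReal.ofReal_ne_top,
      ← mul_assoc (ENNReal.ofReal (2 * K₀ * X * (2 ^ j) ^ 2)),
      ← ENNReal.ofReal_mul (by positivity)]
    congr 2
    have e2 : (((2 : ℝ) ^ l) ^ 2) ^ γ = (2 ^ l) ^ s * 2 ^ l := by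
      rw [← Real.rpow_natCast (2 ^ l) 2, ← Real.rpow_mul hp.le, hs]
      nth_rewrite 3 [← Real.rpow_one ((2 : ℝ) ^ l)]
      rw [← Real.rpow_add hp]
      congr 1
      push_cast
      ring
    rw [hQ, e2, ← hK₀]
    field_simp
  -- Cauchy–Schwarz over the n + 1 angles; no orthogonality between different angles is used.
  have hpt : ∀ t ∈ E, ∀ x, ‖bilinearOp χ a σ j F x t‖ₑ ^ 2 ≤
      ((n + 1 : ℕ) : ℝ≥0∞) * ∑ l ∈ Finset.range (n + 1), ‖freqOp (M l t) F x‖ₑ ^ 2 := by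
    intro t ht x
    rw [bilinearOp_eq_sum_freqOp hχ hcone j h3 n σ (htpos t ht) hF1 (hMi t ht) x]
    exact (enorm_sum_sq_le _ _).trans (by rw [Finset.card_range])
  have hmeas : ∀ l ∈ Finset.range (n + 1), Measurable fun q : Plane × Plane =>
      ENNReal.ofReal (((2 : ℝ) ^ l) ^ s * angleWeight ((2 ^ l)⁻¹) ‖q.1 - q.2‖) := by
    intro l _
    simp_rw [fun q : Plane × Plane => ENNReal.ofReal_mul
      (q := angleWeight ((2 ^ l)⁻¹) ‖q.1 - q.2‖) (by positivity : 0 ≤ ((2 : ℝ) ^ l) ^ s)]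
    exact (measurable_angleWeight _).const_mul _
  rw [hWeq]
  calc _ ≤ ∑ t ∈ E, ∫⁻ x,
        ((n + 1 : ℕ) : ℝ≥0∞) * ∑ l ∈ Finset.range (n + 1), ‖freqOp (M l t) F x‖ₑ ^ 2 :=
        Finset.sum_le_sum fun t ht => lintegral_mono (hpt t ht)
    _ = ((n + 1 : ℕ) : ℝ≥0∞) *
          ∑ l ∈ Finset.range (n + 1), ∑ t ∈ E, ∫⁻ x, ‖freqOp (M l t) F x‖ₑ ^ 2 := by
        rw [Finset.sum_comm, Finset.mul_sum]
        refine Finset.sum_congr rfl fun t ht => ?_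
        rw [lintegral_const_mul' _ _ (ENNReal.natCast_ne_top _), lintegral_finsetSum]
        exact fun l _ => (continuous_freqOp (hMi t ht l) hF1).measurable.enorm.pow_const 2
    _ ≤ ((n + 1 : ℕ) : ℝ≥0∞) * ∑ l ∈ Finset.range (n + 1),
          ENNReal.ofReal (2 * K₀ * X * (2 ^ j) ^ 2) * ∫⁻ q : Plane × Plane,
          ENNReal.ofReal (((2 : ℝ) ^ l) ^ s * angleWeight ((2 ^ l)⁻¹) ‖q.1 - q.2‖) *
            ‖F q‖ₑ ^ 2 := by
        gcongr with l hl
        exact hpiece l hl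
    _ = ENNReal.ofReal (2 * K₀ * X * (2 ^ j) ^ 2) * ∫⁻ q : Plane × Plane,
          ENNReal.ofReal (((n + 1 : ℕ) : ℝ) * ∑ l ∈ Finset.range (n + 1),
            ((2 : ℝ) ^ l) ^ s * angleWeight ((2 ^ l)⁻¹) ‖q.1 - q.2‖) * ‖F q‖ₑ ^ 2 := by
        have hm : ∀ l ∈ Finset.range (n + 1), AEMeasurable (fun q : Plane × Plane =>
            ENNReal.ofReal (((2 : ℝ) ^ l) ^ s * angleWeight ((2 ^ l)⁻¹) ‖q.1 - q.2‖) *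
              ‖F q‖ₑ ^ 2) := fun l hl =>
          (hmeas l hl).aemeasurable.mul (hF1.1.enorm.pow_const 2)
        rw [← Finset.mul_sum, ← lintegral_finsetSum' _ hm, mul_left_comm,
          ← lintegral_const_mul' _ _ (ENNReal.natCast_ne_top _)]
        congr 2
        funext q
        rw [← Finset.sum_mul, ENNReal.ofReal_mul (by positivity), ENNReal.ofReal_natCast,
          ENNReal.ofReal_sum_of_nonneg fun l _ =>
            mul_nonneg (by positivity) (angleWeight_nonneg _ _), mul_assoc]
    _ ≤ ENNReal.ofReal (2 * K₀ * X * (2 ^ j) ^ 2) * ∫⁻ q : Plane × Plane,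
          ENNReal.ofReal (6 * lossFactor γ j ^ 2) *
            (ENNReal.ofReal (‖q.1 - q.2‖ ^ (-s)) * ‖F q‖ₑ ^ 2) := by
        refine mul_le_mul' le_rfl (lintegral_mono_ae ?_)
        filter_upwards [ae_norm_sub_pos] with q hq
        rw [← mul_assoc, ← ENNReal.ofReal_mul (by positivity)]
        refine mul_le_mul' (ENNReal.ofReal_le_ofReal ?_) le_rfl
        exact succ_mul_sum_angleWeight_le hγ0 hγ1 hq hj
    _ = _ := by
        rw [lintegral_const_mul' _ _ ENNReal.ofReal_ne_top, ← mul_assoc,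
          ← ENNReal.ofReal_mul (by positivity)]
        congr 2
        ring

end BilinearWave

/-! ### Density of the integrable functions in the weighted space -/

namespace BilinearWave

/-- The weight is positive off the diagonal, a null set. Hence an identity almost everywhere for the
weighted measure holds almost everywhere for Lebesgue measure, and the integral formula is well
defined on weighted classes. -/
theorem absolutelyContinuous_weightedMeasure (γ : ℝ) :
    (volume : Measure (Plane × Plane)) ≪ weightedMeasure γ := by
  refine withDensity_absolutelyContinuous' (measurable_weight γ).aemeasurable ?_
  filter_upwards [ae_norm_sub_pos] with q hq
  have := Real.rpow_pos_of_pos hq (-(2 * γ - 1))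
  simpa using this

theorem fourierPair_congr {F G : Plane × Plane → ℂ} (h : F =ᵐ[volume] G) (p : Plane × Plane) :
    fourierPair F p = fourierPair G p := by
  refine integral_congr_ae ?_
  filter_upwards [h] with q hq
  rw [hq]

theorem bilinearOp_congr (χ : Plane → ℝ) (a : Plane → ℂ) (σ : ℝ) (j : ℕ)
    {F G : Plane × Plane → ℂ} (h : F =ᵐ[volume] G) (x : Plane) (t : ℝ) :
    bilinearOp χ a σ j F x t = bilinearOp χ a σ j G x t := by
  simp only [bilinearOp, fourierPair_congr h]

theorem continuous_bilinearOp {χ : Plane → ℝ} (hχ : IsDyadicCutoff χ) {a : Plane → ℂ}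
    (ha : ContDiff ℝ 20 a) (hcone : ConeSupported a) (σ : ℝ) (j : ℕ) {t : ℝ} (ht : 0 < t)
    {F : Plane × Plane → ℂ} (hF : Integrable F) :
    Continuous fun x => bilinearOp χ a σ j F x t := by
  obtain ⟨M, hM, h⟩ := exists_bilinearOp_eq_freqOp hχ ha hcone σ j ht
  simp only [h F hF]
  exact continuous_freqOp hM hF

theorem bilinearOp_add {χ : Plane → ℝ} (hχ : IsDyadicCutoff χ) {a : Plane → ℂ}
    (ha : ContDiff ℝ 20 a) (hcone : ConeSupported a) (σ : ℝ) (j : ℕ) {t : ℝ} (ht : 0 < t)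
    {F G : Plane × Plane → ℂ} (hF : Integrable F) (hG : Integrable G)
    (x : Plane) : bilinearOp χ a σ j (fun q => F q + G q) x t =
      bilinearOp χ a σ j F x t + bilinearOp χ a σ j G x t := by
  obtain ⟨M, hM, h⟩ := exists_bilinearOp_eq_freqOp hχ ha hcone σ j ht
  rw [h F hF, h G hG, h (fun q => F q + G q) (hF.add hG)]
  exact freqOp_add hM hF hG x

theorem bilinearOp_const_mul (χ : Plane → ℝ) (a : Plane → ℂ) (σ : ℝ) (j : ℕ)
    (F : Plane × Plane → ℂ) (z : ℂ) (x : Plane) (t : ℝ) :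
    bilinearOp χ a σ j (fun q => z * F q) x t = z * bilinearOp χ a σ j F x t := by
  simp only [bilinearOp, fourierPair_const_mul]
  rw [← integral_const_mul]
  refine integral_congr_ae (Filter.Eventually.of_forall fun p => ?_)
  simp only
  ring

/-- The classes in the weighted space that are integrable for Lebesgue measure. -/
noncomputable def integrableSubmodule (γ : ℝ) : Submodule ℂ (Lp ℂ 2 (weightedMeasure γ)) where
  carrier := {f | Integrable (f : Plane × Plane → ℂ) volume}
  zero_mem' := by
    have h := (absolutelyContinuous_weightedMeasure γ).ae_eq
      (Lp.coeFn_zero ℂ 2 (weightedMeasure γ))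
    exact (integrable_zero _ _ _).congr h.symm
  add_mem' {f g} hf hg := by
    have h := (absolutelyContinuous_weightedMeasure γ).ae_eq (Lp.coeFn_add f g)
    exact (Integrable.add hf hg).congr h.symm
  smul_mem' c f hf := by
    have h := (absolutelyContinuous_weightedMeasure γ).ae_eq (Lp.coeFn_smul c f)
    exact (Integrable.smul c hf).congr h.symm

/-- On a ball |y - z| is bounded, so the decreasing weight is bounded below, f is square integrable
for Lebesgue measure there, and the ball has finite volume. The +1 in D only keeps D positive. -/
theorem integrable_indicator_closedBall {γ : ℝ} (hγ : 1 / 2 ≤ γ) {f : Plane × Plane → ℂ}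
    (hf : MemLp f 2 (weightedMeasure γ)) (R : ℝ) :
    Integrable ((Metric.closedBall (0 : Plane × Plane) R).indicator f) := by
  set B := Metric.closedBall (0 : Plane × Plane) R with hB
  have hBm : MeasurableSet B := Metric.isClosed_closedBall.measurableSet
  rw [integrable_indicator_iff hBm]
  have hfm : AEStronglyMeasurable f volume :=
    hf.1.mono_ac (absolutelyContinuous_weightedMeasure γ)
  have hfin : IsFiniteMeasure (volume.restrict B) :=
    ⟨by rw [Measure.restrict_apply_univ]; exact measure_closedBall_lt_top⟩
  set D : ℝ := 2 * |R| + 1 with hD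
  have hD0 : 0 < D := by positivity
  set s := 2 * γ - 1 with hs
  have hs0 : 0 ≤ s := by linarith
  have hc : 0 < D ^ (-s) := Real.rpow_pos_of_pos hD0 _
  have h2 : MemLp f 2 (volume.restrict B) := by
    refine memLp_two_of_lintegral hfm.restrict ?_
    have h3 : ENNReal.ofReal (D ^ (-s)) * ∫⁻ q in B, ‖f q‖ₑ ^ 2 ≤
        ∫⁻ q, ‖f q‖ₑ ^ 2 ∂(weightedMeasure γ) := by
      rw [lintegral_weightedMeasure γ hfm, ← lintegral_const_mul' _ _ ENNReal.ofReal_ne_top]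
      refine le_trans ?_ (setLIntegral_le_lintegral B _)
      refine lintegral_mono_ae ?_
      filter_upwards [ae_restrict_mem hBm, ae_restrict_of_ae ae_norm_sub_pos] with q hq hq0
      gcongr ENNReal.ofReal ?_ * _
      have hqn : ‖q‖ ≤ |R| := (mem_closedBall_zero_iff.1 hq).trans (le_abs_self R)
      have hqD : ‖q.1 - q.2‖ ≤ D := by
        have := norm_sub_le q.1 q.2
        have := norm_fst_le q
        have := norm_snd_le q
        linarith
      exact Real.rpow_le_rpow_of_nonpos hq0 hqD (by linarith)
    have h4 : ∫⁻ q, ‖f q‖ₑ ^ 2 ∂(weightedMeasure γ) < ∞ := by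
      rw [← eLpNorm_two_sq]
      exact ENNReal.pow_lt_top hf.2
    by_contra h
    rw [not_lt, top_le_iff] at h
    rw [h, ENNReal.mul_top (by simpa using hc)] at h3
    exact absurd h4 (not_lt.2 h3)
  exact h2.integrable (by norm_num)

/-- An element g orthogonal to the subspace is orthogonal to its own truncations f to balls. Since
⟨f, g⟩ = ⟨f, f⟩, every truncation vanishes, hence g does. -/
theorem integrableSubmodule_dense {γ : ℝ} (hγ : 1 / 2 ≤ γ) :
    (integrableSubmodule γ).topologicalClosure = ⊤ := by
  rw [Submodule.topologicalClosure_eq_top_iff, Submodule.eq_bot_iff]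
  intro g hg
  set B : ℕ → Set (Plane × Plane) := fun n => Metric.closedBall 0 n with hB
  have hBm : ∀ n, MeasurableSet (B n) := fun n => Metric.isClosed_closedBall.measurableSet
  have hgm : MemLp g 2 (weightedMeasure γ) := Lp.memLp g
  have hzero : ∀ n, (B n).indicator g =ᵐ[weightedMeasure γ] 0 := by
    intro n
    have hi : MemLp ((B n).indicator g) 2 (weightedMeasure γ) := hgm.indicator (hBm n)
    set f := hi.toLp _ with hf
    have hfe : f =ᵐ[weightedMeasure γ] (B n).indicator g := hi.coeFn_toLp
    have hfS : f ∈ integrableSubmodule γ :=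
      (integrable_indicator_closedBall hγ hgm n).congr
        ((absolutelyContinuous_weightedMeasure γ).ae_eq hfe).symm
    have h0 : inner ℂ f g = 0 := hg f hfS
    have h1 : inner ℂ f f = inner ℂ f g := by
      rw [L2.inner_def, L2.inner_def]
      refine integral_congr_ae ?_
      filter_upwards [hfe] with q hq
      rw [hq]
      by_cases hqB : q ∈ B n
      · rw [Set.indicator_of_mem hqB]
      · rw [Set.indicator_of_notMem hqB, inner_zero_left, inner_zero_left]
    rw [h0, inner_self_eq_zero] at h1
    have h2 := Lp.coeFn_zero ℂ 2 (weightedMeasure γ)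
    rw [← h1] at h2
    exact hfe.symm.trans h2
  refine (Lp.eq_zero_iff_ae_eq_zero (f := g)).2 ?_
  filter_upwards [ae_all_iff.2 hzero] with q hq
  obtain ⟨n, hn⟩ := exists_nat_ge ‖q‖
  have hqB : q ∈ B n := mem_closedBall_zero_iff.2 hn
  have := hq n
  rwa [Set.indicator_of_mem hqB] at this

theorem denseRange_integrableSubmodule {γ : ℝ} (hγ : 1 / 2 ≤ γ) :
    DenseRange (integrableSubmodule γ).subtype := by
  have h := integrableSubmodule_dense hγ
  rw [← Submodule.dense_iff_topologicalClosure_eq_top] at h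
  simpa [DenseRange] using h

theorem measurable_plane_prod {E : Finset ℝ} {f : Plane × E → ℂ}
    (hf : ∀ t : E, Continuous fun x => f (x, t)) : Measurable f :=
  measurable_from_prod_countable_left fun t => (hf t).measurable

theorem lintegral_planeCountMeasure {E : Finset ℝ} {f : Plane × E → ℝ≥0∞} (hf : Measurable f) :
    ∫⁻ q, f q ∂(planeCountMeasure E) = ∑ t : E, ∫⁻ x, f (x, t) := by
  rw [planeCountMeasure, lintegral_prod_symm _ hf.aemeasurable, lintegral_count, tsum_fintype]

theorem lossFactor_nonneg {γ : ℝ} (hγ : 1 / 2 ≤ γ) (j : ℕ) : 0 ≤ lossFactor γ j := by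
  unfold lossFactor
  split_ifs
  · positivity
  · exact le_min (div_nonneg (Real.sqrt_nonneg _) (by linarith)) (Nat.cast_nonneg _)

end BilinearWave

/-! ### Extension to a bounded operator on the weighted space -/

namespace BilinearWave

theorem lintegral_bilinearOp_planeCount {χ : Plane → ℝ} (hχ : IsDyadicCutoff χ) {a : Plane → ℂ}
    (ha : ContDiff ℝ 20 a) (hcone : ConeSupported a) (σ : ℝ) (j : ℕ) {E : Finset ℝ}
    (hE : (E : Set ℝ) ⊆ Set.Icc 1 2) {F : Plane × Plane → ℂ} (hF : Integrable F) :
    Measurable (fun q : Plane × E => bilinearOp χ a σ j F q.1 (q.2 : ℝ)) ∧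
    ∫⁻ q, ‖bilinearOp χ a σ j F q.1 (q.2 : ℝ)‖ₑ ^ 2 ∂(planeCountMeasure E) =
      ∑ t ∈ E, ∫⁻ x, ‖bilinearOp χ a σ j F x t‖ₑ ^ 2 := by
  have hm : Measurable (fun q : Plane × E => bilinearOp χ a σ j F q.1 (q.2 : ℝ)) := by
    refine measurable_plane_prod (f := fun q : Plane × E => bilinearOp χ a σ j F q.1 (q.2 : ℝ))
      fun t => ?_
    have ht : 0 < (t : ℝ) := by linarith [(hE t.2).1]
    exact continuous_bilinearOp hχ ha hcone σ j ht hF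
  refine ⟨hm, ?_⟩
  rw [lintegral_planeCountMeasure (hm.enorm.pow_const 2)]
  exact Finset.sum_coe_sort E fun t => ∫⁻ x, ‖bilinearOp χ a σ j F x t‖ₑ ^ 2

/-- If `bilinearOp` satisfies a bound on integrable functions, it extends to the weighted
space. -/
theorem exists_extension {χ : Plane → ℝ} (hχ : IsDyadicCutoff χ) {γ : ℝ} (hγ : 1 / 2 ≤ γ)
    {a : Plane → ℂ} (ha : ContDiff ℝ 20 a) (hcone : ConeSupported a) (σ : ℝ) (j : ℕ)
    {E : Finset ℝ} (hE : (E : Set ℝ) ⊆ Set.Icc 1 2) {A : ℝ} (hA : 0 ≤ A)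
    (hbound : ∀ {F : Plane × Plane → ℂ}, Integrable F → MemLp F 2 (weightedMeasure γ) →
      ∑ t ∈ E, ∫⁻ x, ‖bilinearOp χ a σ j F x t‖ₑ ^ 2 ≤
        ENNReal.ofReal (A ^ 2) * ∫⁻ q, ‖F q‖ₑ ^ 2 ∂(weightedMeasure γ)) :
    ∃ T : Lp ℂ 2 (weightedMeasure γ) →L[ℂ] Lp ℂ 2 (planeCountMeasure E),
      (∀ (F : Plane × Plane → ℂ) (_ : Integrable F volume)
        (hF : MemLp F 2 (weightedMeasure γ)), T (hF.toLp F) =ᵐ[planeCountMeasure E]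
          fun q => bilinearOp χ a σ j F q.1 (q.2 : ℝ)) ∧ ‖T‖ ≤ A := by
  have htpos : ∀ t : E, 0 < (t : ℝ) := fun t => by linarith [(hE t.2).1]
  have hle : ∀ {F : Plane × Plane → ℂ}, Integrable F → MemLp F 2 (weightedMeasure γ) →
      eLpNorm (fun q : Plane × E => bilinearOp χ a σ j F q.1 (q.2 : ℝ)) 2 (planeCountMeasure E) ≤
        ENNReal.ofReal A * eLpNorm F 2 (weightedMeasure γ) := by
    intro F hF1 hF2
    rw [← ENNReal.pow_le_pow_left_iff two_ne_zero, mul_pow, eLpNorm_two_sq, eLpNorm_two_sq,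
      (lintegral_bilinearOp_planeCount hχ ha hcone σ j hE hF1).2, ← ENNReal.ofReal_pow hA]
    exact hbound hF1 hF2
  have hmem : ∀ {F : Plane × Plane → ℂ}, Integrable F → MemLp F 2 (weightedMeasure γ) →
      MemLp (fun q : Plane × E => bilinearOp χ a σ j F q.1 (q.2 : ℝ)) 2 (planeCountMeasure E) :=
    fun hF1 hF2 =>
      ⟨(lintegral_bilinearOp_planeCount hχ ha hcone σ j hE hF1).1.aestronglyMeasurable,
        (hle hF1 hF2).trans_lt (ENNReal.mul_lt_top ENNReal.ofReal_lt_top hF2.2)⟩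
  have hm := fun f : integrableSubmodule γ => hmem f.2 (Lp.memLp (f : Lp ℂ 2 (weightedMeasure γ)))
  -- The formula applied to the chosen representatives. These are additive and homogeneous only
  -- almost everywhere, which is harmless because the integral depends on the Lebesgue class alone.
  let T₀ : integrableSubmodule γ →ₗ[ℂ] Lp ℂ 2 (planeCountMeasure E) :=
    { toFun := fun f => (hm f).toLp _
      map_add' := fun f g => by
        rw [← MemLp.toLp_add]
        refine MemLp.toLp_congr _ _ (Filter.Eventually.of_forall fun q => ?_)
        have h := (absolutelyContinuous_weightedMeasure γ).ae_eq
          (Lp.coeFn_add (f : Lp ℂ 2 (weightedMeasure γ)) g)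
        exact (bilinearOp_congr χ a σ j h q.1 q.2).trans
          (bilinearOp_add hχ ha hcone σ j (htpos q.2) f.2 g.2 q.1)
      map_smul' := fun z f => by
        rw [RingHom.id_apply, ← MemLp.toLp_const_smul]
        refine MemLp.toLp_congr _ _ (Filter.Eventually.of_forall fun q => ?_)
        have h := (absolutelyContinuous_weightedMeasure γ).ae_eq
          (Lp.coeFn_smul z (f : Lp ℂ 2 (weightedMeasure γ)))
        exact (bilinearOp_congr χ a σ j h q.1 q.2).trans
          (bilinearOp_const_mul χ a σ j f z q.1 q.2) }
  have hnorm : ∀ f, ‖T₀ f‖ ≤ A * ‖(integrableSubmodule γ).subtype f‖ := by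
    intro f
    have h := hle f.2 (Lp.memLp (f : Lp ℂ 2 (weightedMeasure γ)))
    change ‖(hm f).toLp _‖ ≤ A * ‖(f : Lp ℂ 2 (weightedMeasure γ))‖
    rw [Lp.norm_toLp, Lp.norm_def]
    refine (ENNReal.toReal_mono (ENNReal.mul_ne_top ENNReal.ofReal_ne_top
      (Lp.eLpNorm_ne_top _)) h).trans (le_of_eq ?_)
    rw [ENNReal.toReal_mul, ENNReal.toReal_ofReal hA]
  have hd := denseRange_integrableSubmodule hγ
  refine ⟨T₀.extendOfNorm (integrableSubmodule γ).subtype, fun F hF1 hF2 => ?_,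
    LinearMap.opNorm_extendOfNorm_le hd hA hnorm⟩
  have hae := (absolutelyContinuous_weightedMeasure γ).ae_eq hF2.coeFn_toLp
  have hFS : hF2.toLp F ∈ integrableSubmodule γ := hF1.congr hae.symm
  have h1 := LinearMap.extendOfNorm_eq hd ⟨A, hnorm⟩ ⟨hF2.toLp F, hFS⟩
  rw [Submodule.subtype_apply] at h1
  rw [h1]
  refine (hm ⟨hF2.toLp F, hFS⟩).coeFn_toLp.trans (Filter.Eventually.of_forall fun q => ?_)
  exact bilinearOp_congr χ a σ j hae q.1 q.2

end BilinearWave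

/-! ### The proposition -/

theorem mainTheorem6 (χ : BilinearWave.Plane → ℝ) (hχ : BilinearWave.IsDyadicCutoff χ) :
    ∃ c : ℝ, 0 < c ∧
      ∀ (γ : ℝ) (_ : 1 / 2 ≤ γ) (_ : γ ≤ 1)
        (a : BilinearWave.Plane → ℂ) (_ : BilinearWave.IsSymbol 0 a)
        (_ : BilinearWave.symbolNorm 0 a ≤ 1)
        (_ : ∀ ξ : BilinearWave.Plane, a ξ ≠ 0 → 0 < ξ 0 ∧ ξ 0 < (2 : ℝ) ^ (-10 : ℤ) * ξ 1)
        (σ : ℝ) (_ : σ = 1 ∨ σ = -1)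
        (j : ℕ) (_ : 1 ≤ j)
        (E : Finset ℝ) (_ : (E : Set ℝ) ⊆ Set.Icc 1 2)
        (_ : BilinearWave.UniformlySeparated ((2 : ℝ) ^ (-(j : ℤ))) E),
        -- `T` is the bounded operator on the whole weighted space given by the integral formula
        -- on its dense subspace of integrable functions.
        ∃ T : Lp ℂ 2 (BilinearWave.weightedMeasure γ) →L[ℂ]
            Lp ℂ 2 (BilinearWave.planeCountMeasure E),
          (∀ (F : BilinearWave.Plane × BilinearWave.Plane → ℂ)
              (_ : Integrable F volume)
              (hF : MemLp F 2 (BilinearWave.weightedMeasure γ)),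
              T (hF.toLp F) =ᵐ[BilinearWave.planeCountMeasure E]
                fun q => BilinearWave.bilinearOp χ a σ j F q.1 (q.2 : ℝ)) ∧
          ‖T‖ₑ ≤ ENNReal.ofReal (c * BilinearWave.lossFactor γ j * 2 ^ j) *
            BilinearWave.assouadChar γ (E : Set ℝ) ((2 : ℝ) ^ (-(j : ℤ))) ^ (1 / 2 : ℝ) := by
  obtain ⟨K, hK, hmain⟩ := BilinearWave.exists_sum_lintegral_bilinearOp_le hχ
  -- The constant K bounds squared norms and depends only on χ, through the bound for its gradient,
  -- and on the fixed bump.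
  refine ⟨Real.sqrt K, Real.sqrt_pos.2 hK, ?_⟩
  intro γ hγ0 hγ1 a ha hnorm hcone σ hσ j hj E hE hsep
  set X := BilinearWave.assouadChar γ (E : Set ℝ) ((2 : ℝ) ^ (-(j : ℤ))) with hX
  -- For finite E the characteristic is finite, so the real-valued bound via `toReal` loses nothing
  -- when converted back.
  have hXtop : X ≠ ∞ := BilinearWave.assouadChar_ne_top (by linarith) (by positivity) E
  have hX0 : 0 ≤ X.toReal := ENNReal.toReal_nonneg
  have hloss := BilinearWave.lossFactor_nonneg hγ0 j
  have hB : 0 ≤ Real.sqrt K * BilinearWave.lossFactor γ j * 2 ^ j := by positivity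
  have hA2 : (Real.sqrt K * BilinearWave.lossFactor γ j * 2 ^ j * Real.sqrt X.toReal) ^ 2 =
      K * BilinearWave.lossFactor γ j ^ 2 * (2 ^ j) ^ 2 * X.toReal := by
    rw [mul_pow, mul_pow, mul_pow, Real.sq_sqrt hK.le, Real.sq_sqrt hX0]
  obtain ⟨T, hT, hTnorm⟩ := BilinearWave.exists_extension hχ hγ0 ha.1 hcone σ j hE
    (A := Real.sqrt K * BilinearWave.lossFactor γ j * 2 ^ j * Real.sqrt X.toReal) (by positivity)
    fun hF1 hF2 => by
      rw [hA2]
      exact hmain hγ0 hγ1 ha.1 hnorm hcone hσ hj hE hsep hF1 hF2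
  refine ⟨T, hT, ?_⟩
  rw [← ofReal_norm]
  refine (ENNReal.ofReal_le_ofReal hTnorm).trans (le_of_eq ?_)
  rw [ENNReal.ofReal_mul hB, Real.sqrt_eq_rpow X.toReal,
    ← ENNReal.ofReal_rpow_of_nonneg hX0 (by norm_num), ENNReal.ofReal_toReal hXtop]
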